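/- Let $\Sigma$ be the category of the finite sets $\underline{n}=\{1,\dots,n\}$, $n\ge 0$, and bijections, symmetric monoidal under concatenation with the shuffle permutations as symmetry. Let $\mathcal J$ be the category whose objects are pairs $(\underline m,\underline n)$ and whose morphisms $(\underline m,\underline n)\to(\underline k,\underline l)$ are triples $(\varphi,\psi,\alpha)$ with $\varphi\colon\underline m\to\underline k$ and $\psi\colon\underline n\to\underline l$ injections and $\alpha\colon \underline k\setminus\varphi(\underline m)\to\underline l\setminus\psi(\underline n)$ a bijection; composition takes as bijection the disjoint union of the induced bijections, and $\mathcal J$ is symmetric monoidal under concatenation in both entries, with symmetry given by shuffles. Let $j\colon\Sigma\times\Sigma\to\mathcal J$ be the embedding. Let $\mathcal C$ be a cocomplete symmetric monoidal category whose tensor product preserves colimits separately in each variable. Give $\mathcal C^{\mathcal J}$, $\mathcal C^{\Sigma}$ and $(\mathcal C^\Sigma)^\Sigma$ the Day convolution symmetric monoidal structures. Let $T=(\emptyset,\mathbf 1,\emptyset,\emptyset,\dots)\in\mathcal C^\Sigma$ be the symmetric sequence with the tensor unit in degree $1$ and the initial object in every other degree, and let $\mathrm{Sym}(T)=(\mathbf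 1,T,T^{\otimes 2},T^{\otimes 3},\dots)$, with $\Sigma_n$ permuting the factors of $T^{\otimes n}$ and with concatenation as multiplication, a commutative monoid in $(\mathcal C^\Sigma)^\Sigma$. Let $\mathsf{Spt}^\Sigma_T(\mathcal C^\Sigma)$ be the category of $\mathrm{Sym}(T)$-modules in $(\mathcal C^\Sigma)^\Sigma$, symmetric monoidal under the relative tensor product $\otimes_{\mathrm{Sym}(T)}$. Then $\mathcal C^{\mathcal J}$ and $\mathsf{Spt}^\Sigma_T(\mathcal C^\Sigma)$ are naturally equivalent as symmetric monoidal categories: there is an equivalence of categories $e\colon\mathcal C^{\mathcal J}\to\mathsf{Spt}^\Sigma_T(\mathcal C^\Sigma)$ with the structure of a (strong) symmetric monoidal functor, together with an isomorphism, natural in $X\in\mathcal C^{\mathcal J}$, between the object of $(\mathcal C^\Sigma)^\Sigma$ that underlies $e(X)$ and the restriction $j^*X$, $(j^*X)_{i,n}=X(\underline i,\underline n)$, such that, under this identification, 1. the maps $X(\underline i,\underline n)\to X(\underline{i+1},\underline{n+1})$ that correspond to the bonding maps $e(X)_i\otimes T\to e(X)_{i+1}$ are the images under $X$ of the standard maps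 $(\underline i,\underline n)\to(\underline{i+1},\underline{n+1})$ (the standard inclusions with the unique bijection of their complements); 2. for $X,Y\in\mathcal C^{\mathcal J}$, the composite of the canonical map $X(\underline i,\underline n)\otimes Y(\underline k,\underline l)\to (e(X)\otimes_{\mathrm{Sym}(T)}e(Y))_{i+k,n+l}$ with the monoidal structure isomorphism $e(X)\otimes_{\mathrm{Sym}(T)}e(Y)\cong e(X\otimes Y)$ is the canonical map $X(\underline i,\underline n)\otimes Y(\underline k,\underline l)\to(X\otimes Y)(\underline{i+k},\underline{n+l})$ of the Day convolution. -/

import Mathlib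

open CategoryTheory MonoidalCategory Limits

universe w v u

set_option linter.unusedSectionVars false

noncomputable section

namespace JSpectra

/-- A morphism of pairs of sets `(A, B) → (A', B')`: two injections `fst : A → A'`,
`snd : B → B'` and a bijection `A' ∖ fst A ≃ B' ∖ snd B`. -/
structure JHom (A B A' B' : Type) where
  fst : A ↪ A'
  snd : B ↪ B'
  bij : ↥(Set.range fst)ᶜ ≃ ↥(Set.range snd)ᶜ

/-- The complement of a composite of injections is the disjoint union of the complements. -/
def complComp {A A' A'' : Type} (f : A ↪ A') (g : A' ↪ A'') :
    ↥(Set.range f)ᶜ ⊕ ↥(Set.range g)ᶜ ≃ ↥(Set.range (f.trans g))ᶜ :=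
  Equiv.ofBijective
    (Sum.elim
      (fun y => ⟨g y.1, by
        rintro ⟨a, ha⟩
        exact y.2 ⟨a, g.injective ha⟩⟩)
      (fun z => ⟨z.1, by
        rintro ⟨a, ha⟩
        exact z.2 ⟨f a, ha⟩⟩))
    ⟨by
      rintro (⟨y, hy⟩ | ⟨y, hy⟩) (⟨z, hz⟩ | ⟨z, hz⟩) h
      · simpa using h
      · exact absurd ⟨y, by simpa using h⟩ hz
      · exact absurd ⟨z, by simpa using h.symm⟩ hy
      · simpa using h, by
      rintro ⟨x, hx⟩
      by_cases h : x ∈ Set.range g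
      · obtain ⟨y, rfl⟩ := h
        exact ⟨Sum.inl ⟨y, fun ⟨a, ha⟩ => hx ⟨a, by simp [ha]⟩⟩, rfl⟩
      · exact ⟨Sum.inr ⟨x, h⟩, rfl⟩⟩

/-- The complement of a disjoint union of injections is the disjoint union of the complements. -/
def complSum {A A' C C' : Type} (f : A ↪ A') (g : C ↪ C') :
    ↥(Set.range f)ᶜ ⊕ ↥(Set.range g)ᶜ ≃ ↥(Set.range (f.sumMap g))ᶜ :=
  Equiv.ofBijective
    (Sum.elim
      (fun y => ⟨Sum.inl y.1, by
        rintro ⟨a | a, ha⟩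
        · exact y.2 ⟨a, by simpa using ha⟩
        · simp at ha⟩)
      (fun z => ⟨Sum.inr z.1, by
        rintro ⟨a | a, ha⟩
        · simp at ha
        · exact z.2 ⟨a, by simpa using ha⟩⟩))
    ⟨by
      rintro (⟨y, hy⟩ | ⟨y, hy⟩) (⟨z, hz⟩ | ⟨z, hz⟩) h <;>
        simpa using congrArg Subtype.val h, by
      rintro ⟨x | x, hx⟩
      · exact ⟨Sum.inl ⟨x, fun ⟨a, ha⟩ => hx ⟨Sum.inl a, by simp [ha]⟩⟩, rfl⟩
      · exact ⟨Sum.inr ⟨x, fun ⟨a, ha⟩ => hx ⟨Sum.inr a, by simp [ha]⟩⟩, rfl⟩⟩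

namespace JHom

variable {A B A' B' A'' B'' C D C' D' : Type}

lemma ext' {f g : JHom A B A' B'} (h₁ : ∀ a, f.fst a = g.fst a) (h₂ : ∀ b, f.snd b = g.snd b)
    (h₃ : ∀ x hf hg, (f.bij ⟨x, hf⟩ : B') = g.bij ⟨x, hg⟩) : f = g := by
  obtain ⟨f₁, f₂, f₃⟩ := f
  obtain ⟨g₁, g₂, g₃⟩ := g
  obtain rfl : f₁ = g₁ := Function.Embedding.ext h₁
  obtain rfl : f₂ = g₂ := Function.Embedding.ext h₂
  obtain rfl : f₃ = g₃ := by
    ext ⟨x, hx⟩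
    exact h₃ x hx hx
  rfl

/-- A pair of bijections. -/
def ofEquiv (e : A ≃ A') (e' : B ≃ B') : JHom A B A' B' where
  fst := e.toEmbedding
  snd := e'.toEmbedding
  bij :=
    haveI : IsEmpty ↥(Set.range e.toEmbedding)ᶜ := ⟨fun x => x.2 ⟨e.symm x.1, by simp⟩⟩
    haveI : IsEmpty ↥(Set.range e'.toEmbedding)ᶜ := ⟨fun x => x.2 ⟨e'.symm x.1, by simp⟩⟩
    Equiv.equivOfIsEmpty _ _

/-- Composition: the bijection is the disjoint union of the induced bijections. -/
def comp (f : JHom A B A' B') (g : JHom A' B' A'' B'') : JHom A B A'' B'' where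
  fst := f.fst.trans g.fst
  snd := f.snd.trans g.snd
  bij := (complComp f.fst g.fst).symm.trans
    ((f.bij.sumCongr g.bij).trans (complComp f.snd g.snd))

/-- Disjoint union. -/
def sum (f : JHom A B A' B') (g : JHom C D C' D') : JHom (A ⊕ C) (B ⊕ D) (A' ⊕ C') (B' ⊕ D') where
  fst := f.fst.sumMap g.fst
  snd := f.snd.sumMap g.snd
  bij := (complSum f.fst g.fst).symm.trans
    ((f.bij.sumCongr g.bij).trans (complSum f.snd g.snd))

@[simp] lemma ofEquiv_fst (e : A ≃ A') (e' : B ≃ B') (a) : (ofEquiv e e').fst a = e a := rfl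
@[simp] lemma ofEquiv_snd (e : A ≃ A') (e' : B ≃ B') (a) : (ofEquiv e e').snd a = e' a := rfl
@[simp] lemma comp_fst (f : JHom A B A' B') (g : JHom A' B' A'' B'') (a) :
    (f.comp g).fst a = g.fst (f.fst a) := rfl
@[simp] lemma comp_snd (f : JHom A B A' B') (g : JHom A' B' A'' B'') (a) :
    (f.comp g).snd a = g.snd (f.snd a) := rfl
@[simp] lemma sum_fst_inl (f : JHom A B A' B') (g : JHom C D C' D') (a) :
    (f.sum g).fst (Sum.inl a) = Sum.inl (f.fst a) := rfl
@[simp] lemma sum_fst_inr (f : JHom A B A' B') (g : JHom C D C' D') (a) :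
    (f.sum g).fst (Sum.inr a) = Sum.inr (g.fst a) := rfl
@[simp] lemma sum_snd_inl (f : JHom A B A' B') (g : JHom C D C' D') (a) :
    (f.sum g).snd (Sum.inl a) = Sum.inl (f.snd a) := rfl
@[simp] lemma sum_snd_inr (f : JHom A B A' B') (g : JHom C D C' D') (a) :
    (f.sum g).snd (Sum.inr a) = Sum.inr (g.snd a) := rfl

lemma bij_congr (f : JHom A B A' B') {x y : A'} (h : x = y) (hx hy) :
    (f.bij ⟨x, hx⟩ : B') = f.bij ⟨y, hy⟩ := by
  subst h; rfl

lemma comp_bij_map (f : JHom A B A' B') (g : JHom A' B' A'' B'') (y : A')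
    (hy : y ∈ (Set.range f.fst)ᶜ) (h) :
    ((f.comp g).bij ⟨g.fst y, h⟩ : B'') = g.snd (f.bij ⟨y, hy⟩) := by
  have : (complComp f.fst g.fst).symm ⟨g.fst y, h⟩ = Sum.inl ⟨y, hy⟩ := by
    rw [Equiv.symm_apply_eq]; rfl
  change ((complComp f.snd g.snd ((f.bij.sumCongr g.bij)
    ((complComp f.fst g.fst).symm ⟨g.fst y, h⟩)) : ↥(Set.range (f.snd.trans g.snd))ᶜ) : B'') = _
  rw [this]; rfl

lemma comp_bij_compl (f : JHom A B A' B') (g : JHom A' B' A'' B'') (y : A'')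
    (hy : y ∈ (Set.range g.fst)ᶜ) (h) :
    ((f.comp g).bij ⟨y, h⟩ : B'') = g.bij ⟨y, hy⟩ := by
  have : (complComp f.fst g.fst).symm ⟨y, h⟩ = Sum.inr ⟨y, hy⟩ := by
    rw [Equiv.symm_apply_eq]; rfl
  change ((complComp f.snd g.snd ((f.bij.sumCongr g.bij)
    ((complComp f.fst g.fst).symm ⟨y, h⟩)) : ↥(Set.range (f.snd.trans g.snd))ᶜ) : B'') = _
  rw [this]; rfl

lemma sum_bij_inl (f : JHom A B A' B') (g : JHom C D C' D') (y : A')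
    (hy : y ∈ (Set.range f.fst)ᶜ) (h) :
    ((f.sum g).bij ⟨Sum.inl y, h⟩ : B' ⊕ D') = Sum.inl (f.bij ⟨y, hy⟩ : B') := by
  have : (complSum f.fst g.fst).symm ⟨Sum.inl y, h⟩ = Sum.inl ⟨y, hy⟩ := by
    rw [Equiv.symm_apply_eq]; rfl
  change ((complSum f.snd g.snd ((f.bij.sumCongr g.bij)
    ((complSum f.fst g.fst).symm ⟨Sum.inl y, h⟩)) :
      ↥(Set.range (f.snd.sumMap g.snd))ᶜ) : B' ⊕ D') = _
  rw [this]; rfl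

lemma sum_bij_inr (f : JHom A B A' B') (g : JHom C D C' D') (y : C')
    (hy : y ∈ (Set.range g.fst)ᶜ) (h) :
    ((f.sum g).bij ⟨Sum.inr y, h⟩ : B' ⊕ D') = Sum.inr (g.bij ⟨y, hy⟩ : D') := by
  have : (complSum f.fst g.fst).symm ⟨Sum.inr y, h⟩ = Sum.inr ⟨y, hy⟩ := by
    rw [Equiv.symm_apply_eq]; rfl
  change ((complSum f.snd g.snd ((f.bij.sumCongr g.bij)
    ((complSum f.fst g.fst).symm ⟨Sum.inr y, h⟩)) :
      ↥(Set.range (f.snd.sumMap g.snd))ᶜ) : B' ⊕ D') = _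
  rw [this]; rfl

lemma ofEquiv_compl (e : A ≃ A') (e' : B ≃ B') {x : A'}
    (hx : x ∈ (Set.range (ofEquiv e e').fst)ᶜ) : False :=
  hx ⟨e.symm x, by simp⟩

lemma ofEquiv_comp (e : A ≃ A') (e' : B ≃ B') (f : A' ≃ A'') (f' : B' ≃ B'') :
    (ofEquiv e e').comp (ofEquiv f f') = ofEquiv (e.trans f) (e'.trans f') :=
  ext' (fun _ => rfl) (fun _ => rfl) (fun _ _ hg => (ofEquiv_compl _ _ hg).elim)

lemma ofEquiv_sum (e : A ≃ A') (e' : B ≃ B') (f : C ≃ C') (f' : D ≃ D') :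
    (ofEquiv e e').sum (ofEquiv f f') = ofEquiv (e.sumCongr f) (e'.sumCongr f') :=
  ext' (by rintro (a | a) <;> rfl) (by rintro (a | a) <;> rfl)
    (fun _ _ hg => (ofEquiv_compl _ _ hg).elim)

lemma ofEquiv_comp_bij (e : A ≃ A') (e' : B ≃ B') (g : JHom A' B' A'' B'') (x hx hx') :
    (((ofEquiv e e').comp g).bij ⟨x, hx⟩ : B'') = g.bij ⟨x, hx'⟩ :=
  comp_bij_compl _ _ _ _ _

lemma comp_ofEquiv_bij (f : JHom A B A' B') (e : A' ≃ A'') (e' : B' ≃ B'') (x hx hx') :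
    ((f.comp (ofEquiv e e')).bij ⟨x, hx⟩ : B'') = e' (f.bij ⟨e.symm x, hx'⟩) := by
  rw [bij_congr _ (e.apply_symm_apply x).symm hx (by simpa using hx)]
  exact comp_bij_map f (ofEquiv e e') _ _ _

end JHom

/-- Pairs of sets. -/
structure PairType where
  fst : Type
  snd : Type

namespace PairType

instance : Category PairType where
  Hom X Y := JHom X.fst X.snd Y.fst Y.snd
  id X := JHom.ofEquiv (Equiv.refl _) (Equiv.refl _)
  comp f g := f.comp g
  id_comp f := JHom.ext' (fun _ => rfl) (fun _ => rfl)
    (fun x h h' => JHom.ofEquiv_comp_bij _ _ _ _ _ _)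
  comp_id f := JHom.ext' (fun _ => rfl) (fun _ => rfl)
    (fun x h h' => JHom.comp_ofEquiv_bij _ _ _ _ _ h')
  assoc f g h := JHom.ext' (fun _ => rfl) (fun _ => rfl) (by
    intro x hf hg
    by_cases hx : x ∈ Set.range h.fst
    · obtain ⟨x, rfl⟩ := hx
      by_cases hx : x ∈ Set.range g.fst
      · obtain ⟨x, rfl⟩ := hx
        have hx : x ∈ (Set.range f.fst)ᶜ := fun ⟨a, ha⟩ => hf ⟨a, by simp [ha]⟩
        have hx' : g.fst x ∈ (Set.range (f.comp g).fst)ᶜ := fun ⟨a, ha⟩ => hx ⟨a, by simpa using ha⟩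
        rw [JHom.comp_bij_map (f.comp g) h _ hx', JHom.comp_bij_map f g _ hx]
        exact (JHom.comp_bij_map f (g.comp h) x hx hg).symm
      · have hx' : x ∈ (Set.range (f.comp g).fst)ᶜ := fun ⟨a, ha⟩ => hx ⟨_, ha⟩
        have hx2 : h.fst x ∈ (Set.range (g.comp h).fst)ᶜ :=
          fun ⟨a, ha⟩ => hx ⟨a, h.fst.injective ha⟩
        rw [JHom.comp_bij_map (f.comp g) h _ hx', JHom.comp_bij_compl f g _ hx,
          JHom.comp_bij_compl f (g.comp h) _ hx2, JHom.comp_bij_map g h _ hx]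
    · have hx2 : x ∈ (Set.range (g.comp h).fst)ᶜ := fun ⟨a, ha⟩ => hx ⟨_, ha⟩
      rw [JHom.comp_bij_compl (f.comp g) h _ hx, JHom.comp_bij_compl f (g.comp h) _ hx2,
        JHom.comp_bij_compl g h _ hx])

lemma comp_def {X Y Z : PairType} (f : X ⟶ Y) (g : Y ⟶ Z) : f ≫ g = JHom.comp f g := rfl

lemma id_def (X : PairType) :
    𝟙 X = JHom.ofEquiv (Equiv.refl X.fst) (Equiv.refl X.snd) := rfl

/-- The isomorphism given by a pair of bijections. -/
@[simps]
def mkIso {X Y : PairType} (e : X.fst ≃ Y.fst) (e' : X.snd ≃ Y.snd) : X ≅ Y where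
  hom := JHom.ofEquiv e e'
  inv := JHom.ofEquiv e.symm e'.symm
  hom_inv_id := by simp [comp_def, JHom.ofEquiv_comp, id_def]
  inv_hom_id := by simp [comp_def, JHom.ofEquiv_comp, id_def]

lemma sum_comp {A B A' B' A'' B'' C D C' D' C'' D'' : Type}
    (f : JHom A B A' B') (f' : JHom A' B' A'' B'') (g : JHom C D C' D') (g' : JHom C' D' C'' D'') :
    (f.comp f').sum (g.comp g') = (f.sum g).comp (f'.sum g') := by
  refine JHom.ext' (by rintro (a | a) <;> rfl) (by rintro (a | a) <;> rfl) ?_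
  rintro (x | x) h h'
  · have h1 : x ∈ (Set.range (f.comp f').fst)ᶜ := fun ⟨a, ha⟩ => h ⟨Sum.inl a, by rw [← ha]; rfl⟩
    rw [JHom.sum_bij_inl _ _ _ h1]
    by_cases hx : x ∈ Set.range f'.fst
    · obtain ⟨x, rfl⟩ := hx
      have hx : x ∈ (Set.range f.fst)ᶜ := fun ⟨a, ha⟩ => h1 ⟨a, by simp [ha]⟩
      rw [JHom.comp_bij_map _ _ _ hx]
      have hx' : (Sum.inl x : A' ⊕ C') ∈ (Set.range (f.sum g).fst)ᶜ := by
        rintro ⟨a | a, ha⟩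
        · exact hx ⟨a, by simpa using ha⟩
        · simp at ha
      refine Eq.trans ?_ (JHom.comp_bij_map (f.sum g) (f'.sum g') (Sum.inl x) hx' h').symm
      rw [JHom.sum_bij_inl _ _ _ hx]; rfl
    · rw [JHom.comp_bij_compl _ _ _ hx]
      have hx' : (Sum.inl x : A'' ⊕ C'') ∈ (Set.range (f'.sum g').fst)ᶜ := by
        rintro ⟨a | a, ha⟩
        · exact hx ⟨a, by simpa using ha⟩
        · simp at ha
      rw [JHom.comp_bij_compl _ _ _ hx', JHom.sum_bij_inl _ _ _ hx]
  · have h1 : x ∈ (Set.range (g.comp g').fst)ᶜ := fun ⟨a, ha⟩ => h ⟨Sum.inr a, by rw [← ha]; rfl⟩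
    rw [JHom.sum_bij_inr _ _ _ h1]
    by_cases hx : x ∈ Set.range g'.fst
    · obtain ⟨x, rfl⟩ := hx
      have hx : x ∈ (Set.range g.fst)ᶜ := fun ⟨a, ha⟩ => h1 ⟨a, by simp [ha]⟩
      rw [JHom.comp_bij_map _ _ _ hx]
      have hx' : (Sum.inr x : A' ⊕ C') ∈ (Set.range (f.sum g).fst)ᶜ := by
        rintro ⟨a | a, ha⟩
        · simp at ha
        · exact hx ⟨a, by simpa using ha⟩
      refine Eq.trans ?_ (JHom.comp_bij_map (f.sum g) (f'.sum g') (Sum.inr x) hx' h').symm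
      rw [JHom.sum_bij_inr _ _ _ hx]; rfl
    · rw [JHom.comp_bij_compl _ _ _ hx]
      have hx' : (Sum.inr x : A'' ⊕ C'') ∈ (Set.range (f'.sum g').fst)ᶜ := by
        rintro ⟨a | a, ha⟩
        · simp at ha
        · exact hx ⟨a, by simpa using ha⟩
      rw [JHom.comp_bij_compl _ _ _ hx', JHom.sum_bij_inr _ _ _ hx]

/-- Disjoint union of pairs of sets. -/
instance : MonoidalCategoryStruct PairType where
  tensorObj X Y := ⟨X.fst ⊕ Y.fst, X.snd ⊕ Y.snd⟩
  tensorHom f g := JHom.sum f g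
  whiskerLeft X _ _ f := JHom.sum (𝟙 X) f
  whiskerRight f Y := JHom.sum f (𝟙 Y)
  tensorUnit := ⟨Empty, Empty⟩
  associator _ _ _ := mkIso (Equiv.sumAssoc _ _ _) (Equiv.sumAssoc _ _ _)
  leftUnitor _ := mkIso (Equiv.emptySum _ _) (Equiv.emptySum _ _)
  rightUnitor _ := mkIso (Equiv.sumEmpty _ _) (Equiv.sumEmpty _ _)

lemma tensorHom_def' {X Y X' Y' : PairType} (f : X ⟶ Y) (g : X' ⟶ Y') :
    f ⊗ₘ g = JHom.sum f g := rfl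

lemma natural {A B A' B' A'' B'' C D : Type} (f : JHom A B A' B') (e : A' ≃ A'') (e' : B' ≃ B'')
    (d : A ≃ C) (d' : B ≃ D) (g : JHom C D A'' B'')
    (h₁ : ∀ a, e (f.fst a) = g.fst (d a)) (h₂ : ∀ b, e' (f.snd b) = g.snd (d' b))
    (h₃ : ∀ x hx hx', e' (f.bij ⟨x, hx⟩) = g.bij ⟨e x, hx'⟩) :
    f.comp (JHom.ofEquiv e e') = (JHom.ofEquiv d d').comp g := by
  refine JHom.ext' h₁ h₂ ?_
  intro x hf hg
  have hx : e.symm x ∈ (Set.range f.fst)ᶜ := fun ⟨a, ha⟩ => hf ⟨a, by simp [ha]⟩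
  have hx' : x ∈ (Set.range g.fst)ᶜ := fun ⟨a, ha⟩ => hg ⟨d.symm a, by simp [ha]⟩
  rw [JHom.comp_ofEquiv_bij _ _ _ _ _ hx, JHom.ofEquiv_comp_bij _ _ _ _ _ hx',
    h₃ _ hx (by simpa using hx')]
  exact JHom.bij_congr _ (by simp) _ _

lemma inl_compl {A A' C C' : Type} {f : A ↪ A'} {g : C ↪ C'} {x : A'}
    (h : (Sum.inl x : A' ⊕ C') ∈ (Set.range (f.sumMap g))ᶜ) : x ∈ (Set.range f)ᶜ :=
  fun ⟨a, ha⟩ => h ⟨Sum.inl a, by simp [ha]⟩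

lemma inr_compl {A A' C C' : Type} {f : A ↪ A'} {g : C ↪ C'} {x : C'}
    (h : (Sum.inr x : A' ⊕ C') ∈ (Set.range (f.sumMap g))ᶜ) : x ∈ (Set.range g)ᶜ :=
  fun ⟨a, ha⟩ => h ⟨Sum.inr a, by simp [ha]⟩

instance : MonoidalCategory PairType := MonoidalCategory.ofTensorHom
  (id_tensorHom_id := fun X Y => by
    simp only [id_def, tensorHom_def', JHom.ofEquiv_sum]
    congr 1 <;> ext (x | x) <;> rfl)
  (id_tensorHom := fun _ _ _ _ => rfl)
  (tensorHom_id := fun _ _ => rfl)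
  (tensorHom_comp_tensorHom := fun f₁ f₂ g₁ g₂ => (sum_comp f₁ g₁ f₂ g₂).symm)
  (associator_naturality := fun f g h => by
    refine natural (JHom.sum (JHom.sum f g) h) _ _ _ _ (JHom.sum f (JHom.sum g h)) ?_ ?_ ?_
    · rintro ((a | a) | a) <;> rfl
    · rintro ((a | a) | a) <;> rfl
    · rintro ((x | x) | x) hx hx'
      · rw [JHom.sum_bij_inl _ _ _ (inl_compl hx),
          JHom.sum_bij_inl _ _ _ (inl_compl (inl_compl hx))]
        exact (JHom.sum_bij_inl _ _ _ (inl_compl hx') hx').symm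
      · rw [JHom.sum_bij_inl _ _ _ (inl_compl hx),
          JHom.sum_bij_inr _ _ _ (inr_compl (inl_compl hx))]
        refine Eq.trans ?_ (JHom.sum_bij_inr _ _ _ (inr_compl hx') hx').symm
        exact congrArg Sum.inr (JHom.sum_bij_inl _ _ _ _ _).symm
      · rw [JHom.sum_bij_inr _ _ _ (inr_compl hx)]
        refine Eq.trans ?_ (JHom.sum_bij_inr _ _ _ (inr_compl hx') hx').symm
        exact congrArg Sum.inr (JHom.sum_bij_inr _ _ _ _ _).symm)
  (leftUnitor_naturality := fun {X Y} f => by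
    refine natural (JHom.sum (𝟙 (𝟙_ PairType)) f) _ _ _ _ f ?_ ?_ ?_
    · rintro (a | a)
      · exact a.elim
      · rfl
    · rintro (a | a)
      · exact a.elim
      · rfl
    · rintro (x | x) hx hx'
      · exact x.elim
      · exact congrArg (Equiv.emptySum Empty Y.snd) (JHom.sum_bij_inr (𝟙 (𝟙_ PairType)) f x hx' hx))
  (rightUnitor_naturality := fun {X Y} f => by
    refine natural (JHom.sum f (𝟙 (𝟙_ PairType))) _ _ _ _ f ?_ ?_ ?_
    · rintro (a | a)
      · rfl
      · exact a.elim
    · rintro (a | a)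
      · rfl
      · exact a.elim
    · rintro (x | x) hx hx'
      · exact congrArg (Equiv.sumEmpty Y.snd Empty) (JHom.sum_bij_inl f (𝟙 (𝟙_ PairType)) x hx' hx)
      · exact x.elim)
  (pentagon := fun W X Y Z => by
    simp only [comp_def, tensorHom_def', id_def]
    change (JHom.sum (JHom.ofEquiv _ _) (JHom.ofEquiv _ _)).comp
      ((JHom.ofEquiv _ _).comp (JHom.sum (JHom.ofEquiv _ _) (JHom.ofEquiv _ _))) =
      (JHom.ofEquiv _ _).comp (JHom.ofEquiv _ _)
    rw [JHom.ofEquiv_sum, JHom.ofEquiv_sum, JHom.ofEquiv_comp, JHom.ofEquiv_comp,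
      JHom.ofEquiv_comp]
    congr 1 <;> ext (((x | x) | x) | x) <;> rfl)
  (triangle := fun X Y => by
    simp only [comp_def, tensorHom_def', id_def]
    change (JHom.ofEquiv _ _).comp (JHom.sum (JHom.ofEquiv _ _) (JHom.ofEquiv _ _)) =
      JHom.sum (JHom.ofEquiv _ _) (JHom.ofEquiv _ _)
    rw [JHom.ofEquiv_sum, JHom.ofEquiv_sum, JHom.ofEquiv_comp]
    congr 1 <;> ext ((x | x) | x) <;> first | rfl | exact x.elim)

lemma braid_natural {A B A' B' C D C' D' : Type} (f : JHom A B A' B') (g : JHom C D C' D') :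
    (f.sum g).comp (JHom.ofEquiv (Equiv.sumComm _ _) (Equiv.sumComm _ _)) =
      (JHom.ofEquiv (Equiv.sumComm _ _) (Equiv.sumComm _ _)).comp (g.sum f) := by
  refine natural _ _ _ _ _ _ (by rintro (a | a) <;> rfl) (by rintro (a | a) <;> rfl) ?_
  rintro (x | x) hx hx'
  · rw [JHom.sum_bij_inl _ _ _ (inl_compl hx)]
    exact (JHom.sum_bij_inr _ _ _ (inr_compl hx') hx').symm
  · rw [JHom.sum_bij_inr _ _ _ (inr_compl hx)]
    exact (JHom.sum_bij_inl _ _ _ (inl_compl hx') hx').symm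

instance : SymmetricCategory PairType where
  braiding X Y := mkIso (Equiv.sumComm _ _) (Equiv.sumComm _ _)
  braiding_naturality_right X _ _ f := braid_natural (𝟙 X) f
  braiding_naturality_left f Z := braid_natural f (𝟙 Z)
  hexagon_forward X Y Z := by
    change (JHom.ofEquiv _ _).comp ((JHom.ofEquiv _ _).comp (JHom.ofEquiv _ _)) =
      (JHom.sum (JHom.ofEquiv _ _) (JHom.ofEquiv _ _)).comp ((JHom.ofEquiv _ _).comp
        (JHom.sum (JHom.ofEquiv _ _) (JHom.ofEquiv _ _)))
    simp only [JHom.ofEquiv_sum, JHom.ofEquiv_comp]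
    congr 1 <;> ext ((x | x) | x) <;> rfl
  hexagon_reverse X Y Z := by
    change (JHom.ofEquiv _ _).comp ((JHom.ofEquiv _ _).comp (JHom.ofEquiv _ _)) =
      (JHom.sum (JHom.ofEquiv _ _) (JHom.ofEquiv _ _)).comp ((JHom.ofEquiv _ _).comp
        (JHom.sum (JHom.ofEquiv _ _) (JHom.ofEquiv _ _)))
    simp only [JHom.ofEquiv_sum, JHom.ofEquiv_comp]
    congr 1 <;> ext (x | (x | x)) <;> rfl
  symmetry X Y := by
    change (JHom.ofEquiv _ _).comp (JHom.ofEquiv _ _) = JHom.ofEquiv _ _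
    simp only [JHom.ofEquiv_comp]
    congr 1 <;> ext (x | x) <;> rfl

end PairType

/-! ### The category `J` -/

/-- The category `J`: objects are pairs `(m, n)` of natural numbers, standing for the pair of
finite sets `({1,…,m}, {1,…,n})`. -/
@[ext]
structure J where
  fst : ℕ
  snd : ℕ

namespace J

/-- The pair of finite sets of an object of `J`. -/
abbrev pair (X : J) : PairType := ⟨Fin X.fst, Fin X.snd⟩

instance : Category J where
  Hom X Y := JHom (Fin X.fst) (Fin X.snd) (Fin Y.fst) (Fin Y.snd)
  id X := 𝟙 X.pair
  comp {X Y Z} f g := CategoryStruct.comp (X := X.pair) (Y := Y.pair) (Z := Z.pair) f g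
  id_comp {X Y} f := Category.id_comp (X := X.pair) (Y := Y.pair) f
  comp_id {X Y} f := Category.comp_id (X := X.pair) (Y := Y.pair) f
  assoc {W X Y Z} f g h :=
    Category.assoc (W := W.pair) (X := X.pair) (Y := Y.pair) (Z := Z.pair) f g h

/-- `J` as a full subcategory of pairs of sets. -/
def toPair : J ⥤ PairType where
  obj X := X.pair
  map f := f

instance : toPair.Faithful where
  map_injective h := h

/-- The isomorphism of `J` given by a pair of bijections. -/
@[simps]
def mkIso {X Y : J} (e : Fin X.fst ≃ Fin Y.fst) (e' : Fin X.snd ≃ Fin Y.snd) : X ≅ Y where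
  hom := JHom.ofEquiv e e'
  inv := JHom.ofEquiv e.symm e'.symm
  hom_inv_id := (PairType.mkIso (X := X.pair) (Y := Y.pair) e e').hom_inv_id
  inv_hom_id := (PairType.mkIso (X := X.pair) (Y := Y.pair) e e').inv_hom_id

/-- Concatenation on objects. -/
abbrev tensor (X Y : J) : J := ⟨X.fst + Y.fst, X.snd + Y.snd⟩

/-- Concatenation on morphisms, through `{1,…,m} ⊔ {1,…,m'} ≃ {1,…,m+m'}`. -/
def tensorMap {X Y X' Y' : J} (f : X ⟶ Y) (g : X' ⟶ Y') : tensor X X' ⟶ tensor Y Y' :=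
  (JHom.ofEquiv finSumFinEquiv.symm finSumFinEquiv.symm).comp
    ((JHom.sum f g).comp (JHom.ofEquiv finSumFinEquiv finSumFinEquiv))

instance : MonoidalCategoryStruct J where
  tensorObj := tensor
  tensorHom := tensorMap
  whiskerLeft X _ _ f := tensorMap (𝟙 X) f
  whiskerRight f Y := tensorMap f (𝟙 Y)
  tensorUnit := ⟨0, 0⟩
  associator X Y Z := mkIso (finCongr (Nat.add_assoc X.fst Y.fst Z.fst))
    (finCongr (Nat.add_assoc X.snd Y.snd Z.snd))
  leftUnitor X := mkIso (finCongr (Nat.zero_add X.fst)) (finCongr (Nat.zero_add X.snd))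
  rightUnitor X := mkIso (finCongr (Nat.add_zero X.fst)) (finCongr (Nat.add_zero X.snd))

end J

lemma finSum_assoc (a b c : ℕ) : finCongr (Nat.add_assoc a b c) =
    ((finSumFinEquiv.symm.trans (finSumFinEquiv.symm.sumCongr (Equiv.refl _))).trans
      (Equiv.sumAssoc (Fin a) (Fin b) (Fin c))).trans
      (((Equiv.refl _).sumCongr finSumFinEquiv).trans finSumFinEquiv) := by
  ext x
  obtain ⟨x, rfl⟩ := finSumFinEquiv.surjective x
  obtain x | x := x
  · obtain ⟨x, rfl⟩ := finSumFinEquiv.surjective x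
    obtain x | x := x <;> simp
  · simp [Nat.add_assoc]

lemma finSum_zero_add (e : Fin 0 ≃ Empty) (a : ℕ) : finCongr (Nat.zero_add a) =
    (finSumFinEquiv.symm.trans (e.sumCongr (Equiv.refl _))).trans
      (Equiv.emptySum Empty (Fin a)) := by
  ext x
  obtain ⟨x, rfl⟩ := finSumFinEquiv.surjective x
  obtain x | x := x
  · exact x.elim0
  · rw [Equiv.trans_apply, Equiv.trans_apply, Equiv.symm_apply_apply]; simp

lemma finSum_add_zero (e : Fin 0 ≃ Empty) (a : ℕ) : finCongr (Nat.add_zero a) =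
    (finSumFinEquiv.symm.trans ((Equiv.refl _).sumCongr e)).trans
      (Equiv.sumEmpty (Fin a) Empty) := by
  ext x
  obtain ⟨x, rfl⟩ := finSumFinEquiv.surjective x
  obtain x | x := x
  · rw [Equiv.trans_apply, Equiv.trans_apply, Equiv.symm_apply_apply]; rfl
  · exact x.elim0

namespace JHom

variable {A B A₁ B₁ A₂ B₂ A₃ B₃ A₄ B₄ C D C₁ D₁ C₂ D₂ E F E₁ F₁ : Type}

lemma assoc_eq (a : A ≃ A₁ ⊕ C₁) (a' : B ≃ B₁ ⊕ D₁) (b : A₁ ≃ A₂) (b' : B₁ ≃ B₂) (c : C₁ ≃ C₂)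
    (c' : D₁ ≃ D₂) (d : A₂ ⊕ C₂ ≃ E ⊕ E₁) (d' : B₂ ⊕ D₂ ≃ F ⊕ F₁) (e : E ≃ A₃) (e' : F ≃ B₃)
    (f : E₁ ≃ A₄) (f' : F₁ ≃ B₄) (g : A₃ ⊕ A₄ ≃ C) (g' : B₃ ⊕ B₄ ≃ D) :
    ofEquiv (((a.trans (b.sumCongr c)).trans d).trans ((e.sumCongr f).trans g))
      (((a'.trans (b'.sumCongr c')).trans d').trans ((e'.sumCongr f').trans g')) =
    ((ofEquiv a a').comp ((ofEquiv b b').sum (ofEquiv c c'))).comp ((ofEquiv d d').comp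
      (((ofEquiv e e').sum (ofEquiv f f')).comp (ofEquiv g g'))) := by
  simp only [ofEquiv_sum, ofEquiv_comp]; rfl

lemma unitor_eq (a : A ≃ A₁ ⊕ C₁) (a' : B ≃ B₁ ⊕ D₁) (b : A₁ ≃ A₂) (b' : B₁ ≃ B₂) (c : C₁ ≃ C₂)
    (c' : D₁ ≃ D₂) (d : A₂ ⊕ C₂ ≃ E) (d' : B₂ ⊕ D₂ ≃ F) :
    ofEquiv ((a.trans (b.sumCongr c)).trans d) ((a'.trans (b'.sumCongr c')).trans d') =
    ((ofEquiv a a').comp ((ofEquiv b b').sum (ofEquiv c c'))).comp (ofEquiv d d') := by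
  simp only [ofEquiv_sum, ofEquiv_comp]

lemma tensor_eq (a : A ≃ A₁ ⊕ C₁) (a' : B ≃ B₁ ⊕ D₁) (b : A₁ ≃ A₂) (b' : B₁ ≃ B₂) (c : C₁ ≃ C₂)
    (c' : D₁ ≃ D₂) (d : A₂ ⊕ C₂ ≃ E) (d' : B₂ ⊕ D₂ ≃ F) :
    ofEquiv (a.trans ((b.sumCongr c).trans d)) (a'.trans ((b'.sumCongr c').trans d')) =
    (ofEquiv a a').comp (((ofEquiv b b').sum (ofEquiv c c')).comp (ofEquiv d d')) := by
  simp only [ofEquiv_sum, ofEquiv_comp]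

lemma square_eq (a : A ≃ A₁) (a' : B ≃ B₁) (b : A₁ ≃ A₂) (b' : B₁ ≃ B₂)
    (c : A ≃ C) (c' : B ≃ D) (d : C ≃ A₂) (d' : D ≃ B₂) (h : ∀ x, b (a x) = d (c x))
    (h' : ∀ x, b' (a' x) = d' (c' x)) :
    (ofEquiv a a').comp (ofEquiv b b') = (ofEquiv c c').comp (ofEquiv d d') := by
  simp only [ofEquiv_comp]
  exact congrArg₂ _ (Equiv.ext h) (Equiv.ext h')

end JHom

/-- The shuffle permutation `{1,…,m+n} ≃ {1,…,n+m}` exchanging the two blocks. -/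
def shuffle (m n : ℕ) : Fin (m + n) ≃ Fin (n + m) :=
  finSumFinEquiv.symm.trans ((Equiv.sumComm _ _).trans finSumFinEquiv)

lemma shuffle_sum (m n : ℕ) (x : Fin m ⊕ Fin n) :
    shuffle m n (finSumFinEquiv x) = finSumFinEquiv (Equiv.sumComm _ _ x) := by
  simp [shuffle]

namespace J

/-- The coherence axioms of `J` are those of pairs of sets. -/
def inducing : Monoidal.InducingFunctorData toPair where
  μIso X Y := PairType.mkIso (X := X.pair ⊗ Y.pair) (Y := (tensor X Y).pair)
    (finSumFinEquiv (m := X.fst) (n := Y.fst)) (finSumFinEquiv (m := X.snd) (n := Y.snd))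
  εIso := PairType.mkIso (X := ⟨Empty, Empty⟩) (Y := ⟨Fin 0, Fin 0⟩)
    (Equiv.equivOfIsEmpty Empty (Fin 0)) (Equiv.equivOfIsEmpty Empty (Fin 0))
  whiskerLeft_eq _ _ _ _ := rfl
  whiskerRight_eq _ _ := rfl
  tensorHom_eq _ _ := rfl
  associator_eq X Y Z := (congrArg₂ JHom.ofEquiv (finSum_assoc X.fst Y.fst Z.fst)
    (finSum_assoc X.snd Y.snd Z.snd)).trans (JHom.assoc_eq _ _ _ _ _ _ _ _ _ _ _ _ _ _)
  leftUnitor_eq X := (congrArg₂ JHom.ofEquiv (finSum_zero_add _ X.fst)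
    (finSum_zero_add _ X.snd)).trans (JHom.unitor_eq _ _ _ _ _ _ _ _)
  rightUnitor_eq X := (congrArg₂ JHom.ofEquiv (finSum_add_zero _ X.fst)
    (finSum_add_zero _ X.snd)).trans (JHom.unitor_eq _ _ _ _ _ _ _ _)

instance : MonoidalCategory J := Monoidal.induced toPair inducing

instance : toPair.Monoidal := Monoidal.fromInducedMonoidal toPair inducing

lemma toPair_braided (X Y : J) : Functor.LaxMonoidal.μ toPair X Y ≫
    toPair.map (mkIso (X := X ⊗ Y) (Y := Y ⊗ X) (shuffle X.fst Y.fst) (shuffle X.snd Y.snd)).hom =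
    (β_ (toPair.obj X) (toPair.obj Y)).hom ≫ Functor.LaxMonoidal.μ toPair Y X :=
  JHom.square_eq _ _ _ _ _ _ _ _ (shuffle_sum _ _) (shuffle_sum _ _)

instance : BraidedCategory J := .ofFaithful toPair
  (fun X Y => mkIso (shuffle X.fst Y.fst) (shuffle X.snd Y.snd)) toPair_braided

instance : toPair.Braided where
  braided := toPair_braided

instance : SymmetricCategory J := .ofFaithful toPair

end J

/-! ### The category `Σ` -/

/-- The category `Σ`: objects are natural numbers `n`, standing for the finite set `{1,…,n}`,
morphisms are bijections. -/
@[ext]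
structure Sym where
  n : ℕ

namespace Sym

instance : Category Sym where
  Hom X Y := Fin X.n ≃ Fin Y.n
  id _ := Equiv.refl _
  comp f g := Equiv.trans f g

/-- An isomorphism of `Σ`. -/
@[simps]
def mkIso {X Y : Sym} (e : Fin X.n ≃ Fin Y.n) : X ≅ Y where
  hom := e
  inv := e.symm
  hom_inv_id := Equiv.self_trans_symm e
  inv_hom_id := Equiv.symm_trans_self e

/-- Juxtaposition of bijections. -/
def blockSum {m m' n n' : ℕ} (e : Fin m ≃ Fin m') (f : Fin n ≃ Fin n') :
    Fin (m + n) ≃ Fin (m' + n') :=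
  finSumFinEquiv.symm.trans ((e.sumCongr f).trans finSumFinEquiv)

instance : MonoidalCategoryStruct Sym where
  tensorObj X Y := ⟨X.n + Y.n⟩
  tensorHom f g := blockSum f g
  whiskerLeft X _ _ f := blockSum (Equiv.refl (Fin X.n)) f
  whiskerRight f Y := blockSum f (Equiv.refl (Fin Y.n))
  tensorUnit := ⟨0⟩
  associator X Y Z := mkIso (finCongr (Nat.add_assoc X.n Y.n Z.n))
  leftUnitor X := mkIso (finCongr (Nat.zero_add X.n))
  rightUnitor X := mkIso (finCongr (Nat.add_zero X.n))

/-- A finite set as the first member of a pair of sets. -/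
def toPair : Sym ⥤ PairType where
  obj X := ⟨Fin X.n, Empty⟩
  map {X Y} f := JHom.ofEquiv (A := Fin X.n) (A' := Fin Y.n) f (Equiv.refl Empty)
  map_comp {X Y Z} f g := (JHom.ofEquiv_comp (A := Fin X.n) (A' := Fin Y.n) (A'' := Fin Z.n)
    f (Equiv.refl Empty) g (Equiv.refl Empty)).symm

instance : toPair.Faithful where
  map_injective {X Y} f g h := by
    refine Equiv.ext fun (x : Fin X.n) => ?_
    exact DFunLike.congr_fun (F := Fin X.n ↪ Fin Y.n) (congrArg JHom.fst h) x

/-- The coherence axioms of `Σ` are those of pairs of sets. -/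
def inducing : Monoidal.InducingFunctorData toPair where
  μIso X Y := PairType.mkIso (X := ⟨Fin X.n ⊕ Fin Y.n, Empty ⊕ Empty⟩) (Y := ⟨Fin (X.n + Y.n), Empty⟩)
    finSumFinEquiv (Equiv.equivOfIsEmpty (Empty ⊕ Empty) Empty)
  εIso := PairType.mkIso (X := ⟨Empty, Empty⟩) (Y := ⟨Fin 0, Empty⟩)
    (Equiv.equivOfIsEmpty Empty (Fin 0)) (Equiv.refl Empty)
  whiskerLeft_eq _ _ _ _ := (congrArg (JHom.ofEquiv _) (Subsingleton.elim (α := Empty ≃ Empty) _ _)).trans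
    (JHom.tensor_eq _ _ _ _ _ _ _ _)
  whiskerRight_eq _ _ := (congrArg (JHom.ofEquiv _) (Subsingleton.elim (α := Empty ≃ Empty) _ _)).trans
    (JHom.tensor_eq _ _ _ _ _ _ _ _)
  tensorHom_eq _ _ := (congrArg (JHom.ofEquiv _) (Subsingleton.elim (α := Empty ≃ Empty) _ _)).trans
    (JHom.tensor_eq _ _ _ _ _ _ _ _)
  associator_eq X Y Z := (congrArg₂ JHom.ofEquiv (finSum_assoc X.n Y.n Z.n)
    (Subsingleton.elim (α := Empty ≃ Empty) _ _)).trans (JHom.assoc_eq _ _ _ _ _ _ _ _ _ _ _ _ _ _)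
  leftUnitor_eq X := (congrArg₂ JHom.ofEquiv (finSum_zero_add _ X.n)
    (Subsingleton.elim (α := Empty ≃ Empty) _ _)).trans (JHom.unitor_eq _ _ _ _ _ _ _ _)
  rightUnitor_eq X := (congrArg₂ JHom.ofEquiv (finSum_add_zero _ X.n)
    (Subsingleton.elim (α := Empty ≃ Empty) _ _)).trans (JHom.unitor_eq _ _ _ _ _ _ _ _)

instance : MonoidalCategory Sym := Monoidal.induced toPair inducing

instance : toPair.Monoidal := Monoidal.fromInducedMonoidal toPair inducing

lemma toPair_braided (X Y : Sym) : Functor.LaxMonoidal.μ toPair X Y ≫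
    toPair.map (mkIso (X := X ⊗ Y) (Y := Y ⊗ X) (shuffle X.n Y.n)).hom =
    (β_ (toPair.obj X) (toPair.obj Y)).hom ≫ Functor.LaxMonoidal.μ toPair Y X :=
  JHom.square_eq _ _ _ _ _ _ _ _ (shuffle_sum _ _) (fun x => (x.elim Empty.elim Empty.elim))

instance : BraidedCategory Sym := .ofFaithful toPair
  (fun X Y => mkIso (shuffle X.n Y.n)) toPair_braided

instance : toPair.Braided where
  braided := toPair_braided

instance : SymmetricCategory Sym := .ofFaithful toPair

end Sym

/-- The embedding `Σ × Σ ⥤ J`. -/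
def incl : Sym × Sym ⥤ J where
  obj X := ⟨X.1.n, X.2.n⟩
  map {X Y} f := JHom.ofEquiv (A := Fin X.1.n) (A' := Fin Y.1.n) (B := Fin X.2.n)
    (B' := Fin Y.2.n) f.1 f.2
  map_comp _ _ := (JHom.ofEquiv_comp _ _ _ _).symm

section Day

open LawfulDayConvolutionMonoidalCategoryStruct
open scoped MonoidalCategory.ExternalProduct
open scoped DayConvolution

section Abstract

attribute [local instance] convolution convolution₂ convolution₂' convolutionUnit

variable (K : Type) [Category.{0} K] [MonoidalCategory K] [SymmetricCategory K]
  (V : Type u) [Category.{v} V] [MonoidalCategory V] [SymmetricCategory V]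
  [∀ (v : V) (d : K), PreservesColimitsOfShape (CostructuredArrow (tensor K) d) (tensorLeft v)]
  [∀ (v : V) (d : K), PreservesColimitsOfShape (CostructuredArrow (tensor K) d) (tensorRight v)]
  {D : Type w} [Category.{v} D] [MonoidalCategory D]
  [LawfulDayConvolutionMonoidalCategoryStruct K V D]

lemma ι_assoc_inv (X Y Z : D) : (ι K V D).map (α_ X Y Z).inv =
      (DayConvolution.associator ((ι K V D).obj X) ((ι K V D).obj Y) ((ι K V D).obj Z)).inv :=
  congrArg Iso.inv (Iso.ext (α := (ι K V D).mapIso (α_ X Y Z))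
    (β := DayConvolution.associator ((ι K V D).obj X) ((ι K V D).obj Y) ((ι K V D).obj Z))
    (ι_map_associator_hom_eq_associator_hom K V D X Y Z))

/-- A braiding for a Day convolution monoidal structure, from those of source and target. -/
@[reducible]
def braidedOfDay (β : ∀ F G : D, F ⊗ G ≅ G ⊗ F)
    (hβ : ∀ F G : D, (ι K V D).map (β F G).hom =
      (DayConvolution.braiding ((ι K V D).obj F) ((ι K V D).obj G)).hom) :
    SymmetricCategory D where
  braiding := β
  braiding_naturality_right F G H f := by
    apply (ι K V D).map_injective
    simp only [CategoryTheory.Functor.map_comp, ← id_tensorHom, ← tensorHom_id, hβ,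
      ι_map_tensorHom_hom_eq_tensorHom, CategoryTheory.Functor.map_id]
    exact DayConvolution.braiding_naturality_right _ _
  braiding_naturality_left f H := by
    apply (ι K V D).map_injective
    simp only [CategoryTheory.Functor.map_comp, ← id_tensorHom, ← tensorHom_id, hβ,
      ι_map_tensorHom_hom_eq_tensorHom, CategoryTheory.Functor.map_id]
    exact DayConvolution.braiding_naturality_left _ _
  hexagon_forward F G H := by
    apply (ι K V D).map_injective
    simp only [CategoryTheory.Functor.map_comp, ← id_tensorHom, ← tensorHom_id, hβ,
      ι_map_tensorHom_hom_eq_tensorHom, CategoryTheory.Functor.map_id,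
      ι_map_associator_hom_eq_associator_hom]
    exact DayConvolution.hexagon_forward ((ι K V D).obj F) ((ι K V D).obj G) ((ι K V D).obj H)
  hexagon_reverse F G H := by
    apply (ι K V D).map_injective
    simp only [CategoryTheory.Functor.map_comp, ← id_tensorHom, ← tensorHom_id, hβ,
      ι_map_tensorHom_hom_eq_tensorHom, CategoryTheory.Functor.map_id, ι_assoc_inv]
    exact DayConvolution.hexagon_reverse ((ι K V D).obj F) ((ι K V D).obj G) ((ι K V D).obj H)
  symmetry F G := by
    apply (ι K V D).map_injective
    simp only [CategoryTheory.Functor.map_comp, hβ]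
    exact (DayConvolution.symmetry _ _).trans (CategoryTheory.Functor.map_id _ _).symm

end Abstract

variable (K : Type) [Category.{0} K] [MonoidalCategory K] [SymmetricCategory K]
  (V : Type u) [Category.{v} V] [MonoidalCategory V] [SymmetricCategory V]
  [HasColimitsOfSize.{0, 0} V] [∀ v : V, PreservesColimitsOfSize.{0, 0} (tensorLeft v)]

instance preservesColimits_tensorRight (v : V) : PreservesColimitsOfSize.{0, 0} (tensorRight v) :=
  preservesColimits_of_natIso (BraidedCategory.tensorLeftIsoTensorRight v)

instance : HasColimitsOfSize.{0, 0} (DayFunctor K V) :=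
  Adjunction.has_colimits_of_equivalence (DayFunctor.equiv K V).functor

/-- The Day convolution monoidal structure on `K ⥤ V`. -/
instance (priority := high) dayMonoidal : MonoidalCategory (DayFunctor K V) :=
  DayFunctor.inst

instance (priority := high) dayLawful : LawfulDayConvolutionMonoidalCategoryStruct K V (DayFunctor K V) :=
  inferInstance

variable {K V}

/-- The universal maps `F(x) ⊗ G(y) ⟶ (F ⊗ G)(x ⊗ y)` of the Day convolution. -/
abbrev dayη (F G : DayFunctor K V) : F.functor ⊠ G.functor ⟶ tensor K ⋙ (F ⊗ G).functor :=
  DayFunctor.η F G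

variable (K V) in
/-- The universal map `𝟙 ⟶ 𝟙(𝟙)` of the unit of the Day convolution. -/
abbrev dayν : 𝟙_ V ⟶ (𝟙_ (DayFunctor K V)).functor.obj (𝟙_ K) :=
  DayFunctor.ν K V

section
attribute [local instance] convolution convolution₂ convolution₂' convolutionUnit

/-- The braiding of the Day convolution. -/
def dayBraiding (F G : DayFunctor K V) : F ⊗ G ≅ G ⊗ F :=
  (DayFunctor.equiv K V).fullyFaithfulFunctor.preimageIso
    (DayConvolution.braiding ((ι K V (DayFunctor K V)).obj F) ((ι K V (DayFunctor K V)).obj G))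

instance : SymmetricCategory (DayFunctor K V) :=
  braidedOfDay K V dayBraiding
    (fun _ _ => (DayFunctor.equiv K V).fullyFaithfulFunctor.map_preimage _)

/-- The Day convolution braiding is determined by the braidings of source and target. -/
lemma η_braiding (F G : DayFunctor K V) (x y : K) :
    (dayη F G).app (x, y) ≫ (β_ F G).hom.natTrans.app (x ⊗ y) =
      (β_ (F.functor.obj x) (G.functor.obj y)).hom ≫ (dayη G F).app (y, x) ≫
        (G ⊗ F).functor.map (β_ y x).hom := by
  have h : (β_ F G).hom.natTrans = (DayConvolution.braiding ((ι K V (DayFunctor K V)).obj F)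
    ((ι K V (DayFunctor K V)).obj G)).hom :=
    (DayFunctor.equiv K V).fullyFaithfulFunctor.map_preimage _
  rw [h]
  exact DayConvolution.unit_app_braiding_hom_app ((ι K V (DayFunctor K V)).obj F)
    ((ι K V (DayFunctor K V)).obj G) x y

end

lemma η_whiskerLeft (F : DayFunctor K V) {G H : DayFunctor K V} (g : G ⟶ H) (x y : K) :
    (dayη F G).app (x, y) ≫ (F ◁ g).natTrans.app (x ⊗ y) =
      F.functor.obj x ◁ g.natTrans.app y ≫ (dayη F H).app (x, y) :=
  convolutionExtensionUnit_comp_ι_map_whiskerLeft_app V F g x y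

lemma η_whiskerRight {G H : DayFunctor K V} (g : G ⟶ H) (F : DayFunctor K V) (x y : K) :
    (dayη G F).app (x, y) ≫ (g ▷ F).natTrans.app (x ⊗ y) =
      g.natTrans.app x ▷ F.functor.obj y ≫ (dayη H F).app (x, y) :=
  convolutionExtensionUnit_comp_ι_map_whiskerRight_app K V g F x y

lemma η_associator (F G H : DayFunctor K V) (x y z : K) :
    (dayη F G).app (x, y) ▷ H.functor.obj z ≫ (dayη (F ⊗ G) H).app (x ⊗ y, z) ≫
      (α_ F G H).hom.natTrans.app ((x ⊗ y) ⊗ z) =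
    (α_ _ _ _).hom ≫ F.functor.obj x ◁ (dayη G H).app (y, z) ≫
      (dayη F (G ⊗ H)).app (x, y ⊗ z) ≫ (F ⊗ G ⊗ H).functor.map (α_ x y z).inv :=
  associator_hom_unit_unit V F G H x y z

lemma ν_leftUnitor (F : DayFunctor K V) (y : K) :
    dayν K V ▷ F.functor.obj y ≫ (dayη (𝟙_ _) F).app (𝟙_ K, y) ≫
      (λ_ F).hom.natTrans.app (𝟙_ K ⊗ y) =
    (λ_ (F.functor.obj y)).hom ≫ F.functor.map (λ_ y).inv :=
  leftUnitor_hom_unit_app V F y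

lemma ν_rightUnitor (F : DayFunctor K V) (y : K) :
    F.functor.obj y ◁ dayν K V ≫ (dayη F (𝟙_ _)).app (y, 𝟙_ K) ≫
      (ρ_ F).hom.natTrans.app (y ⊗ 𝟙_ K) =
    (ρ_ (F.functor.obj y)).hom ≫ F.functor.map (ρ_ y).inv :=
  rightUnitor_hom_unit_app V F y

/-- `F ⊠ -`. -/
def extLeft (F : K ⥤ V) : (K ⥤ V) ⥤ (K × K ⥤ V) where
  obj G := F ⊠ G
  map {G H} g := {
    app x := F.obj x.1 ◁ g.app x.2
    naturality x y f := by
      have h : F.obj x.1 ◁ G.map f.2 ≫ F.obj x.1 ◁ g.app y.2 =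
          F.obj x.1 ◁ g.app x.2 ≫ F.obj x.1 ◁ H.map f.2 := by
        rw [← whiskerLeft_comp, g.naturality, whiskerLeft_comp]
      simp [← whisker_exchange, reassoc_of% h] }

instance (F : K ⥤ V) : PreservesColimitsOfSize.{0, 0} (extLeft F) := by
  refine preservesColimits_of_evaluation _ fun ⟨x, y⟩ => ?_
  have e : (evaluation K V).obj y ⋙ tensorLeft (F.obj x) ≅
      extLeft F ⋙ (evaluation (K × K) V).obj (x, y) :=
    NatIso.ofComponents (fun G => Iso.refl (F.obj x ⊗ G.obj y)) (fun f =>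
      (Category.comp_id _).trans (Category.id_comp _).symm)
  have : PreservesColimitsOfSize.{0, 0} ((evaluation K V).obj y) :=
    ⟨fun {_} _ => inferInstance⟩
  exact preservesColimits_of_natIso e

/-- The Day convolution with a fixed functor as a left Kan extension. -/
def tensorLeftIso (F : DayFunctor K V) :
    extLeft F.functor ⋙ (tensor K).lan ≅
    (DayFunctor.equiv K V).inverse ⋙ tensorLeft F ⋙ (DayFunctor.equiv K V).functor :=
  NatIso.ofComponents (fun G =>
    Functor.leftKanExtensionUnique
      ((tensor K).lan.obj (F.functor ⊠ G)) ((tensor K).lanUnit.app (F.functor ⊠ G))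
    (F ⊗ DayFunctor.mk G).functor (dayη F (.mk G)) )
    (fun {G H} f => by
      apply Functor.hom_ext_of_isLeftKanExtension ((tensor K).lan.obj (F.functor ⊠ G))
        ((tensor K).lanUnit.app (F.functor ⊠ G))
      ext ⟨x, y⟩
      have h (G : K ⥤ V) : ((tensor K).lanUnit.app (F.functor ⊠ G)).app (x, y) ≫
          (Functor.leftKanExtensionUnique ((tensor K).lan.obj (F.functor ⊠ G))
            ((tensor K).lanUnit.app (F.functor ⊠ G)) (F ⊗ DayFunctor.mk G).functor
            (dayη F (.mk G))).hom.app (x ⊗ y) = (dayη F (.mk G)).app (x, y) := by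
        rw [Functor.leftKanExtensionUnique_hom]
        exact Functor.descOfIsLeftKanExtension_fac_app _ _ _ _ _
      have h₁ := h G
      have h₂ := h H
      have h₃ := congr_app ((tensor K).lanUnit.naturality ((extLeft F.functor).map f)) (x, y)
      have h₄ := η_whiskerLeft F (G := .mk G) (H := .mk H) (.mk f) x y
      dsimp at h₃ h₄ ⊢
      exact (Category.assoc _ _ _).symm.trans ((congrArg (· ≫ _) h₃.symm).trans
        ((Category.assoc _ _ _).trans ((congrArg (_ ≫ ·) h₂).trans (h₄.symm.trans
          ((congrArg (· ≫ _) h₁.symm).trans (Category.assoc _ _ _)))))))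

instance (F : DayFunctor K V) : PreservesColimitsOfSize.{0, 0} (tensorLeft F) := by
  have : PreservesColimitsOfSize.{0, 0} ((tensor K).lan : (_ ⥤ V) ⥤ _) :=
    ((tensor K).lanAdjunction V).leftAdjoint_preservesColimits
  have := preservesColimits_of_natIso.{0, 0} (tensorLeftIso F)
  exact preservesColimits_of_natIso (F := (DayFunctor.equiv K V).functor ⋙
    ((DayFunctor.equiv K V).inverse ⋙ tensorLeft F ⋙
    (DayFunctor.equiv K V).functor) ⋙ (DayFunctor.equiv K V).inverse)
    (NatIso.ofComponents (fun G => Iso.refl (F ⊗ G))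
      (fun f => (Category.comp_id _).trans (Category.id_comp _).symm))

end Day

section Modules

variable {D : Type u} [Category.{v} D] [MonoidalCategory D] [SymmetricCategory D]
  [HasColimitsOfSize.{0, 0} D] [∀ X : D, PreservesColimitsOfSize.{0, 0} (tensorLeft X)]
  {A : D} [MonObj A] [IsCommMonObj A]

instance epi_whiskerLeft (X : D) {Y Z : D} (f : Y ⟶ Z) [Epi f] : Epi (X ◁ f) :=
  inferInstanceAs (Epi ((tensorLeft X).map f))

instance epi_whiskerRight (X : D) {Y Z : D} (f : Y ⟶ Z) [Epi f] : Epi (f ▷ X) :=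
  inferInstanceAs (Epi ((tensorRight X).map f))

/-- The action map of a module. -/
def act (M : Mod D A) : A ⊗ M.X ⟶ M.X := ModObj.smul (M := A) (X := M.X)

lemma one_act (M : Mod D A) : MonObj.one (X := A) ▷ M.X ≫ act M = (λ_ M.X).hom :=
  ModObj.one_smul_self A M.X

lemma mul_act (M : Mod D A) : MonObj.mul (X := A) ▷ M.X ≫ act M =
    (α_ A A M.X).hom ≫ A ◁ act M ≫ act M :=
  ModObj.mul_smul_self A M.X

lemma act_hom {M N : Mod D A} (f : M ⟶ N) : act M ≫ f.hom = A ◁ f.hom ≫ act N :=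
  IsModHom.smul_hom (A := A) (f := f.hom)

/-- The interchange `X ⊗ (A ⊗ Y) ≅ A ⊗ (X ⊗ Y)`. -/
def mid (X B Y : D) : X ⊗ (B ⊗ Y) ⟶ B ⊗ (X ⊗ Y) :=
  (α_ X B Y).inv ≫ (β_ X B).hom ▷ Y ≫ (α_ B X Y).hom

lemma mid_nat₁ {X X' : D} (f : X ⟶ X') (B Y : D) :
    f ▷ (B ⊗ Y) ≫ mid X' B Y = mid X B Y ≫ B ◁ f ▷ Y := by
  simp [mid, ← comp_whiskerRight_assoc]

lemma mid_nat₂ {B B' : D} (X : D) (f : B ⟶ B') (Y : D) :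
    X ◁ f ▷ Y ≫ mid X B' Y = mid X B Y ≫ f ▷ (X ⊗ Y) := by
  simp only [mid, associator_inv_naturality_middle_assoc, Category.assoc,
    ← comp_whiskerRight_assoc, BraidedCategory.braiding_naturality_right]
  simp

lemma mid_nat₃ {Y Y' : D} (X B : D) (f : Y ⟶ Y') :
    X ◁ B ◁ f ≫ mid X B Y' = mid X B Y ≫ B ◁ X ◁ f := by
  simp only [mid, Category.assoc, associator_inv_naturality_right_assoc, whisker_exchange_assoc,
    associator_naturality_right]

lemma mid_tensor (X X' B Y : D) : mid (X ⊗ X') B Y =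
    (α_ X X' (B ⊗ Y)).hom ≫ X ◁ mid X' B Y ≫ mid X B (X' ⊗ Y) ≫ B ◁ (α_ X X' Y).inv := by
  simp only [mid, BraidedCategory.braiding_tensor_left_hom, comp_whiskerRight, whisker_assoc]
  monoidal

lemma mid_tensor_right (X B Y Z : D) : mid X B (Y ⊗ Z) =
    X ◁ (α_ B Y Z).inv ≫ (α_ X (B ⊗ Y) Z).inv ≫ mid X B Y ▷ Z ≫ (α_ B (X ⊗ Y) Z).hom ≫
      B ◁ (α_ X Y Z).hom := by
  simp only [mid]
  monoidal

lemma mid_mid (X B Y : D) : mid X B Y ≫ mid B X Y = 𝟙 _ := by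
  simp [mid, ← comp_whiskerRight_assoc]

lemma act_comm (M : Mod D A) : A ◁ act M ≫ act M = mid A A M.X ≫ A ◁ act M ≫ act M := by
  have h := mul_act M
  have h' : A ◁ act M ≫ act M = (α_ A A M.X).inv ≫ MonObj.mul (X := A) ▷ M.X ≫ act M := by
    rw [h]; simp
  rw [h', mid]
  simp only [Category.assoc, Iso.hom_inv_id_assoc, ← comp_whiskerRight_assoc]
  rw [IsCommMonObj.mul_comm]

/-- The relative tensor product `M ⊗_A N`: the coequalizer of the two maps
`M ⊗ (A ⊗ N) ⇉ M ⊗ N` given by the actions of `A` on `M` and on `N`. -/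
def relTensor (M N : Mod D A) : D :=
  coequalizer (mid M.X A N.X ≫ (α_ A M.X N.X).inv ≫ act M ▷ N.X) (M.X ◁ act N)

/-- The projection `M ⊗ N ⟶ M ⊗_A N`. -/
def relπ (M N : Mod D A) : M.X ⊗ N.X ⟶ relTensor M N := coequalizer.π _ _

instance (M N : Mod D A) : Epi (relπ M N) := inferInstanceAs (Epi (coequalizer.π _ _))

lemma relπ_condition (M N : Mod D A) :
    mid M.X A N.X ≫ (α_ A M.X N.X).inv ≫ act M ▷ N.X ≫ relπ M N = M.X ◁ act N ≫ relπ M N := by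
  have := coequalizer.condition (mid M.X A N.X ≫ (α_ A M.X N.X).inv ≫ act M ▷ N.X)
    (M.X ◁ act N)
  simp only [Category.assoc] at this
  exact this

/-- A map out of `M ⊗_A N` from a balanced map. -/
def relDesc (M N : Mod D A) {Z : D} (f : M.X ⊗ N.X ⟶ Z)
    (h : mid M.X A N.X ≫ (α_ A M.X N.X).inv ≫ act M ▷ N.X ≫ f = M.X ◁ act N ≫ f) :
    relTensor M N ⟶ Z :=
  coequalizer.desc f (by simpa using h)

lemma relπ_desc (M N : Mod D A) {Z : D} (f : M.X ⊗ N.X ⟶ Z) (h) :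
    relπ M N ≫ relDesc M N f h = f :=
  coequalizer.π_desc _ _

lemma exists_descLeft (M N : Mod D A) (X : D) {Z : D} (f : X ⊗ (M.X ⊗ N.X) ⟶ Z)
    (h : X ◁ (mid M.X A N.X ≫ (α_ A M.X N.X).inv ≫ act M ▷ N.X) ≫ f = X ◁ (M.X ◁ act N) ≫ f) :
    ∃ g : X ⊗ relTensor M N ⟶ Z, X ◁ relπ M N ≫ g = f :=
  let l := isColimitCoforkMapOfIsColimit (tensorLeft X) _
    (coequalizerIsCoequalizer (mid M.X A N.X ≫ (α_ A M.X N.X).inv ≫ act M ▷ N.X) (M.X ◁ act N))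
  ⟨Cofork.IsColimit.desc l f h, Cofork.IsColimit.π_desc' l f h⟩

lemma exists_descRight (M N : Mod D A) (X : D) {Z : D} (f : (M.X ⊗ N.X) ⊗ X ⟶ Z)
    (h : (mid M.X A N.X ≫ (α_ A M.X N.X).inv ≫ act M ▷ N.X) ▷ X ≫ f = (M.X ◁ act N) ▷ X ≫ f) :
    ∃ g : relTensor M N ⊗ X ⟶ Z, relπ M N ▷ X ≫ g = f :=
  let l := isColimitCoforkMapOfIsColimit (tensorRight X) _
    (coequalizerIsCoequalizer (mid M.X A N.X ≫ (α_ A M.X N.X).inv ≫ act M ▷ N.X) (M.X ◁ act N))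
  ⟨Cofork.IsColimit.desc l f h, Cofork.IsColimit.π_desc' l f h⟩

lemma exists_relAct (M N : Mod D A) : ∃ g : A ⊗ relTensor M N ⟶ relTensor M N,
    A ◁ relπ M N ≫ g = (α_ A M.X N.X).inv ≫ act M ▷ N.X ≫ relπ M N := by
  apply exists_descLeft
  have h := relπ_condition M N
  have e := act_comm M
  symm
  calc _ = (α_ A M.X (A ⊗ N.X)).inv ≫ act M ▷ (A ⊗ N.X) ≫ M.X ◁ act N ≫ relπ M N := by
        rw [associator_inv_naturality_right_assoc, whisker_exchange_assoc]
    _ = (α_ A M.X (A ⊗ N.X)).inv ≫ mid (A ⊗ M.X) A N.X ≫ A ◁ act M ▷ N.X ≫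
          (α_ A M.X N.X).inv ≫ act M ▷ N.X ≫ relπ M N := by
        rw [← h, reassoc_of% mid_nat₁]
    _ = A ◁ mid M.X A N.X ≫ A ◁ (α_ A M.X N.X).inv ≫ (α_ _ _ _).inv ≫
          (mid A A M.X ≫ A ◁ act M ≫ act M) ▷ N.X ≫ relπ M N := by
        rw [mid_tensor, mid_tensor_right]
        simp
    _ = _ := by
        rw [← e]
        simp

/-- The action of `A` on `M ⊗_A N`, induced by the action on `M`. -/
def relAct (M N : Mod D A) : A ⊗ relTensor M N ⟶ relTensor M N := (exists_relAct M N).choose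

lemma relAct_spec (M N : Mod D A) :
    A ◁ relπ M N ≫ relAct M N = (α_ A M.X N.X).inv ≫ act M ▷ N.X ≫ relπ M N :=
  (exists_relAct M N).choose_spec

lemma relAct_one (M N : Mod D A) :
    MonObj.one (X := A) ▷ relTensor M N ≫ relAct M N = (λ_ (relTensor M N)).hom := by
  rw [← cancel_epi (𝟙_ D ◁ relπ M N), whisker_exchange_assoc, relAct_spec,
    associator_inv_naturality_left_assoc, ← comp_whiskerRight_assoc, one_act]
  simp

lemma relAct_mul (M N : Mod D A) :
    MonObj.mul (X := A) ▷ relTensor M N ≫ relAct M N =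
      (α_ A A (relTensor M N)).hom ≫ A ◁ relAct M N ≫ relAct M N := by
  rw [← cancel_epi ((A ⊗ A) ◁ relπ M N), whisker_exchange_assoc, relAct_spec,
    associator_inv_naturality_left_assoc, ← comp_whiskerRight_assoc, mul_act,
    associator_naturality_right_assoc, ← whiskerLeft_comp_assoc, relAct_spec]
  simp only [whiskerLeft_comp, Category.assoc, relAct_spec]
  simp

/-- The `A`-module `M ⊗_A N`. -/
def relMod (M N : Mod D A) : Mod D A where
  X := relTensor M N
  mod :=
    { smul := relAct M N
      one_smul := relAct_one M N
      mul_smul := relAct_mul M N }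

/-- The projection `M ⊗ N ⟶ M ⊗_A N`. -/
def proj (M N : Mod D A) : M.X ⊗ N.X ⟶ (relMod M N).X := relπ M N

instance (M N : Mod D A) : Epi (proj M N) := inferInstanceAs (Epi (relπ M N))

/-- Linearity in the first variable. -/
def LinL (M N P : Mod D A) (f : M.X ⊗ N.X ⟶ P.X) : Prop :=
  act M ▷ N.X ≫ f = (α_ A M.X N.X).hom ≫ A ◁ f ≫ act P

/-- Linearity in the second variable. -/
def LinR (M N P : Mod D A) (f : M.X ⊗ N.X ⟶ P.X) : Prop :=
  M.X ◁ act N ≫ f = mid M.X A N.X ≫ A ◁ f ≫ act P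

lemma linL_π (M N : Mod D A) : LinL M N (relMod M N) (proj M N) := by
  have : act M ▷ N.X ≫ relπ M N = (α_ A M.X N.X).hom ≫ A ◁ relπ M N ≫ relAct M N := by
    rw [relAct_spec]; simp
  exact this

lemma linR_π (M N : Mod D A) : LinR M N (relMod M N) (proj M N) := by
  have : M.X ◁ act N ≫ relπ M N = mid M.X A N.X ≫ A ◁ relπ M N ≫ relAct M N := by
    rw [relAct_spec, relπ_condition]
  exact this

lemma LinL.comp {M N P Q : Mod D A} {f : M.X ⊗ N.X ⟶ P.X} (h : LinL M N P f) (g : P ⟶ Q) :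
    LinL M N Q (f ≫ g.hom) := by
  unfold LinL at *
  rw [reassoc_of% h, act_hom]; simp

lemma LinR.comp {M N P Q : Mod D A} {f : M.X ⊗ N.X ⟶ P.X} (h : LinR M N P f) (g : P ⟶ Q) :
    LinR M N Q (f ≫ g.hom) := by
  unfold LinR at *
  rw [reassoc_of% h, act_hom]; simp

lemma LinL.pre₁ {M N M' P : Mod D A} {f : M.X ⊗ N.X ⟶ P.X} (h : LinL M N P f)
    (g : M' ⟶ M) : LinL M' N P (g.hom ▷ N.X ≫ f) := by
  unfold LinL at *
  rw [← comp_whiskerRight_assoc, act_hom, comp_whiskerRight_assoc, h]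
  simp

lemma LinL.pre₂ {M N N' P : Mod D A} {f : M.X ⊗ N.X ⟶ P.X} (h : LinL M N P f)
    (k : N' ⟶ N) : LinL M N' P (M.X ◁ k.hom ≫ f) := by
  unfold LinL at *
  rw [← whisker_exchange_assoc, h]
  simp

lemma LinR.pre₂ {M N N' P : Mod D A} {f : M.X ⊗ N.X ⟶ P.X} (h : LinR M N P f)
    (k : N' ⟶ N) : LinR M N' P (M.X ◁ k.hom ≫ f) := by
  unfold LinR at *
  rw [← whiskerLeft_comp_assoc, act_hom, whiskerLeft_comp_assoc, h, reassoc_of% mid_nat₃]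
  simp

lemma LinR.pre₁ {M N M' P : Mod D A} {f : M.X ⊗ N.X ⟶ P.X} (h : LinR M N P f)
    (g : M' ⟶ M) : LinR M' N P (g.hom ▷ N.X ≫ f) := by
  unfold LinR at *
  rw [whisker_exchange_assoc, h, reassoc_of% mid_nat₁]
  simp

lemma LinR.braid {M N P : Mod D A} {f : N.X ⊗ M.X ⟶ P.X} (h : LinR N M P f) :
    LinL M N P ((β_ M.X N.X).hom ≫ f) := by
  unfold LinL LinR at *
  rw [BraidedCategory.braiding_naturality_left_assoc, h]
  simp only [mid, BraidedCategory.braiding_tensor_left_hom, whiskerLeft_comp, Category.assoc,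
    Iso.inv_hom_id_assoc, Iso.hom_inv_id_assoc, ← comp_whiskerRight_assoc,
    SymmetricCategory.symmetry, id_whiskerRight, Category.id_comp]

lemma LinL.braid {M N P : Mod D A} {f : N.X ⊗ M.X ⟶ P.X} (h : LinL N M P f) :
    LinR M N P ((β_ M.X N.X).hom ≫ f) := by
  unfold LinL LinR at *
  rw [BraidedCategory.braiding_naturality_right_assoc, h]
  simp [mid]

lemma exists_lift {M N P : Mod D A} (f : M.X ⊗ N.X ⟶ P.X) (hl : LinL M N P f)
    (hr : LinR M N P f) : ∃ g : relMod M N ⟶ P, proj M N ≫ g.hom = f := by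
  have hb : mid M.X A N.X ≫ (α_ A M.X N.X).inv ≫ act M ▷ N.X ≫ f = M.X ◁ act N ≫ f := by
    rw [hl, hr]; simp
  have h : relAct M N ≫ relDesc M N f hb = A ◁ relDesc M N f hb ≫ act P := by
    rw [← cancel_epi (A ◁ relπ M N), reassoc_of% relAct_spec, relπ_desc, ← whiskerLeft_comp_assoc,
      relπ_desc, hl]
    simp
  exact ⟨Mod.Hom.mk' (relDesc M N f hb) h, relπ_desc _ _ _ hb⟩

/-- The module map out of `M ⊗_A N` induced by a bilinear map. -/
def lift {M N P : Mod D A} (f : M.X ⊗ N.X ⟶ P.X) (hl : LinL M N P f)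
    (hr : LinR M N P f) : relMod M N ⟶ P := (exists_lift f hl hr).choose

lemma π_lift {M N P : Mod D A} (f : M.X ⊗ N.X ⟶ P.X) (hl : LinL M N P f)
    (hr : LinR M N P f) : proj M N ≫ (lift f hl hr).hom = f := (exists_lift f hl hr).choose_spec

lemma relMod_hom_ext {M N P : Mod D A} {f g : relMod M N ⟶ P}
    (h : proj M N ≫ f.hom = proj M N ≫ g.hom) : f = g := by
  ext
  exact (cancel_epi (proj M N)).1 h

/-- Functoriality of `M ⊗_A N`. -/
def relMap₁ {M M' : Mod D A} (f : M ⟶ M') (N : Mod D A) : relMod M N ⟶ relMod M' N :=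
  lift (f.hom ▷ N.X ≫ proj M' N) ((linL_π _ _).pre₁ f) ((linR_π _ _).pre₁ f)

/-- Functoriality of `M ⊗_A N`. -/
def relMap₂ (M : Mod D A) {N N' : Mod D A} (f : N ⟶ N') : relMod M N ⟶ relMod M N' :=
  lift (M.X ◁ f.hom ≫ proj M N') ((linL_π _ _).pre₂ f) ((linR_π _ _).pre₂ f)

lemma π_relMap₁ {M M' : Mod D A} (f : M ⟶ M') (N : Mod D A) :
    proj M N ≫ (relMap₁ f N).hom = f.hom ▷ N.X ≫ proj M' N := π_lift _ _ _

lemma π_relMap₂ (M : Mod D A) {N N' : Mod D A} (f : N ⟶ N') :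
    proj M N ≫ (relMap₂ M f).hom = M.X ◁ f.hom ≫ proj M N' := π_lift _ _ _

lemma exists_lift₃ {M N P Q : Mod D A} (f : (M.X ⊗ N.X) ⊗ P.X ⟶ Q.X)
    (h₁ : act M ▷ N.X ▷ P.X ≫ f = (α_ A M.X N.X).hom ▷ P.X ≫ (α_ _ _ _).hom ≫ A ◁ f ≫ act Q)
    (h₂ : (M.X ◁ act N) ▷ P.X ≫ f = mid M.X A N.X ▷ P.X ≫ (α_ _ _ _).hom ≫ A ◁ f ≫ act Q)
    (h₃ : (M.X ⊗ N.X) ◁ act P ≫ f = mid (M.X ⊗ N.X) A P.X ≫ A ◁ f ≫ act Q) :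
    ∃ g : relMod (relMod M N) P ⟶ Q,
      proj M N ▷ P.X ≫ proj (relMod M N) P ≫ g.hom = f := by
  obtain ⟨g, hg⟩ : ∃ g : (relMod M N).X ⊗ P.X ⟶ Q.X, proj M N ▷ P.X ≫ g = f := by
    apply exists_descRight
    rw [h₂]
    simp [h₁]
  subst hg
  refine ⟨lift g ?_ ?_, by rw [π_lift]⟩
  · have e : A ◁ proj M N ≫ act (relMod M N) = (α_ A M.X N.X).inv ≫ act M ▷ N.X ≫ proj M N :=
      relAct_spec M N
    unfold LinL
    rw [← cancel_epi ((A ◁ proj M N) ▷ P.X), ← comp_whiskerRight_assoc, e]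
    simp [h₁]
  · unfold LinR
    rw [← cancel_epi (proj M N ▷ (A ⊗ P.X)), ← whisker_exchange_assoc, h₃,
      reassoc_of% mid_nat₁]
    simp

lemma relMod_hom_ext₃ {M N P Q : Mod D A} {f g : relMod (relMod M N) P ⟶ Q}
    (h : proj M N ▷ P.X ≫ proj (relMod M N) P ≫ f.hom =
      proj M N ▷ P.X ≫ proj (relMod M N) P ≫ g.hom) : f = g :=
  relMod_hom_ext ((cancel_epi (proj M N ▷ P.X)).1 h)

lemma relMod_hom_ext₃' {M N P Q : Mod D A} {f g : relMod M (relMod N P) ⟶ Q}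
    (h : M.X ◁ proj N P ≫ proj M (relMod N P) ≫ f.hom =
      M.X ◁ proj N P ≫ proj M (relMod N P) ≫ g.hom) : f = g :=
  relMod_hom_ext ((cancel_epi (M.X ◁ proj N P)).1 h)

lemma exists_assoc (M N P : Mod D A) :
    ∃ g : relMod (relMod M N) P ⟶ relMod M (relMod N P),
      proj M N ▷ P.X ≫ proj (relMod M N) P ≫ g.hom =
        (α_ M.X N.X P.X).hom ≫ M.X ◁ proj N P ≫ proj M (relMod N P) := by
  have l₁ := linL_π M (relMod N P)
  have r₁ := linR_π M (relMod N P)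
  have l₂ := linL_π N P
  have r₂ := linR_π N P
  unfold LinL at l₁ l₂
  unfold LinR at r₁ r₂
  apply exists_lift₃
  · rw [associator_naturality_left_assoc, ← whisker_exchange_assoc, l₁]
    simp
  · rw [associator_naturality_middle_assoc, ← whiskerLeft_comp_assoc, l₂]
    simp only [whiskerLeft_comp, Category.assoc]
    rw [r₁, reassoc_of% mid_nat₃, mid_tensor_right]
    simp
  · rw [associator_naturality_right_assoc, ← whiskerLeft_comp_assoc, r₂]
    simp only [whiskerLeft_comp, Category.assoc]
    rw [r₁, reassoc_of% mid_nat₃, mid_tensor]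
    simp

/-- The associativity map of the relative tensor product. -/
def relAssoc (M N P : Mod D A) : relMod (relMod M N) P ⟶ relMod M (relMod N P) :=
  (exists_assoc M N P).choose

lemma π_relAssoc (M N P : Mod D A) :
    proj M N ▷ P.X ≫ proj (relMod M N) P ≫ (relAssoc M N P).hom =
      (α_ M.X N.X P.X).hom ≫ M.X ◁ proj N P ≫ proj M (relMod N P) :=
  (exists_assoc M N P).choose_spec

/-- The symmetry of the relative tensor product. -/
def relBraid (M N : Mod D A) : relMod M N ⟶ relMod N M :=
  lift ((β_ M.X N.X).hom ≫ proj N M) (linR_π N M).braid (linL_π N M).braid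

lemma π_relBraid (M N : Mod D A) :
    proj M N ≫ (relBraid M N).hom = (β_ M.X N.X).hom ≫ proj N M := π_lift _ _ _

lemma relBraid_relBraid (M N : Mod D A) : relBraid M N ≫ relBraid N M = 𝟙 _ := by
  apply relMod_hom_ext
  rw [Mod.comp_hom', reassoc_of% π_relBraid, π_relBraid]
  simp

/-- The inverse associativity map, obtained from `relAssoc` by symmetry. -/
def relAssocInv (M N P : Mod D A) : relMod M (relMod N P) ⟶ relMod (relMod M N) P :=
  relBraid _ _ ≫ relMap₁ (relBraid _ _) _ ≫ relAssoc _ _ _ ≫ relBraid _ _ ≫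
    relMap₁ (relBraid _ _) _

lemma π_relAssocInv (M N P : Mod D A) :
    M.X ◁ proj N P ≫ proj M (relMod N P) ≫ (relAssocInv M N P).hom =
      (α_ M.X N.X P.X).inv ≫ proj M N ▷ P.X ≫ proj (relMod M N) P := by
  simp only [relAssocInv, Mod.comp_hom']
  rw [reassoc_of% π_relBraid, BraidedCategory.braiding_naturality_right_assoc,
    reassoc_of% π_relMap₁, ← comp_whiskerRight_assoc, π_relBraid, comp_whiskerRight_assoc,
    reassoc_of% π_relAssoc, reassoc_of% π_relBraid,
    BraidedCategory.braiding_naturality_right_assoc, π_relMap₁,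
    ← comp_whiskerRight_assoc, π_relBraid, comp_whiskerRight_assoc]
  simp only [← Category.assoc]
  congr 2
  have c₁ : ∀ (X Y Z W : D) (f : (X ⊗ Y) ⊗ Z ⟶ W), (β_ X Y).hom ▷ Z ≫ (β_ Y X).hom ▷ Z ≫ f = f :=
    fun X Y Z W f => by simp [← comp_whiskerRight_assoc]
  have c₂ : ∀ (X Y Z W : D) (f : Z ⊗ (X ⊗ Y) ⟶ W), Z ◁ (β_ X Y).hom ≫ Z ◁ (β_ Y X).hom ≫ f = f :=
    fun X Y Z W f => by simp [← whiskerLeft_comp_assoc]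
  rw [← cancel_mono (α_ M.X N.X P.X).hom]
  simp [c₁, c₂]

/-- The associator of the relative tensor product. -/
def relAssocIso (M N P : Mod D A) : relMod (relMod M N) P ≅ relMod M (relMod N P) where
  hom := relAssoc M N P
  inv := relAssocInv M N P
  hom_inv_id := by
    apply relMod_hom_ext₃
    rw [Mod.comp_hom', reassoc_of% π_relAssoc, π_relAssocInv]
    simp
  inv_hom_id := by
    apply relMod_hom_ext₃'
    rw [Mod.comp_hom', reassoc_of% π_relAssocInv, π_relAssoc]
    simp

/-- `A` as a module over itself, the unit of the relative tensor product. -/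
def relUnit (A : D) [MonObj A] : Mod D A := Mod.regular A

/-- The projection `A ⊗ M ⟶ A ⊗_A M`. -/
def projA (M : Mod D A) : A ⊗ M.X ⟶ (relMod (relUnit A) M).X := proj (relUnit A) M

instance (M : Mod D A) : Epi (projA M) := inferInstanceAs (Epi (proj (relUnit A) M))

lemma linL_projA (M : Mod D A) : MonObj.mul (X := A) ▷ M.X ≫ projA M =
    (α_ A A M.X).hom ≫ A ◁ projA M ≫ act _ := linL_π (relUnit A) M

lemma linR_projA (M : Mod D A) : A ◁ act M ≫ projA M =
    mid A A M.X ≫ A ◁ projA M ≫ act _ := linR_π (relUnit A) M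

lemma act_projA (M : Mod D A) : A ◁ projA M ≫ act (relMod (relUnit A) M) =
    (α_ _ _ _).inv ≫ MonObj.mul (X := A) ▷ M.X ≫ projA M := by
  rw [linL_projA]; simp

lemma linL_act (M : Mod D A) : LinL (relUnit A) M M (act M) := mul_act M

lemma linR_act (M : Mod D A) : LinR (relUnit A) M M (act M) := act_comm M

/-- The left unit map of the relative tensor product, given by the action. -/
def relLeftUnit (M : Mod D A) : relMod (relUnit A) M ⟶ M := lift (act M) (linL_act M) (linR_act M)

lemma projA_relLeftUnit (M : Mod D A) :
    projA M ≫ (relLeftUnit M).hom = act M := π_lift _ (linL_act M) (linR_act M)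

/-- The inverse of the left unit map, given by the unit of `A`. -/
def relLeftUnitInv (M : Mod D A) : M.X ⟶ (relMod (relUnit A) M).X :=
  (λ_ M.X).inv ≫ MonObj.one (X := A) ▷ M.X ≫ projA M

lemma one_mul_aux (M : Mod D A) {Z : D} (f : A ⊗ M.X ⟶ Z) :
    A ◁ MonObj.one (X := A) ▷ M.X ≫ (α_ _ _ _).inv ≫ MonObj.mul (X := A) ▷ M.X ≫ f =
      (α_ _ _ _).inv ≫ (ρ_ A).hom ▷ M.X ≫ f := by
  have u : (A ◁ MonObj.one (X := A)) ≫ MonObj.mul (X := A) = (ρ_ A).hom := MonObj.mul_one A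
  rw [associator_inv_naturality_middle_assoc, ← comp_whiskerRight_assoc, u]

lemma act_relLeftUnitInv (M : Mod D A) : act M ≫ relLeftUnitInv M = projA M := by
  unfold relLeftUnitInv
  rw [leftUnitor_inv_naturality_assoc, whisker_exchange_assoc, linR_projA, act_projA,
    reassoc_of% mid_nat₁, one_mul_aux]
  simp [mid]

lemma relLeftUnitInv_linear (M : Mod D A) :
    act M ≫ relLeftUnitInv M = A ◁ relLeftUnitInv M ≫ act (relMod (relUnit A) M) := by
  rw [act_relLeftUnitInv]
  unfold relLeftUnitInv
  simp only [whiskerLeft_comp, Category.assoc]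
  rw [act_projA, one_mul_aux]
  simp

/-- The left unitor of the relative tensor product. -/
def relLeftUnitor (M : Mod D A) : relMod (relUnit A) M ≅ M where
  hom := relLeftUnit M
  inv := Mod.Hom.mk' (relLeftUnitInv M) (relLeftUnitInv_linear M)
  hom_inv_id := by
    ext
    change (relLeftUnit M).hom ≫ relLeftUnitInv M = 𝟙 _
    rw [← cancel_epi (projA M), reassoc_of% projA_relLeftUnit]
    exact (act_relLeftUnitInv M).trans (Category.comp_id _).symm
  inv_hom_id := by
    ext
    change relLeftUnitInv M ≫ (relLeftUnit M).hom = 𝟙 M.X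
    unfold relLeftUnitInv
    simp only [Category.assoc]
    rw [projA_relLeftUnit, one_act]
    simp

/-- The symmetry of the relative tensor product. -/
def relBraidIso (M N : Mod D A) : relMod M N ≅ relMod N M where
  hom := relBraid M N
  inv := relBraid N M
  hom_inv_id := relBraid_relBraid M N
  inv_hom_id := relBraid_relBraid N M

lemma relMap_exchange {M M' N N' : Mod D A} (f : M ⟶ M') (g : N ⟶ N') :
    relMap₂ M g ≫ relMap₁ f N' = relMap₁ f N ≫ relMap₂ M' g := by
  apply relMod_hom_ext
  rw [Mod.comp_hom', Mod.comp_hom', reassoc_of% π_relMap₁, reassoc_of% π_relMap₂, π_relMap₁,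
    π_relMap₂, whisker_exchange_assoc]

/-- The relative tensor product on the category of `A`-modules. -/
instance relMonoidalStruct : MonoidalCategoryStruct (Mod D A) where
  tensorObj := relMod
  tensorUnit := relUnit A
  whiskerLeft M _ _ f := relMap₂ M f
  whiskerRight f N := relMap₁ f N
  associator := relAssocIso
  leftUnitor := relLeftUnitor
  rightUnitor M := relBraidIso _ _ ≪≫ relLeftUnitor M

/-- The projection `M ⊗ N ⟶ M ⊗_A N`. -/
def tproj (M N : Mod D A) : M.X ⊗ N.X ⟶ (M ⊗ N).X := proj M N

instance (M N : Mod D A) : Epi (tproj M N) := inferInstanceAs (Epi (proj M N))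

/-- Naturality of `M ⊗ N ⟶ M ⊗_A N`. -/
lemma π_whiskerRight {M M' : Mod D A} (f : M ⟶ M') (N : Mod D A) :
    tproj M N ≫ (f ▷ N).hom = f.hom ▷ N.X ≫ tproj M' N := π_relMap₁ f N

lemma π_whiskerLeft (M : Mod D A) {N N' : Mod D A} (f : N ⟶ N') :
    tproj M N ≫ (M ◁ f).hom = M.X ◁ f.hom ≫ tproj M N' := π_relMap₂ M f

lemma π_tensorHom {M M' N N' : Mod D A} (f : M ⟶ M') (g : N ⟶ N') :
    tproj M N ≫ (f ⊗ₘ g).hom = (f.hom ⊗ₘ g.hom) ≫ tproj M' N' := by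
  have : tproj M N ≫ (f ▷ N).hom ≫ (M' ◁ g).hom = (f.hom ⊗ₘ g.hom) ≫ tproj M' N' := by
    rw [reassoc_of% π_whiskerRight, π_whiskerLeft, MonoidalCategory.tensorHom_def, Category.assoc]
  exact this

lemma π_associator (M N P : Mod D A) :
    tproj M N ▷ P.X ≫ tproj (M ⊗ N) P ≫ (α_ M N P).hom.hom =
      (α_ M.X N.X P.X).hom ≫ M.X ◁ tproj N P ≫ tproj M (N ⊗ P) := π_relAssoc M N P

/-- The action of the unit object on a module. -/
def actU (M : Mod D A) : (𝟙_ (Mod D A)).X ⊗ M.X ⟶ M.X := act M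

lemma actU_hom {M N : Mod D A} (f : M ⟶ N) :
    actU M ≫ f.hom = (𝟙_ (Mod D A)).X ◁ f.hom ≫ actU N := act_hom f

lemma actU_condition (M N : Mod D A) :
    (α_ _ _ _).hom ≫ M.X ◁ actU N ≫ tproj M N =
      (β_ M.X (𝟙_ (Mod D A)).X).hom ▷ N.X ≫ actU M ▷ N.X ≫ tproj M N := by
  have : (α_ M.X A N.X).hom ≫ M.X ◁ act N ≫ relπ M N =
      (β_ M.X A).hom ▷ N.X ≫ act M ▷ N.X ≫ relπ M N := by
    rw [← relπ_condition]; simp [mid]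
  exact this

lemma π_leftUnitor (M : Mod D A) : tproj (𝟙_ _) M ≫ (λ_ M).hom.hom = actU M :=
  projA_relLeftUnit M

lemma π_rightUnitor (M : Mod D A) :
    tproj M (𝟙_ _) ≫ (ρ_ M).hom.hom = (β_ M.X (𝟙_ (Mod D A)).X).hom ≫ actU M := by
  have e : tproj M (relUnit A) ≫ (relBraid M (relUnit A)).hom =
      (β_ M.X (relUnit A).X).hom ≫ tproj (relUnit A) M := π_relBraid M (relUnit A)
  have : tproj M (relUnit A) ≫ (relBraid M (relUnit A)).hom ≫ (relLeftUnit M).hom =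
      (β_ M.X (relUnit A).X).hom ≫ tproj (relUnit A) M ≫ (relLeftUnit M).hom := by
    rw [reassoc_of% e]
  exact this.trans (congrArg ((β_ M.X (relUnit A).X).hom ≫ ·) (projA_relLeftUnit M))

lemma π_associator_inv (M N P : Mod D A) {Z : D} (f : ((M ⊗ N) ⊗ P).X ⟶ Z) :
    M.X ◁ tproj N P ≫ tproj M (N ⊗ P) ≫ (α_ M N P).inv.hom ≫ f =
      (α_ M.X N.X P.X).inv ≫ tproj M N ▷ P.X ≫ tproj (M ⊗ N) P ≫ f := by
  have := reassoc_of% (π_relAssocInv M N P)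
  exact this f

lemma π_associator_inv' (M N P : Mod D A) :
    M.X ◁ tproj N P ≫ tproj M (N ⊗ P) ≫ (α_ M N P).inv.hom =
      (α_ M.X N.X P.X).inv ≫ tproj M N ▷ P.X ≫ tproj (M ⊗ N) P := π_relAssocInv M N P

lemma tensor_hom_ext {M N P : Mod D A} {f g : M ⊗ N ⟶ P}
    (h : tproj M N ≫ f.hom = tproj M N ≫ g.hom) : f = g := relMod_hom_ext h

lemma tensor_hom_ext₃ {M N P Q : Mod D A} {f g : (M ⊗ N) ⊗ P ⟶ Q}
    (h : tproj M N ▷ P.X ≫ tproj (M ⊗ N) P ≫ f.hom =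
      tproj M N ▷ P.X ≫ tproj (M ⊗ N) P ≫ g.hom) : f = g := relMod_hom_ext₃ h

lemma tensor_hom_ext₃' {M N P Q : Mod D A} {f g : M ⊗ (N ⊗ P) ⟶ Q}
    (h : M.X ◁ tproj N P ≫ tproj M (N ⊗ P) ≫ f.hom =
      M.X ◁ tproj N P ≫ tproj M (N ⊗ P) ≫ g.hom) : f = g := relMod_hom_ext₃' h

lemma tensor_hom_ext₄ {M N P Q R : Mod D A} {f g : ((M ⊗ N) ⊗ P) ⊗ Q ⟶ R}
    (h : tproj M N ▷ P.X ▷ Q.X ≫ tproj (M ⊗ N) P ▷ Q.X ≫ tproj ((M ⊗ N) ⊗ P) Q ≫ f.hom =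
      tproj M N ▷ P.X ▷ Q.X ≫ tproj (M ⊗ N) P ▷ Q.X ≫ tproj ((M ⊗ N) ⊗ P) Q ≫ g.hom) :
    f = g :=
  tensor_hom_ext₃ ((cancel_epi (tproj M N ▷ P.X ▷ Q.X)).1 h)

instance relMonoidal : MonoidalCategory (Mod D A) where
  tensorHom_def _ _ := rfl
  id_tensorHom_id M N := by
    apply tensor_hom_ext
    rw [π_tensorHom]
    simp
  whiskerLeft_id M N := by
    apply tensor_hom_ext
    rw [π_whiskerLeft]
    simp
  id_whiskerRight M N := by
    apply tensor_hom_ext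
    rw [π_whiskerRight]
    simp
  tensorHom_comp_tensorHom f g h k := by
    apply tensor_hom_ext
    rw [Mod.comp_hom', reassoc_of% π_tensorHom, π_tensorHom, π_tensorHom]; simp
  associator_naturality f g h := by
    apply tensor_hom_ext₃
    rw [Mod.comp_hom', Mod.comp_hom', reassoc_of% π_tensorHom, reassoc_of% π_associator,
      π_tensorHom, MonoidalCategory.tensorHom_def (f ⊗ₘ g).hom,
      MonoidalCategory.tensorHom_def' _ (g ⊗ₘ h).hom]
    simp only [Category.assoc]
    rw [← comp_whiskerRight_assoc, π_tensorHom, comp_whiskerRight_assoc,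
      ← whisker_exchange_assoc, π_associator,
      ← whiskerLeft_comp_assoc, π_tensorHom]
    simp only [MonoidalCategory.tensorHom_def, comp_whiskerRight, whiskerLeft_comp, Category.assoc]
    rw [whisker_exchange_assoc, whisker_exchange_assoc, whisker_exchange_assoc]
    simp
  leftUnitor_naturality f := by
    apply tensor_hom_ext
    rw [Mod.comp_hom', Mod.comp_hom', reassoc_of% π_leftUnitor, actU_hom,
      reassoc_of% π_whiskerLeft, π_leftUnitor]
  rightUnitor_naturality f := by
    apply tensor_hom_ext
    rw [Mod.comp_hom', Mod.comp_hom', reassoc_of% π_rightUnitor, actU_hom,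
      reassoc_of% π_whiskerRight, π_rightUnitor, BraidedCategory.braiding_naturality_left_assoc]
  pentagon M N P Q := by
    apply tensor_hom_ext₄
    simp only [Mod.comp_hom']
    rw [reassoc_of% π_whiskerRight, ← comp_whiskerRight_assoc, ← comp_whiskerRight_assoc,
      Category.assoc, π_associator, comp_whiskerRight_assoc, comp_whiskerRight_assoc,
      reassoc_of% π_associator, π_whiskerLeft, reassoc_of% π_associator,
      associator_naturality_left_assoc, ← whisker_exchange_assoc, π_associator,
      associator_naturality_middle_assoc, ← whiskerLeft_comp_assoc, ← whiskerLeft_comp_assoc,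
      Category.assoc, π_associator]
    simp
  triangle M N := by
    apply tensor_hom_ext₃
    rw [Mod.comp_hom', reassoc_of% π_associator, π_whiskerLeft, π_whiskerRight,
      ← whiskerLeft_comp_assoc, π_leftUnitor, ← comp_whiskerRight_assoc, π_rightUnitor,
      actU_condition, comp_whiskerRight_assoc]

lemma π_braid (M N : Mod D A) :
    tproj M N ≫ (relBraidIso M N).hom.hom = (β_ M.X N.X).hom ≫ tproj N M := π_relBraid M N

/-- The modules over a commutative monoid form a symmetric monoidal category. -/
instance relSymmetric : SymmetricCategory (Mod D A) where
  braiding := relBraidIso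
  braiding_naturality_right M N P f := by
    apply tensor_hom_ext
    rw [Mod.comp_hom', Mod.comp_hom', reassoc_of% π_whiskerLeft, π_braid, reassoc_of% π_braid,
      π_whiskerRight, BraidedCategory.braiding_naturality_right_assoc]
  braiding_naturality_left f P := by
    apply tensor_hom_ext
    rw [Mod.comp_hom', Mod.comp_hom', reassoc_of% π_whiskerRight, π_braid, reassoc_of% π_braid,
      π_whiskerLeft, BraidedCategory.braiding_naturality_left_assoc]
  hexagon_forward M N P := by
    apply tensor_hom_ext₃
    simp only [Mod.comp_hom']
    rw [reassoc_of% π_associator, reassoc_of% π_braid, BraidedCategory.braiding_naturality_right_assoc,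
      π_associator, reassoc_of% π_whiskerRight, ← comp_whiskerRight_assoc, π_braid,
      comp_whiskerRight_assoc, reassoc_of% π_associator, π_whiskerLeft, ← whiskerLeft_comp_assoc,
      π_braid]
    simp
  hexagon_reverse M N P := by
    apply tensor_hom_ext₃'
    simp only [Mod.comp_hom']
    rw [π_associator_inv, reassoc_of% π_braid, BraidedCategory.braiding_naturality_left_assoc,
      π_associator_inv', reassoc_of% π_whiskerLeft, ← whiskerLeft_comp_assoc, π_braid,
      whiskerLeft_comp_assoc, π_associator_inv, π_whiskerRight, ← comp_whiskerRight_assoc,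
      π_braid]
    simp
  symmetry := relBraid_relBraid

end Modules

section Powers

/-- Removing the point `i` and its image from a bijection. -/
def rem {m n : ℕ} (e : Fin (m + 1) ≃ Fin (n + 1)) (i : Fin (m + 1)) : Fin m ≃ Fin n :=
  Equiv.removeNone ((finSuccEquiv' i).symm.trans (e.trans (finSuccEquiv' (e i))))

lemma succAbove_rem {m n : ℕ} (e : Fin (m + 1) ≃ Fin (n + 1)) (i : Fin (m + 1)) (j : Fin m) :
    (e i).succAbove (rem e i j) = e (i.succAbove j) := by
  have h : some (rem e i j) = finSuccEquiv' (e i) (e (i.succAbove j)) := by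
    have := Equiv.removeNone_some ((finSuccEquiv' i).symm.trans (e.trans (finSuccEquiv' (e i))))
      (x := j) ⟨((finSuccEquiv' (e i)) (e (i.succAbove j))).get (by
        rw [← Option.ne_none_iff_isSome]
        intro h
        have h' := (finSuccEquiv' (e i)).injective (h.trans (finSuccEquiv'_at (e i)).symm)
        exact Fin.succAbove_ne i j (e.injective h')), by simp⟩
    simpa [rem] using this
  have := congrArg (finSuccEquiv' (e i)).symm h
  simpa using this

lemma rem_eq {m n : ℕ} (e : Fin (m + 1) ≃ Fin (n + 1)) (i : Fin (m + 1)) (f : Fin m ≃ Fin n)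
    (h : ∀ j, (e i).succAbove (f j) = e (i.succAbove j)) : rem e i = f :=
  Equiv.ext fun j => Fin.succAbove_right_injective (p := e i) ((succAbove_rem e i j).trans (h j).symm)

variable {D : Type u} [Category.{v} D] [MonoidalCategory D] [SymmetricCategory D]

/-- The tensor power `X^{⊗ n}`. -/
@[reducible] def pw (X : D) : ℕ → D
  | 0 => 𝟙_ D
  | n + 1 => pw X n ⊗ X

/-- Exchanging the last two factors. -/
def swap (W X : D) : (W ⊗ X) ⊗ X ⟶ (W ⊗ X) ⊗ X :=
  (α_ W X X).hom ≫ W ◁ (β_ X X).hom ≫ (α_ W X X).inv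

lemma swap_swap (W X : D) : swap W X ≫ swap W X = 𝟙 _ := by
  simp [swap, ← whiskerLeft_comp_assoc]

lemma swap_nat {W W' : D} (f : W ⟶ W') (X : D) : f ▷ X ▷ X ≫ swap W' X = swap W X ≫ f ▷ X ▷ X := by
  simp only [swap, Category.assoc, associator_naturality_left_assoc, ← whisker_exchange_assoc,
    associator_inv_naturality_left]

lemma swap_yb (W X : D) : swap (W ⊗ X) X ≫ swap W X ▷ X ≫ swap (W ⊗ X) X =
    swap W X ▷ X ≫ swap (W ⊗ X) X ≫ swap W X ▷ X := by
  have h := BraidedCategory.yang_baxter' X X X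
  calc _ = 𝟙 (((W ⊗ X) ⊗ X) ⊗ X) ⊗≫ W ◁ (𝟙 ((X ⊗ X) ⊗ X) ⊗≫ (X ◁ (β_ X X).hom ⊗≫
        (β_ X X).hom ▷ X ⊗≫ X ◁ (β_ X X).hom) ⊗≫ 𝟙 ((X ⊗ X) ⊗ X)) ⊗≫ 𝟙 (((W ⊗ X) ⊗ X) ⊗ X) := by
        simp only [swap, comp_whiskerRight]
        monoidal
    _ = 𝟙 (((W ⊗ X) ⊗ X) ⊗ X) ⊗≫ W ◁ ((β_ X X).hom ▷ X ⊗≫ X ◁ (β_ X X).hom ⊗≫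
        (β_ X X).hom ▷ X) ⊗≫ 𝟙 (((W ⊗ X) ⊗ X) ⊗ X) := by
        rw [← h]
    _ = _ := by
        simp only [swap, comp_whiskerRight]
        monoidal

/-- Moving the last factor to the position `i`. -/
def ins (X : D) : ∀ (n : ℕ), Fin (n + 1) → (pw X n ⊗ X ⟶ pw X (n + 1))
  | 0, _ => 𝟙 _
  | n + 1, i => Fin.lastCases (motive := fun _ => pw X (n + 1) ⊗ X ⟶ pw X (n + 1 + 1)) (𝟙 _)
      (fun j => swap (pw X n) X ≫ ins X n j ▷ X) i

lemma ins_last (X : D) (n : ℕ) : ins X n (Fin.last n) = 𝟙 _ := by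
  cases n with
  | zero => rfl
  | succ n => exact Fin.lastCases_last

lemma ins_castSucc (X : D) (n : ℕ) (j : Fin (n + 1)) :
    ins X (n + 1) j.castSucc = swap (pw X n) X ≫ ins X n j ▷ X :=
  Fin.lastCases_castSucc _

lemma val_succAbove {n : ℕ} (p : Fin (n + 1)) (i : Fin n) :
    (p.succAbove i).val = if i.val < p.val then i.val else i.val + 1 := by
  rcases lt_or_ge i.castSucc p with h | h
  · rw [Fin.succAbove_of_castSucc_lt _ _ h, if_pos (by simpa [Fin.lt_def] using h)]; rfl
  · rw [Fin.succAbove_of_le_castSucc _ _ h, if_neg (by simpa [Fin.le_def] using h)]; rfl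

lemma ins_exchange_last (X : D) (n : ℕ) (b a' : Fin (n + 1)) (b' : Fin (n + 2))
    (h : (Fin.last _).succAbove b = b') (h' : b'.succAbove a' = Fin.last _) :
    swap (pw X n) X ≫ ins X n b ▷ X ≫ ins X (n + 1) (Fin.last _) =
      ins X n a' ▷ X ≫ ins X (n + 1) b' := by
  rw [Fin.succAbove_last] at h
  subst h
  have : a' = Fin.last _ := by
    have h₁ := congrArg Fin.val h'
    have := a'.isLt
    rw [val_succAbove] at h₁
    ext
    simp only [Fin.val_last] at *
    split_ifs at h₁ <;> omega
  subst this
  rw [ins_last, ins_last, ins_castSucc, id_whiskerRight]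
  exact (congrArg (swap (pw X n) X ≫ ·) (Category.comp_id _)).trans (Category.id_comp _).symm

lemma swap_swap_assoc (W X : D) {Z : D} (f : (W ⊗ X) ⊗ X ⟶ Z) : swap W X ≫ swap W X ≫ f = f := by
  rw [reassoc_of% swap_swap]

lemma ins_exchange (X : D) (n : ℕ) (b a' : Fin (n + 1)) (a b' : Fin (n + 2))
    (h : a.succAbove b = b') (h' : b'.succAbove a' = a) :
    swap (pw X n) X ≫ ins X n b ▷ X ≫ ins X (n + 1) a = ins X n a' ▷ X ≫ ins X (n + 1) b' := by
  induction n with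
  | zero =>
    cases a using Fin.lastCases with
    | last => exact ins_exchange_last X _ b a' b' h h'
    | cast c =>
      cases b' using Fin.lastCases with
      | last => rw [← ins_exchange_last X _ a' b _ h' h, swap_swap_assoc]
      | cast d =>
        have h₁ := congrArg Fin.val h
        rw [val_succAbove] at h₁
        simp only [Fin.val_castSucc] at h₁
        split_ifs at h₁ <;> omega
  | succ n ih =>
    cases a using Fin.lastCases with
    | last => exact ins_exchange_last X _ b a' b' h h'
    | cast c =>
      cases b' using Fin.lastCases with
      | last => rw [← ins_exchange_last X _ a' b _ h' h, swap_swap_assoc]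
      | cast d =>
        cases b using Fin.lastCases with
        | last =>
          have h₁ := congrArg Fin.val h
          rw [val_succAbove] at h₁
          simp only [Fin.val_castSucc, Fin.val_last] at h₁
          split_ifs at h₁ <;> omega
        | cast b =>
          cases a' using Fin.lastCases with
          | last =>
            have h₁ := congrArg Fin.val h'
            rw [val_succAbove] at h₁
            simp only [Fin.val_castSucc, Fin.val_last] at h₁
            split_ifs at h₁ <;> omega
          | cast a =>
            have e := ih b a c d
              (by
                have h₁ := congrArg Fin.val h
                ext
                rw [val_succAbove] at h₁ ⊢
                simpa using h₁)
              (by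
                have h₁ := congrArg Fin.val h'
                ext
                rw [val_succAbove] at h₁ ⊢
                simpa using h₁)
            simp only [ins_castSucc, comp_whiskerRight, Category.assoc]
            rw [reassoc_of% (swap_nat (ins X n b) X), reassoc_of% (swap_nat (ins X n a) X),
              ← comp_whiskerRight, ← comp_whiskerRight, ← e]
            simp only [comp_whiskerRight]
            rw [← reassoc_of% (swap_yb (pw X n) X)]

/-- The action of permutations on tensor powers. -/
def permMap (X : D) : ∀ (m n : ℕ), (Fin m ≃ Fin n) → (pw X m ⟶ pw X n)
  | 0, 0, _ => 𝟙 _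
  | m + 1, n + 1, e => permMap X m n (rem e (Fin.last m)) ▷ X ≫ ins X n (e (Fin.last m))
  | 0, _ + 1, e => (e.symm 0).elim0
  | _ + 1, 0, e => (e 0).elim0

lemma permMap_succ (X : D) (m n : ℕ) (e : Fin (m + 1) ≃ Fin (n + 1)) :
    permMap X (m + 1) (n + 1) e =
      permMap X m n (rem e (Fin.last m)) ▷ X ≫ ins X n (e (Fin.last m)) := rfl

lemma rem_refl (m : ℕ) (i : Fin (m + 1)) : rem (Equiv.refl _) i = Equiv.refl _ :=
  rem_eq _ _ _ fun _ => rfl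

lemma rem_trans {m n p : ℕ} (e : Fin (m + 1) ≃ Fin (n + 1)) (f : Fin (n + 1) ≃ Fin (p + 1))
    (i : Fin (m + 1)) : rem (e.trans f) i = (rem e i).trans (rem f (e i)) :=
  rem_eq _ _ _ fun j => by
    have h₁ := succAbove_rem e i j
    have h₂ := succAbove_rem f (e i) (rem e i j)
    simp only [Equiv.trans_apply, h₂, h₁]

lemma succAbove_comm {n : ℕ} (a b' : Fin (n + 2)) (b a' : Fin (n + 1)) (h : a.succAbove b = b')
    (h' : b'.succAbove a' = a) (k : Fin n) :
    a.succAbove (b.succAbove k) = b'.succAbove (a'.succAbove k) := by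
  have h₁ := congrArg Fin.val h
  have h₂ := congrArg Fin.val h'
  ext
  simp only [val_succAbove] at *
  split_ifs at * <;> omega

lemma ins_permMap (X : D) : ∀ (m n : ℕ) (e : Fin (m + 1) ≃ Fin (n + 1)) (i : Fin (m + 1)),
    ins X m i ≫ permMap X (m + 1) (n + 1) e = permMap X m n (rem e i) ▷ X ≫ ins X n (e i)
  | 0, n, e, i => by
    rw [show i = Fin.last 0 from Subsingleton.elim (α := Fin 1) _ _, ins_last, Category.id_comp, permMap_succ]
  | m + 1, 0, e, i => by
    have := Fintype.card_congr e
    simp at this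
  | m + 1, n + 1, e, i => by
    cases i using Fin.lastCases with
    | last => rw [ins_last, Category.id_comp, permMap_succ]
    | cast j =>
      have h₁ : (e (Fin.last _)).succAbove (rem e (Fin.last _) j) = e j.castSucc := by
        rw [succAbove_rem, Fin.succAbove_last]
      have h₂ : (e j.castSucc).succAbove (rem e j.castSucc (Fin.last _)) = e (Fin.last _) := by
        rw [succAbove_rem]
        congr 1
        ext
        rw [val_succAbove]
        have := j.isLt
        simp only [Fin.val_last, Fin.val_castSucc]
        split_ifs <;> omega
      have h₃ : rem (rem e (Fin.last _)) j = rem (rem e j.castSucc) (Fin.last _) := by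
        apply rem_eq
        intro k
        apply Fin.succAbove_right_injective (p := e (Fin.last _))
        rw [succAbove_comm _ _ _ _ h₁ h₂, succAbove_rem, succAbove_rem, succAbove_rem]
        congr 1
        ext
        simp only [val_succAbove]
        have := k.isLt
        have := j.isLt
        simp only [Fin.val_last, Fin.val_castSucc]
        split_ifs <;> omega
      rw [ins_castSucc, permMap_succ, Category.assoc, ← comp_whiskerRight_assoc,
        ins_permMap X m n, comp_whiskerRight_assoc, permMap_succ, ← h₃, comp_whiskerRight_assoc,
        ← ins_exchange X n _ _ _ _ h₁ h₂, reassoc_of% swap_nat]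

lemma permMap_refl (X : D) (n : ℕ) : permMap X n n (Equiv.refl _) = 𝟙 _ := by
  induction n with
  | zero => rfl
  | succ n ih =>
    rw [permMap_succ, rem_refl, ih]
    simp [ins_last]

lemma permMap_trans (X : D) : ∀ (m n p : ℕ) (e : Fin m ≃ Fin n) (f : Fin n ≃ Fin p),
    permMap X m p (e.trans f) = permMap X m n e ≫ permMap X n p f
  | 0, 0, 0, e, f => (Category.id_comp _).symm
  | 0, 0, _ + 1, _, f => (f.symm 0).elim0
  | 0, _ + 1, _, e, _ => (e.symm 0).elim0
  | _ + 1, 0, _, e, _ => (e 0).elim0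
  | _ + 1, _ + 1, 0, _, f => (f 0).elim0
  | m + 1, n + 1, p + 1, e, f => by
    rw [permMap_succ, permMap_succ X m n e, Category.assoc, ins_permMap, rem_trans,
      permMap_trans X m n p]
    simp

/-- Concatenation of tensor powers. -/
def cat (X : D) (m : ℕ) : ∀ n : ℕ, pw X m ⊗ pw X n ⟶ pw X (m + n)
  | 0 => (ρ_ (pw X m)).hom
  | n + 1 => (α_ (pw X m) (pw X n) X).inv ≫ cat X m n ▷ X

lemma cat_zero (X : D) (m : ℕ) : cat X m 0 = (ρ_ (pw X m)).hom := rfl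

lemma cat_succ (X : D) (m n : ℕ) :
    cat X m (n + 1) = (α_ (pw X m) (pw X n) X).inv ≫ cat X m n ▷ X := rfl

lemma blockSum_castAdd {m m' n n' : ℕ} (e : Fin m ≃ Fin m') (f : Fin n ≃ Fin n') (i : Fin m) :
    Sym.blockSum e f (Fin.castAdd n i) = Fin.castAdd n' (e i) := by
  simp [Sym.blockSum]

lemma blockSum_natAdd {m m' n n' : ℕ} (e : Fin m ≃ Fin m') (f : Fin n ≃ Fin n') (i : Fin n) :
    Sym.blockSum e f (Fin.natAdd m i) = Fin.natAdd m' (f i) := by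
  simp [Sym.blockSum]

lemma val_shuffle (m n : ℕ) (i : Fin (m + n)) :
    (shuffle m n i).val = if i.val < m then n + i.val else i.val - m := by
  cases i using Fin.addCases with
  | left i =>
    have := shuffle_sum m n (Sum.inl i)
    simp only [finSumFinEquiv_apply_left, Equiv.sumComm_apply, Sum.swap_inl,
      finSumFinEquiv_apply_right] at this
    rw [this]
    simp
  | right i =>
    have := shuffle_sum m n (Sum.inr i)
    simp only [finSumFinEquiv_apply_left, Equiv.sumComm_apply, Sum.swap_inr,
      finSumFinEquiv_apply_right] at this
    rw [this]
    simp

lemma blockSum_zero {m m' : ℕ} (e : Fin m ≃ Fin m') : Sym.blockSum e (Equiv.refl (Fin 0)) = e :=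
  Equiv.ext fun i => blockSum_castAdd e (Equiv.refl (Fin 0)) i

lemma blockSum_last {m m' n n' : ℕ} (e : Fin m ≃ Fin m') (f : Fin (n + 1) ≃ Fin (n' + 1)) :
    Sym.blockSum e f (Fin.last (m + n)) = Fin.natAdd m' (f (Fin.last n)) :=
  blockSum_natAdd e f (Fin.last n)

lemma rem_blockSum {m m' n n' : ℕ} (e : Fin m ≃ Fin m') (f : Fin (n + 1) ≃ Fin (n' + 1)) :
    rem (m := m + n) (n := m' + n') (Sym.blockSum e f : Fin (m + (n + 1)) ≃ Fin (m' + (n' + 1)))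
      (Fin.last (m + n)) =
      Sym.blockSum e (rem f (Fin.last n)) := by
  apply rem_eq
  intro j
  rw [blockSum_last, Fin.succAbove_last]
  cases j using Fin.addCases with
  | left i =>
    rw [blockSum_castAdd, show (Fin.castAdd n i).castSucc = Fin.castAdd (n + 1) i from rfl]
    refine Eq.trans ?_ (blockSum_castAdd e f i).symm
    ext
    rw [val_succAbove]
    have := (e i).isLt
    simp only [Fin.val_castAdd, Fin.val_natAdd]
    split_ifs <;> omega
  | right i =>
    rw [blockSum_natAdd, show (Fin.natAdd m i).castSucc = Fin.natAdd m i.castSucc from rfl]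
    refine Eq.trans ?_ (blockSum_natAdd e f i.castSucc).symm
    have := congrArg Fin.val (succAbove_rem f (Fin.last n) i)
    rw [val_succAbove, Fin.succAbove_last] at this
    ext
    rw [val_succAbove]
    simp only [Fin.val_natAdd]
    split_ifs at * <;> omega

lemma permMap_blockSum_succ (X : D) {m m' n : ℕ} (e : Fin m ≃ Fin m') :
    permMap X (m + (n + 1)) (m' + (n + 1)) (Sym.blockSum e (Equiv.refl (Fin (n + 1)))) =
      permMap X (m + n) (m' + n) (Sym.blockSum e (Equiv.refl (Fin n))) ▷ X := by
  refine (permMap_succ X (m + n) (m' + n) _).trans ?_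
  rw [rem_blockSum, rem_refl, blockSum_last]
  exact (congrArg (_ ≫ ·) (ins_last X (m' + n))).trans (Category.comp_id _)

lemma permMap_whiskerRight_cat (X : D) {m m' : ℕ} (n : ℕ) (e : Fin m ≃ Fin m') :
    permMap X m m' e ▷ pw X n ≫ cat X m' n =
      cat X m n ≫ permMap X (m + n) (m' + n) (Sym.blockSum e (Equiv.refl _)) := by
  induction n with
  | zero =>
    rw [blockSum_zero, cat_zero, cat_zero]
    exact rightUnitor_naturality _
  | succ n ih =>
    rw [permMap_blockSum_succ, cat_succ, cat_succ, associator_inv_naturality_left_assoc,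
      ← comp_whiskerRight, ih]
    simp

lemma whiskerLeft_ins_cat (X : D) (m n : ℕ) (i : Fin (n + 1)) :
    pw X m ◁ ins X n i ≫ cat X m (n + 1) =
      (α_ (pw X m) (pw X n) X).inv ≫ cat X m n ▷ X ≫ ins X (m + n) (Fin.natAdd m i) := by
  have h (n : ℕ) : pw X m ◁ ins X n (Fin.last n) ≫ cat X m (n + 1) =
      (α_ (pw X m) (pw X n) X).inv ≫ cat X m n ▷ X ≫ ins X (m + n) (Fin.natAdd m (Fin.last n)) := by
    have : ins X (m + n) (Fin.natAdd m (Fin.last n)) = 𝟙 _ := ins_last X (m + n)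
    rw [ins_last, this, cat_succ]
    simp
  induction n with
  | zero =>
    rw [show i = Fin.last 0 from Subsingleton.elim (α := Fin 1) _ _]
    exact h 0
  | succ n ih =>
    cases i using Fin.lastCases with
    | last => exact h (n + 1)
    | cast j =>
      have : ins X (m + (n + 1)) (Fin.natAdd m j.castSucc) =
        swap (pw X (m + n)) X ≫ ins X (m + n) (Fin.natAdd m j) ▷ X :=
        ins_castSucc X (m + n) (Fin.natAdd m j)
      rw [this, ins_castSucc, cat_succ, cat_succ, comp_whiskerRight_assoc,
        reassoc_of% swap_nat, ← comp_whiskerRight]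
      have := ih j
      rw [Iso.eq_inv_comp] at this
      rw [← this]
      simp [swap, cat_succ]

lemma permMap_whiskerLeft_cat (X : D) (m : ℕ) : ∀ (n n' : ℕ) (e : Fin n ≃ Fin n'),
    pw X m ◁ permMap X n n' e ≫ cat X m n' =
      cat X m n ≫ permMap X (m + n) (m + n') (Sym.blockSum (Equiv.refl _) e)
  | 0, 0, e => by
    rw [show e = Equiv.refl _ from Subsingleton.elim _ _, permMap_refl, blockSum_zero]
    refine Eq.trans ?_ (congrArg (cat X m 0 ≫ ·) (permMap_refl X m)).symm
    simp
  | 0, _ + 1, e => (e.symm 0).elim0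
  | _ + 1, 0, e => (e 0).elim0
  | n + 1, n' + 1, e => by
    have : permMap X (m + (n + 1)) (m + (n' + 1)) (Sym.blockSum (Equiv.refl _) e) =
        permMap X (m + n) (m + n') (Sym.blockSum (Equiv.refl _) (rem e (Fin.last n))) ▷ X ≫
          ins X (m + n') (Fin.natAdd m (e (Fin.last n))) := by
      refine (permMap_succ X (m + n) (m + n') _).trans ?_
      rw [rem_blockSum, blockSum_last]
    rw [this, permMap_succ, whiskerLeft_comp, Category.assoc, whiskerLeft_ins_cat, cat_succ,
      associator_inv_naturality_middle_assoc, ← comp_whiskerRight_assoc,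
      permMap_whiskerLeft_cat X m n n']
    simp

lemma permMap_finCongr_succ (X : D) {a b : ℕ} (h : a = b) (h' : a + 1 = b + 1) :
    permMap X (a + 1) (b + 1) (finCongr h') = permMap X a b (finCongr h) ▷ X := by
  subst h
  rw [show finCongr h' = Equiv.refl _ from rfl, show finCongr rfl = Equiv.refl _ from rfl,
    permMap_refl, permMap_refl]
  simp

lemma cat_assoc (X : D) (m n p : ℕ) :
    cat X m n ▷ pw X p ≫ cat X (m + n) p ≫
        permMap X (m + n + p) (m + (n + p)) (finCongr (Nat.add_assoc m n p)) =
      (α_ _ _ _).hom ≫ pw X m ◁ cat X n p ≫ cat X m (n + p) := by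
  induction p with
  | zero =>
    refine (congrArg (fun t => cat X m n ▷ pw X 0 ≫ cat X (m + n) 0 ≫ t)
      (permMap_refl X (m + n))).trans ?_
    simp [cat_zero]
  | succ p ih =>
    refine (congrArg (fun t => cat X m n ▷ pw X (p + 1) ≫ cat X (m + n) (p + 1) ≫ t)
      (permMap_finCongr_succ X (Nat.add_assoc m n p) _)).trans ?_
    refine Eq.trans ?_ (congrArg (fun t => (α_ _ _ _).hom ≫ pw X m ◁ cat X n (p + 1) ≫ t)
      (cat_succ X m (n + p))).symm
    rw [cat_succ, cat_succ]
    rw [Category.assoc, associator_inv_naturality_left_assoc, ← comp_whiskerRight,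
      ← comp_whiskerRight, ih]
    simp

lemma cat_zero_left (X : D) (n : ℕ) :
    cat X 0 n ≫ permMap X (0 + n) n (finCongr (Nat.zero_add n)) = (λ_ (pw X n)).hom := by
  induction n with
  | zero =>
    refine (congrArg (cat X 0 0 ≫ ·) (permMap_refl X 0)).trans ?_
    simp [cat_zero, unitors_equal]
  | succ n ih =>
    refine (congrArg (fun t => cat X 0 (n + 1) ≫ t)
      (permMap_finCongr_succ X (Nat.zero_add n) _)).trans ?_
    rw [cat_succ, Category.assoc, ← comp_whiskerRight, ih]
    simp

lemma cat_braid_one (X : D) (n m : ℕ) (e : Fin (n + m + 1) ≃ Fin (n + 1 + m))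
    (he : ∀ i, (e i).val = if i.val < n then i.val else if i.val < n + m then i.val + 1 else n) :
    pw X n ◁ (β_ (pw X m) X).hom ≫ (α_ _ _ _).inv ≫ cat X (n + 1) m =
      (α_ _ _ _).inv ≫ cat X n m ▷ X ≫ permMap X (n + m + 1) (n + 1 + m) e := by
  induction m with
  | zero =>
    have : e = Equiv.refl _ := by
      ext i
      have := he i
      have := i.isLt
      simp only [Equiv.refl_apply]
      split_ifs at * <;> omega
    subst this
    refine Eq.trans ?_ (congrArg (fun t => (α_ _ _ _).inv ≫ cat X n 0 ▷ X ≫ t)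
      (permMap_refl X (n + 1))).symm
    simp [cat_zero]
  | succ m ih =>
    change Fin (n + m + 1 + 1) ≃ Fin (n + 1 + m + 1) at e
    have hl : e (Fin.last (n + m)).castSucc = Fin.last (n + 1 + m) := by
      ext
      have := he (Fin.last (n + m)).castSucc
      simp only [Fin.val_castSucc, Fin.val_last] at *
      split_ifs at * <;> omega
    have key := ins_permMap X (n + m + 1) (n + 1 + m) e (Fin.last (n + m)).castSucc
    rw [hl, ins_last, ins_castSucc, ins_last, id_whiskerRight, Category.comp_id] at key
    have h := ih (rem e (Fin.last (n + m)).castSucc) (by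
      intro i
      have h₁ := congrArg Fin.val (succAbove_rem e (Fin.last (n + m)).castSucc i)
      rw [hl, Fin.succAbove_last] at h₁
      have h₂ := he ((Fin.last (n + m)).castSucc.succAbove i)
      have h₃ := val_succAbove (Fin.last (n + m)).castSucc i
      have := i.isLt
      simp only [Fin.val_castSucc, Fin.val_last] at *
      rw [h₁]
      refine h₂.trans ?_
      rw [h₃]
      split_ifs <;> omega)
    have key' : permMap X (n + m + 1 + 1) (n + 1 + m + 1) e = swap (pw X (n + m)) X ≫
        permMap X (n + m + 1) (n + 1 + m) (rem e (Fin.last (n + m)).castSucc) ▷ X := by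
      rw [← swap_swap_assoc (pw X (n + m)) X (permMap X (n + m + 1 + 1) (n + 1 + m + 1) e)]
      exact congrArg (swap (pw X (n + m)) X ≫ ·) (key.trans (Category.comp_id _))
    refine Eq.trans ?_ (congrArg (fun t => (α_ _ _ _).inv ≫ cat X n (m + 1) ▷ X ≫ t) key').symm
    rw [cat_succ, cat_succ, comp_whiskerRight, Category.assoc, reassoc_of% swap_nat,
      ← comp_whiskerRight]
    rw [Iso.eq_inv_comp] at h
    rw [← h]
    simp [swap]

lemma cat_braid (X : D) (m n : ℕ) :
    (β_ (pw X m) (pw X n)).hom ≫ cat X n m =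
      cat X m n ≫ permMap X (m + n) (n + m) (shuffle m n) := by
  induction n with
  | zero =>
    have : shuffle m 0 = finCongr (Nat.zero_add m).symm := by
      ext i
      have := i.isLt
      have h := val_shuffle m 0 i
      simp only [finCongr_apply, Fin.val_cast]
      rw [h]
      split_ifs <;> omega
    have h := cat_zero_left X m
    have h₂ : permMap X (0 + m) m (finCongr (Nat.zero_add m)) ≫
        permMap X m (0 + m) (finCongr (Nat.zero_add m).symm) = 𝟙 _ := by
      rw [← permMap_trans, ← permMap_refl]
      rfl
    have h₃ : cat X 0 m = (λ_ (pw X m)).hom ≫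
        permMap X m (0 + m) (finCongr (Nat.zero_add m).symm) := by
      rw [← h, Category.assoc, h₂, Category.comp_id]
    rw [this, h₃]
    refine Eq.trans ?_ (congrArg (fun t => t ≫ permMap X m (0 + m)
      (finCongr (Nat.zero_add m).symm)) (cat_zero X m).symm)
    simp
  | succ n ih =>
    let e : Fin (n + m + 1) ≃ Fin (n + 1 + m) :=
      (show Fin (n + m + 1) ≃ Fin (m + n + 1) from
        Sym.blockSum (shuffle n m) (Equiv.refl (Fin 1))).trans (shuffle m (n + 1))
    have he (i) : (e i).val = if i.val < n then i.val else if i.val < n + m then i.val + 1 else n := by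
      change (shuffle m (n + 1) (Sym.blockSum (shuffle n m) (Equiv.refl (Fin 1)) i)).val = _
      rw [val_shuffle]
      cases i using Fin.addCases with
      | left i =>
        have := i.isLt
        rw [blockSum_castAdd, Fin.val_castAdd, Fin.val_castAdd, val_shuffle]
        split_ifs <;> omega
      | right i =>
        rw [blockSum_natAdd, Fin.val_natAdd, Fin.val_natAdd]
        have := i.isLt
        rw [Equiv.refl_apply, if_neg (by omega), if_neg (by omega), if_neg (by omega)]
        omega
    have h := cat_braid_one X n m e he
    have h' : permMap X (m + (n + 1)) (n + 1 + m) (shuffle m (n + 1)) =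
        permMap X (m + n) (n + m) (shuffle m n) ▷ X ≫ permMap X (n + m + 1) (n + 1 + m) e := by
      have b : permMap X (n + m + 1) (m + n + 1)
          (Sym.blockSum (shuffle n m) (Equiv.refl (Fin 1))) =
          permMap X (n + m) (m + n) (shuffle n m) ▷ X :=
        (permMap_blockSum_succ X (n := 0) (shuffle n m)).trans (by rw [blockSum_zero]; rfl)
      have t : (shuffle m n).trans (shuffle n m) = Equiv.refl _ := by
        ext i
        have := i.isLt
        simp only [Equiv.trans_apply, val_shuffle, Equiv.refl_apply]
        split_ifs <;> omega
      have c : permMap X (n + m + 1) (n + 1 + m) e =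
          permMap X (n + m) (m + n) (shuffle n m) ▷ X ≫
            permMap X (m + n + 1) (n + 1 + m) (shuffle m (n + 1)) := by
        rw [← b, ← permMap_trans]
      rw [c, ← comp_whiskerRight_assoc, ← permMap_trans, t, permMap_refl, id_whiskerRight]
      exact (Category.id_comp _).symm
    rw [h', cat_succ, BraidedCategory.braiding_tensor_right_hom]
    simp only [Category.assoc]
    rw [h, Iso.hom_inv_id_assoc, ← comp_whiskerRight_assoc, ih]
    simp

end Powers

section DayMonoid

open LawfulDayConvolutionMonoidalCategoryStruct
open scoped MonoidalCategory.ExternalProduct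
open scoped DayConvolution

variable {K : Type} [Category.{0} K] [MonoidalCategory K] [SymmetricCategory K]
  {V : Type u} [Category.{v} V] [MonoidalCategory V] [SymmetricCategory V]
  [HasColimitsOfSize.{0, 0} V] [∀ v : V, PreservesColimitsOfSize.{0, 0} (tensorLeft v)]

/-- The universal map `F(x) ⊗ G(y) ⟶ (F ⊗ G)(x ⊗ y)` of the Day convolution. -/
def dη (F G : DayFunctor K V) (x y : K) :
    F.functor.obj x ⊗ G.functor.obj y ⟶ (F ⊗ G).functor.obj (x ⊗ y) :=
  (dayη F G).app (x, y)

lemma day_comp_app {F G H : DayFunctor K V} (f : F ⟶ G) (g : G ⟶ H) (x : K) :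
    (f ≫ g).natTrans.app x = f.natTrans.app x ≫ g.natTrans.app x := rfl

lemma day_id_app (F : DayFunctor K V) (x : K) :
    NatTrans.app (DayFunctor.Hom.natTrans (𝟙 F)) x = 𝟙 (F.functor.obj x) := rfl

lemma dη_braiding (F G : DayFunctor K V) (x y : K) :
    dη F G x y ≫ (β_ F G).hom.natTrans.app (x ⊗ y) =
      (β_ (F.functor.obj x) (G.functor.obj y)).hom ≫ dη G F y x ≫
        (G ⊗ F).functor.map (β_ y x).hom := η_braiding F G x y

lemma dη_whiskerLeft (F : DayFunctor K V) {G H : DayFunctor K V} (g : G ⟶ H) (x y : K) :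
    dη F G x y ≫ (F ◁ g).natTrans.app (x ⊗ y) =
      F.functor.obj x ◁ g.natTrans.app y ≫ dη F H x y := η_whiskerLeft F g x y

lemma dη_whiskerRight {G H : DayFunctor K V} (g : G ⟶ H) (F : DayFunctor K V) (x y : K) :
    dη G F x y ≫ (g ▷ F).natTrans.app (x ⊗ y) =
      g.natTrans.app x ▷ F.functor.obj y ≫ dη H F x y := η_whiskerRight g F x y

lemma dη_associator (F G H : DayFunctor K V) (x y z : K) :
    dη F G x y ▷ H.functor.obj z ≫ dη (F ⊗ G) H (x ⊗ y) z ≫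
      (α_ F G H).hom.natTrans.app ((x ⊗ y) ⊗ z) =
    (α_ _ _ _).hom ≫ F.functor.obj x ◁ dη G H y z ≫
      dη F (G ⊗ H) x (y ⊗ z) ≫ (F ⊗ G ⊗ H).functor.map (α_ x y z).inv := η_associator F G H x y z

lemma dν_leftUnitor (F : DayFunctor K V) (y : K) :
    dayν K V ▷ F.functor.obj y ≫ dη (𝟙_ _) F (𝟙_ K) y ≫ (λ_ F).hom.natTrans.app (𝟙_ K ⊗ y) =
    (λ_ (F.functor.obj y)).hom ≫ F.functor.map (λ_ y).inv := ν_leftUnitor F y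

lemma dη_tensorDesc {F G H : DayFunctor K V} (m : F.functor ⊠ G.functor ⟶ tensor K ⋙ H.functor)
    (x y : K) :
    dη F G x y ≫ (DayFunctor.tensorDesc m).natTrans.app (x ⊗ y) = m.app (x, y) :=
  DayFunctor.η_comp_tensorDesc_app m x y

lemma dν_unitDesc {F : DayFunctor K V} (u : 𝟙_ V ⟶ F.functor.obj (𝟙_ K)) :
    dayν K V ≫ (DayFunctor.unitDesc u).natTrans.app (𝟙_ K) = u :=
  DayFunctor.ν_comp_unitDesc u

lemma day_hom_ext {F G H : DayFunctor K V} {f g : F ⊗ G ⟶ H}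
    (h : ∀ x y, dη F G x y ≫ f.natTrans.app (x ⊗ y) =
      dη F G x y ≫ g.natTrans.app (x ⊗ y)) : f = g := by
  apply DayFunctor.tensor_hom_ext
  intro x y
  exact h x y

lemma day_hom_ext₃ {F G H L : DayFunctor K V} {f g : (F ⊗ G) ⊗ H ⟶ L}
    (h : ∀ x y z, dη F G x y ▷ H.functor.obj z ≫ dη (F ⊗ G) H (x ⊗ y) z ≫
        f.natTrans.app ((x ⊗ y) ⊗ z) =
      dη F G x y ▷ H.functor.obj z ≫ dη (F ⊗ G) H (x ⊗ y) z ≫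
        g.natTrans.app ((x ⊗ y) ⊗ z)) : f = g := by
  have : ((F ⊗ G).functor ⊠ H.functor).IsLeftKanExtension
      (ExternalProduct.extensionUnitLeft (F ⊗ G).functor (dayη F G) H.functor) :=
    (ExternalProduct.isPointwiseLeftKanExtensionExtensionUnitLeft _ _ _
      (isPointwiseLeftKanExtensionConvolutionExtensionUnit F G)).isLeftKanExtension
  apply DayFunctor.hom_ext
  apply Functor.hom_ext_of_isLeftKanExtension _ (dayη (F ⊗ G) H)
  apply Functor.hom_ext_of_isLeftKanExtension _
    (ExternalProduct.extensionUnitLeft (F ⊗ G).functor (dayη F G) H.functor)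
  ext ⟨⟨x, y⟩, z⟩
  simpa [ExternalProduct.extensionUnitLeft] using! h x y z

lemma unit_tensor_hom_ext {F L : DayFunctor K V} {f g : 𝟙_ (DayFunctor K V) ⊗ F ⟶ L}
    (h : ∀ y, dayν K V ▷ F.functor.obj y ≫ dη (𝟙_ _) F (𝟙_ K) y ≫ f.natTrans.app (𝟙_ K ⊗ y) =
      dayν K V ▷ F.functor.obj y ≫ dη (𝟙_ _) F (𝟙_ K) y ≫ g.natTrans.app (𝟙_ K ⊗ y)) :
    f = g := by
  rw [← cancel_epi (λ_ F).inv]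
  apply DayFunctor.hom_ext
  ext y
  have e : (λ_ F).inv.natTrans.app y ≫ (𝟙_ (DayFunctor K V) ⊗ F).functor.map (λ_ y).inv =
      (λ_ (F.functor.obj y)).inv ≫ dayν K V ▷ F.functor.obj y ≫ dη (𝟙_ _) F (𝟙_ K) y := by
    have h₁ := dν_leftUnitor F y
    have h₂ : (λ_ F).hom.natTrans.app (𝟙_ K ⊗ y) ≫ (λ_ F).inv.natTrans.app (𝟙_ K ⊗ y) = 𝟙 _ :=
      congrArg (fun t => t.natTrans.app (𝟙_ K ⊗ y)) (λ_ F).hom_inv_id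
    rw [Iso.eq_inv_comp, ← (λ_ F).inv.natTrans.naturality, ← reassoc_of% h₁, h₂, Category.comp_id]
  have k (t : 𝟙_ (DayFunctor K V) ⊗ F ⟶ L) : (λ_ F).inv.natTrans.app y ≫ t.natTrans.app y =
      ((λ_ (F.functor.obj y)).inv ≫ dayν K V ▷ F.functor.obj y ≫
        dη (𝟙_ _) F (𝟙_ K) y ≫ t.natTrans.app (𝟙_ K ⊗ y)) ≫ L.functor.map (λ_ y).hom := by
    rw [← reassoc_of% e]
    simp
  refine (k f).trans (Eq.trans ?_ (k g).symm)
  rw [h]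

section CommMonoid

variable (F : DayFunctor K V) (u : 𝟙_ V ⟶ F.functor.obj (𝟙_ K))
    (m : F.functor ⊠ F.functor ⟶ tensor K ⋙ F.functor)

lemma day_mul_comm (hc : ∀ x y, (β_ (F.functor.obj x) (F.functor.obj y)).hom ≫ m.app (y, x) =
      m.app (x, y) ≫ F.functor.map (β_ x y).hom) :
    (β_ F F).hom ≫ DayFunctor.tensorDesc m = DayFunctor.tensorDesc m := by
  apply day_hom_ext
  intro x y
  rw [day_comp_app, reassoc_of% dη_braiding, (DayFunctor.tensorDesc m).natTrans.naturality,
    reassoc_of% dη_tensorDesc, dη_tensorDesc, reassoc_of% (hc x y)]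
  simp [← CategoryTheory.Functor.map_comp]

lemma day_one_mul (hl : ∀ y, u ▷ F.functor.obj y ≫ m.app (𝟙_ K, y) =
      (λ_ (F.functor.obj y)).hom ≫ F.functor.map (λ_ y).inv) :
    DayFunctor.unitDesc u ▷ F ≫ DayFunctor.tensorDesc m = (λ_ F).hom := by
  apply unit_tensor_hom_ext
  intro y
  rw [day_comp_app, dν_leftUnitor, reassoc_of% dη_whiskerRight, dη_tensorDesc,
    ← comp_whiskerRight_assoc, dν_unitDesc]
  exact hl y

lemma day_mul_assoc (ha : ∀ x y z, m.app (x, y) ▷ F.functor.obj z ≫ m.app (x ⊗ y, z) =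
    (α_ (F.functor.obj x) (F.functor.obj y) (F.functor.obj z)).hom ≫
      F.functor.obj x ◁ m.app (y, z) ≫ m.app (x, y ⊗ z) ≫ F.functor.map (α_ x y z).inv) :
    DayFunctor.tensorDesc m ▷ F ≫ DayFunctor.tensorDesc m =
    (α_ F F F).hom ≫ F ◁ DayFunctor.tensorDesc m ≫ DayFunctor.tensorDesc m := by
  apply day_hom_ext₃
  intro x y z
  rw [day_comp_app, day_comp_app, day_comp_app, reassoc_of% dη_associator,
    reassoc_of% dη_whiskerRight, (F ◁ DayFunctor.tensorDesc m).natTrans.naturality_assoc,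
    (DayFunctor.tensorDesc m).natTrans.naturality, reassoc_of% dη_whiskerLeft, dη_tensorDesc,
    reassoc_of% dη_tensorDesc, ← whiskerLeft_comp_assoc, ← comp_whiskerRight_assoc,
    dη_tensorDesc, dη_tensorDesc]
  exact ha x y z

end CommMonoid

end DayMonoid

section SymMonoid

open scoped MonoidalCategory.ExternalProduct

variable {D : Type u} [Category.{v} D] [MonoidalCategory D] [SymmetricCategory D]
  [HasColimitsOfSize.{0, 0} D] [∀ X : D, PreservesColimitsOfSize.{0, 0} (tensorLeft X)]

/-- The symmetric sequence `Sym(X) = (𝟙, X, X^{⊗ 2}, X^{⊗ 3}, …)`, on which the symmetric groups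
act by permutations of the factors. -/
def symPow (X : D) : DayFunctor Sym D := .mk
  { obj n := pw X n.n
    map {m n} f := permMap X m.n n.n f
    map_id n := permMap_refl X n.n
    map_comp {m n p} f g := permMap_trans X m.n n.n p.n f g }

lemma blockSum_comp {m m' n n' : ℕ} (e : Fin m ≃ Fin m') (f : Fin n ≃ Fin n') :
    (Sym.blockSum e (Equiv.refl (Fin n))).trans (Sym.blockSum (Equiv.refl (Fin m')) f) =
      Sym.blockSum e f := by
  ext i
  cases i using Fin.addCases with
  | left i => simp [blockSum_castAdd]
  | right i => simp [blockSum_natAdd]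

/-- The concatenation maps `X^{⊗ m} ⊗ X^{⊗ n} ⟶ X^{⊗ (m + n)}`. -/
def catNat (X : D) : (symPow X).functor ⊠ (symPow X).functor ⟶ tensor Sym ⋙ (symPow X).functor where
  app x := cat X x.1.n x.2.n
  naturality x y f := by
    have h₁ := permMap_whiskerRight_cat X x.2.n f.1
    have h₂ := permMap_whiskerLeft_cat X y.1.n _ _ f.2
    change (permMap X x.1.n y.1.n f.1 ▷ pw X x.2.n ≫ pw X y.1.n ◁ permMap X x.2.n y.2.n f.2) ≫
        cat X y.1.n y.2.n =
      cat X x.1.n x.2.n ≫ permMap X (x.1.n + x.2.n) (y.1.n + y.2.n) (Sym.blockSum f.1 f.2)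
    rw [Category.assoc, h₂, reassoc_of% h₁, ← permMap_trans, blockSum_comp]

lemma symPow_map (X : D) {m n : Sym} (f : m ⟶ n) :
    (symPow X).functor.map f = permMap X m.n n.n f := rfl

/-- The unit `𝟙 ⟶ Sym(X)`, the identity of `𝟙` in degree `0`. -/
def symOne (X : D) : 𝟙_ (DayFunctor Sym D) ⟶ symPow X :=
  DayFunctor.unitDesc (F := symPow X) (𝟙 (𝟙_ D))

/-- The multiplication of `Sym(X)`, given by concatenation. -/
def symMul (X : D) : symPow X ⊗ symPow X ⟶ symPow X := DayFunctor.tensorDesc (catNat X)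

lemma symPow_mul_comm (X : D) :
    (β_ (symPow X) (symPow X)).hom ≫ symMul X =
      symMul X :=
  day_mul_comm _ _ fun x y => cat_braid X x.n y.n

lemma symPow_one_mul (X : D) :
    symOne X ▷ symPow X ≫ symMul X =
      (λ_ (symPow X)).hom :=
  day_one_mul _ _ _ fun y => by
    have h : (λ_ (pw X y.n)).hom ≫ permMap X y.n (0 + y.n) (finCongr (Nat.zero_add y.n)).symm =
        cat X 0 y.n := by
      rw [← cat_zero_left, Category.assoc, ← permMap_trans, Equiv.self_trans_symm, permMap_refl,
        Category.comp_id]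
    have h' : 𝟙 (𝟙_ D) ▷ pw X y.n ≫ cat X 0 y.n =
      (λ_ (pw X y.n)).hom ≫ permMap X y.n (0 + y.n) (finCongr (Nat.zero_add y.n)).symm := by
      rw [h, id_whiskerRight, Category.id_comp]
    exact h'

lemma symPow_mul_assoc (X : D) :
    symMul X ▷ symPow X ≫ symMul X =
      (α_ _ _ _).hom ≫ symPow X ◁ symMul X ≫
        symMul X :=
  day_mul_assoc _ _ fun x y z => by
    have h : cat X x.n y.n ▷ pw X z.n ≫ cat X (x.n + y.n) z.n =
        (α_ _ _ _).hom ≫ pw X x.n ◁ cat X y.n z.n ≫ cat X x.n (y.n + z.n) ≫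
          permMap X (x.n + (y.n + z.n)) (x.n + y.n + z.n)
            (finCongr (Nat.add_assoc x.n y.n z.n)).symm := by
      rw [← reassoc_of% cat_assoc, ← permMap_trans, Equiv.self_trans_symm, permMap_refl,
        Category.comp_id]
    exact h

/-- The commutative monoid structure of `Sym(X)`, given by concatenation. -/
instance symPowMon (X : D) : MonObj (symPow X) where
  one := symOne X
  mul := symMul X
  one_mul := symPow_one_mul X
  mul_one := by
    rw [← symPow_mul_comm, BraidedCategory.braiding_naturality_right_assoc, symPow_one_mul]
    simp
  mul_assoc := symPow_mul_assoc X

instance (X : D) : IsCommMonObj (symPow X) where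
  mul_comm := symPow_mul_comm X

end SymMonoid

section T

variable (C : Type u) [Category.{v} C] [MonoidalCategory C] [SymmetricCategory C]
  [HasColimitsOfSize.{0, 0} C] [∀ X : C, PreservesColimitsOfSize.{0, 0} (tensorLeft X)]

/-- The members of the sequence `(∅, 𝟙, ∅, ∅, …)`. -/
def sphereObj : ℕ → C
  | 1 => 𝟙_ C
  | _ => ⊥_ C

/-- The symmetric sequence `T = (∅, 𝟙, ∅, ∅, …)`. Its symmetric groups act trivially. -/
def sphereT : DayFunctor Sym C := .mk
  { obj n := sphereObj C n.n
    map {m n} f := eqToHom (congrArg (sphereObj C) (Fin.equiv_iff_eq.1 ⟨f⟩)) }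

/-- The category of symmetric `T`-spectra in `C^Σ`: the modules over the commutative monoid
`Sym(T)` in `(C^Σ)^Σ`. It is symmetric monoidal under the relative tensor product over `Sym(T)`.

Of the colimits of `C` only those of diagrams indexed by categories in `Type` are needed; a category
with all colimits has them. -/
abbrev Spectra : Type _ := Mod (DayFunctor Sym (DayFunctor Sym C)) (symPow (sphereT C))

end T

/-- The standard map `(i, n) ⟶ (i + 1, n + 1)`, the two standard inclusions together with the
unique bijection between the complements `{i + 1}` and `{n + 1}` of their images. -/
def stdMap (i n : ℕ) : (⟨i, n⟩ : J) ⟶ ⟨i + 1, n + 1⟩ :=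
  show JHom (Fin i) (Fin n) (Fin (i + 1)) (Fin (n + 1)) from
  { fst := Fin.castSuccEmb
    snd := Fin.castSuccEmb
    bij :=
      { toFun _ := ⟨Fin.last n, by simp⟩
        invFun _ := ⟨Fin.last i, by simp⟩
        left_inv x := by
          obtain ⟨x, hx⟩ := x
          cases x using Fin.lastCases with
          | last => rfl
          | cast x => exact absurd ⟨x, rfl⟩ hx
        right_inv x := by
          obtain ⟨x, hx⟩ := x
          cases x using Fin.lastCases with
          | last => rfl
          | cast x => exact absurd ⟨x, rfl⟩ hx } }

section

variable (C : Type u) [Category.{v} C] [MonoidalCategory C] [SymmetricCategory C]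
  [HasColimitsOfSize.{0, 0} C] [∀ X : C, PreservesColimitsOfSize.{0, 0} (tensorLeft X)]

/-- The restriction `j^* : C^J ⥤ (C^Σ)^Σ` along `j : Σ × Σ ⥤ J`, with
`(j^* X)_{i,n} = X(i, n)`. -/
def jStar : DayFunctor J C ⥤ DayFunctor Sym (DayFunctor Sym C) where
  obj X := .mk
    { obj i := .mk
        { obj n := X.functor.obj (incl.obj (i, n))
          map f := X.functor.map (incl.map (X := (i, _)) (Y := (i, _)) (𝟙 i, f))
          map_id n := by
            rw [← CategoryTheory.Functor.map_id, ← CategoryTheory.Functor.map_id]; rfl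
          map_comp f g := by
            rw [← CategoryTheory.Functor.map_comp, ← CategoryTheory.Functor.map_comp, prod_comp,
              Category.id_comp] }
      map f := .mk
        { app n := X.functor.map (incl.map (X := (_, n)) (Y := (_, n)) (f, 𝟙 n))
          naturality n n' g := by
            simp [← CategoryTheory.Functor.map_comp] }
      map_id i := by
        apply DayFunctor.hom_ext
        ext n
        exact (congrArg _ (CategoryTheory.Functor.map_id incl _)).trans
          (CategoryTheory.Functor.map_id _ _)
      map_comp f g := by
        apply DayFunctor.hom_ext
        ext n
        refine Eq.trans (congrArg X.functor.map ?_) (CategoryTheory.Functor.map_comp _ _ _)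
        rw [← CategoryTheory.Functor.map_comp, prod_comp, Category.comp_id] }
  map φ := .mk
    { app i := .mk { app n := φ.natTrans.app (incl.obj (i, n)) } }

variable {C}

/-- The object `X_{i,n}` of a symmetric sequence of symmetric sequences. -/
abbrev lev (X : DayFunctor Sym (DayFunctor Sym C)) (i n : ℕ) : C :=
  (X.functor.obj ⟨i⟩).functor.obj ⟨n⟩

/-- The component `X_{i,n} ⟶ Y_{i,n}` of a morphism. -/
abbrev levMap {X Y : DayFunctor Sym (DayFunctor Sym C)} (f : X ⟶ Y) (i n : ℕ) :
    lev X i n ⟶ lev Y i n :=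
  (f.natTrans.app ⟨i⟩).natTrans.app ⟨n⟩

/-- The universal map `X_{i,n} ⊗ Y_{k,l} ⟶ (X ⊗ Y)_{i+k,n+l}`. -/
def levTensor (X Y : DayFunctor Sym (DayFunctor Sym C)) (i n k l : ℕ) :
    lev X i n ⊗ lev Y k l ⟶ lev (X ⊗ Y) (i + k) (n + l) :=
  dη (X.functor.obj ⟨i⟩) (Y.functor.obj ⟨k⟩) ⟨n⟩ ⟨l⟩ ≫
    (dη X Y ⟨i⟩ ⟨k⟩).natTrans.app (⟨n⟩ ⊗ ⟨l⟩)

/-- The bonding map `X_i ⊗ T ⟶ X_{i+1}` of a symmetric `T`-spectrum, the part of the action of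
`Sym(T)` that belongs to `T` in degree `1`. -/
def bond (X : Spectra C) (i : ℕ) :
    X.X.functor.obj ⟨i⟩ ⊗ sphereT C ⟶ X.X.functor.obj ⟨i + 1⟩ :=
  X.X.functor.obj ⟨i⟩ ◁ (λ_ (sphereT C)).inv ≫ dη X.X (symPow (sphereT C)) ⟨i⟩ ⟨1⟩ ≫
    ((β_ X.X (symPow (sphereT C))).hom ≫ act X).natTrans.app (⟨i⟩ ⊗ ⟨1⟩)

/-- The map `X_{i,n} ⟶ X_{i+1,n+1}` that corresponds to the bonding map
`X_i ⊗ T ⟶ X_{i+1}`. -/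
def bondMap (X : Spectra C) (i n : ℕ) : lev X.X i n ⟶ lev X.X (i + 1) (n + 1) :=
  (ρ_ (lev X.X i n)).inv ≫ dη (X.X.functor.obj ⟨i⟩) (sphereT C) ⟨n⟩ ⟨1⟩ ≫
    (bond X i).natTrans.app (⟨n⟩ ⊗ ⟨1⟩)

end

end JSpectra

end

open JSpectra

/-!
A `Sym(T)`-module in `(C^Σ)^Σ` is described by generators. Degree `(p, p)` of `Sym(T)` contains a
fundamental element, the unit of `T^{⊗ p}` in degree `p` (`gen`, `bgen`). It is invariant under the
diagonal action of `Σ_p`, because a permutation of the factors of `T^{⊗ p}` moves the degree in the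
opposite way (`gen_permMap`), and the fundamental elements are multiplicative (`gen_cat`). Since `T`
is initial outside degree `1`, they generate `Sym(T)` freely, subject to the invariance alone: a
morphism `Sym(T) ⊗ M ⟶ N` amounts to natural maps `M(x) ⟶ N(p + x)` that are invariant under `Σ_p`
(`opr_ext`, `exists_opr`). So a spectrum is an object of `(C^Σ)^Σ` with operations
`M(x) ⟶ M(p + x)` (`opn`) that are natural, invariant and multiplicative (`exists_spectrum`), and a
morphism of spectra is one that commutes with the operations (`exists_hom`).

The category `J` has the same presentation over `Σ × Σ`. Every morphism is a standard morphism
`std p x : x ⟶ p + x`, which adds `p` points on both sides with the identity as bijection, followed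
by a pair of bijections, and this factorization is unique up to a permutation of the `p` points
(`exists_std`, `std_unique`). The standard morphisms are natural, invariant and multiplicative. Hence
functors `J ⥤ C` are the same as spectra: `toSpectra` restricts along `Σ × Σ ⥤ J` and lets the
fundamental elements act through the standard morphisms, and it is an equivalence.

For the tensor product, a map out of `j^* X ⊗ j^* Y` into `j^* Z` that is linear in both variables
over `Sym(T)` is a pairing `X(x) ⊗ Y(y) ⟶ Z(x ⊗ y)` that is natural for bijections and for standard
morphisms, thus for all of `J` (`pairing_natural_left`, `exists_of_bilinear`). The relative tensor
product represents the former and the Day convolution over `J` the latter, which makes the comparison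
map `specμ` an isomorphism. It is defined by the universal maps of the Day convolution, so that the
coherence axioms reduce to those of the universal maps, and condition 2 holds by construction. The
units are compared in the same way (`specε`). Condition 1 holds because the bonding map is the
operation of the fundamental element of degree `1`, up to the shuffle that moves the new point from
the front to the back (`bondMap_eq`).

Objects of `(C^Σ)^Σ` are handled as functors of two variables (`bi`), with universal maps `bη` of the
iterated Day convolution.
-/

noncomputable section

namespace JSpectra

open LawfulDayConvolutionMonoidalCategoryStruct
open scoped MonoidalCategory.ExternalProduct
open scoped DayConvolution

/-! ### Day convolution -/

lemma comp_comp_eq {V : Type u} [Category.{v} V] {A B B' C : V} {f : A ⟶ B} {g : B ⟶ B'}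
    {k : A ⟶ B'} (e : f ≫ g = k) (t : B' ⟶ C) : f ≫ g ≫ t = k ≫ t := by
  rw [← e, Category.assoc]

section DayLevel

variable {K : Type} [Category.{0} K] [MonoidalCategory K] [SymmetricCategory K]
  {V : Type u} [Category.{v} V] [MonoidalCategory V] [SymmetricCategory V]
  [HasColimitsOfSize.{0, 0} V] [∀ v : V, PreservesColimitsOfSize.{0, 0} (tensorLeft v)]

lemma dη_natural (F G : DayFunctor K V) {x x' y y' : K} (f : x ⟶ x') (g : y ⟶ y') :
    (F.functor.map f ⊗ₘ G.functor.map g) ≫ dη F G x' y' =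
      dη F G x y ≫ (F ⊗ G).functor.map (f ⊗ₘ g) := by
  have h := (dayη F G).naturality (X := (x, y)) (Y := (x', y')) (f, g)
  rw [MonoidalCategory.tensorHom_def]
  exact h

lemma dη_natural_left (F G : DayFunctor K V) {x x' : K} (f : x ⟶ x') (y : K) :
    F.functor.map f ▷ G.functor.obj y ≫ dη F G x' y = dη F G x y ≫ (F ⊗ G).functor.map (f ▷ y) := by
  have h := dη_natural F G f (𝟙 y)
  rwa [CategoryTheory.Functor.map_id, tensorHom_id, tensorHom_id] at h

lemma dη_natural_right (F G : DayFunctor K V) (x : K) {y y' : K} (g : y ⟶ y') :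
    F.functor.obj x ◁ G.functor.map g ≫ dη F G x y' = dη F G x y ≫ (F ⊗ G).functor.map (x ◁ g) := by
  have h := dη_natural F G (𝟙 x) g
  rwa [CategoryTheory.Functor.map_id, id_tensorHom, id_tensorHom] at h

/-- A map out of `F ⊗ G` from a family `F(x) ⊗ G(y) ⟶ H(x ⊗ y)` that is natural in both
variables. -/
def dayDesc {F G H : DayFunctor K V}
    (m : ∀ x y, F.functor.obj x ⊗ G.functor.obj y ⟶ H.functor.obj (x ⊗ y))
    (h₁ : ∀ {x x' : K} (f : x ⟶ x') (y : K),
      F.functor.map f ▷ G.functor.obj y ≫ m x' y = m x y ≫ H.functor.map (f ▷ y))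
    (h₂ : ∀ (x : K) {y y' : K} (g : y ⟶ y'),
      F.functor.obj x ◁ G.functor.map g ≫ m x y' = m x y ≫ H.functor.map (x ◁ g)) : F ⊗ G ⟶ H :=
  DayFunctor.tensorDesc
    { app x := m x.1 x.2
      naturality x y f := by
        have h : (F.functor.map f.1 ▷ G.functor.obj x.2 ≫ F.functor.obj y.1 ◁ G.functor.map f.2) ≫
            m y.1 y.2 = m x.1 x.2 ≫ H.functor.map (f.1 ⊗ₘ f.2) := by
          rw [Category.assoc, h₂, reassoc_of% h₁, ← CategoryTheory.Functor.map_comp,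
            ← MonoidalCategory.tensorHom_def]
        exact h }

lemma dη_dayDesc {F G H : DayFunctor K V}
    (m : ∀ x y, F.functor.obj x ⊗ G.functor.obj y ⟶ H.functor.obj (x ⊗ y)) (h₁ h₂) (x y : K) :
    dη F G x y ≫ (dayDesc (F := F) (G := G) (H := H) m h₁ h₂).natTrans.app (x ⊗ y) = m x y :=
  dη_tensorDesc _ x y

lemma dν_rightUnitor (F : DayFunctor K V) (y : K) :
    F.functor.obj y ◁ dayν K V ≫ dη F (𝟙_ _) y (𝟙_ K) ≫ (ρ_ F).hom.natTrans.app (y ⊗ 𝟙_ K) =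
    (ρ_ (F.functor.obj y)).hom ≫ F.functor.map (ρ_ y).inv := ν_rightUnitor F y

/-- Tensored with an object `W`, the value of `F ⊗ G` at `z` is still jointly covered by the
universal maps, because it is a colimit and `- ⊗ W` preserves it. -/
lemma day_obj_tensor_hom_ext (F G : DayFunctor K V) (z : K) (W : V) {Z : V}
    {f g : (F ⊗ G).functor.obj z ⊗ W ⟶ Z}
    (h : ∀ x y (s : x ⊗ y ⟶ z), (dη F G x y ≫ (F ⊗ G).functor.map s) ▷ W ≫ f =
      (dη F G x y ≫ (F ⊗ G).functor.map s) ▷ W ≫ g) : f = g := by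
  have l := isColimitOfPreserves (tensorRight W)
    (isPointwiseLeftKanExtensionConvolutionExtensionUnit (C := K) (V := V) F G z)
  apply l.hom_ext
  intro j
  exact h _ _ j.hom

lemma unit_obj_tensor_hom_ext (z : K) (W : V) {Z : V}
    {f g : (𝟙_ (DayFunctor K V)).functor.obj z ⊗ W ⟶ Z}
    (h : ∀ (s : 𝟙_ K ⟶ z), (dayν K V ≫ (𝟙_ (DayFunctor K V)).functor.map s) ▷ W ≫ f =
      (dayν K V ≫ (𝟙_ (DayFunctor K V)).functor.map s) ▷ W ≫ g) : f = g := by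
  have l := isColimitOfPreserves (tensorRight W)
    (isPointwiseLeftKanExtensionUnitUnit K V (DayFunctor K V) z)
  apply l.hom_ext
  intro j
  exact h j.hom

end DayLevel

/-! ### Iterated Day convolution -/

section Bi

variable {K L : Type} [Category.{0} K] [MonoidalCategory K] [SymmetricCategory K]
  [Category.{0} L] [MonoidalCategory L] [SymmetricCategory L]
  {V : Type u} [Category.{v} V] [MonoidalCategory V] [SymmetricCategory V]
  [HasColimitsOfSize.{0, 0} V] [∀ v : V, PreservesColimitsOfSize.{0, 0} (tensorLeft v)]

/-- The functor of two variables that underlies an object of `(V^L)^K`. -/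
@[simps]
def bi (F : DayFunctor K (DayFunctor L V)) : K × L ⥤ V where
  obj x := (F.functor.obj x.1).functor.obj x.2
  map {x y} f := (F.functor.map f.1).natTrans.app x.2 ≫ (F.functor.obj y.1).functor.map f.2
  map_id x := by
    rw [prod_id, CategoryTheory.Functor.map_id, CategoryTheory.Functor.map_id, day_id_app,
      Category.comp_id]
  map_comp f g := by
    rw [prod_comp, CategoryTheory.Functor.map_comp, CategoryTheory.Functor.map_comp, day_comp_app]
    simp

lemma bi_map_left (F : DayFunctor K (DayFunctor L V)) {x y : K} (f : x ⟶ y) (a : L) :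
    (bi F).map (X := (x, a)) (Y := (y, a)) (f, 𝟙 a) = (F.functor.map f).natTrans.app a :=
  (congrArg (_ ≫ ·) (CategoryTheory.Functor.map_id _ _)).trans (Category.comp_id _)

lemma bi_map_right (F : DayFunctor K (DayFunctor L V)) (x : K) {a b : L} (f : a ⟶ b) :
    (bi F).map (X := (x, a)) (Y := (x, b)) (𝟙 x, f) = (F.functor.obj x).functor.map f :=
  (congrArg (· ≫ _) (congrArg (fun t => t.natTrans.app a)
    (CategoryTheory.Functor.map_id F.functor x))).trans (Category.id_comp _)

/-- The transformation of functors of two variables that underlies a morphism of `(V^L)^K`. -/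
@[simps]
def biMap {F G : DayFunctor K (DayFunctor L V)} (φ : F ⟶ G) : bi F ⟶ bi G where
  app x := (φ.natTrans.app x.1).natTrans.app x.2
  naturality x y f := by
    have h := congrArg (fun t => t.natTrans.app x.2) (φ.natTrans.naturality f.1)
    simp only [day_comp_app] at h
    change ((F.functor.map f.1).natTrans.app x.2 ≫ (F.functor.obj y.1).functor.map f.2) ≫
        (φ.natTrans.app y.1).natTrans.app y.2 = (φ.natTrans.app x.1).natTrans.app x.2 ≫
          (G.functor.map f.1).natTrans.app x.2 ≫ (G.functor.obj y.1).functor.map f.2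
    rw [Category.assoc, (φ.natTrans.app y.1).natTrans.naturality, reassoc_of% h]

lemma biMap_comp_app {F G H : DayFunctor K (DayFunctor L V)} (φ : F ⟶ G) (ψ : G ⟶ H) (x : K × L) :
    (biMap (φ ≫ ψ)).app x = (biMap φ).app x ≫ (biMap ψ).app x := rfl

lemma biMap_id_app (F : DayFunctor K (DayFunctor L V)) (x : K × L) :
    (biMap (𝟙 F)).app x = 𝟙 ((bi F).obj x) := rfl

lemma biMap_injective {F G : DayFunctor K (DayFunctor L V)} {φ ψ : F ⟶ G}
    (h : ∀ x, (biMap φ).app x = (biMap ψ).app x) : φ = ψ := by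
  apply DayFunctor.hom_ext
  apply NatTrans.ext
  funext x
  apply DayFunctor.hom_ext
  apply NatTrans.ext
  funext a
  exact h (x, a)

/-- The morphism of `(V^L)^K` given by a transformation of functors of two variables. -/
def ofBi {F G : DayFunctor K (DayFunctor L V)} (t : bi F ⟶ bi G) : F ⟶ G := .mk
  { app x := .mk
      { app a := t.app (x, a)
        naturality a b f := by
          have h := t.naturality (X := (x, a)) (Y := (x, b)) (𝟙 x, f)
          rwa [bi_map_right, bi_map_right] at h }
    naturality x y f := by
      apply DayFunctor.hom_ext
      ext a
      have h := t.naturality (X := (x, a)) (Y := (y, a)) (f, 𝟙 a)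
      rwa [bi_map_left, bi_map_left] at h }

/-- The universal map `F(x) ⊗ G(y) ⟶ (F ⊗ G)(x ⊗ y)` of the iterated Day convolution. -/
def bη (F G : DayFunctor K (DayFunctor L V)) (x y : K × L) :
    (bi F).obj x ⊗ (bi G).obj y ⟶ (bi (F ⊗ G)).obj (x ⊗ y) :=
  dη (F.functor.obj x.1) (G.functor.obj y.1) x.2 y.2 ≫
    (dη F G x.1 y.1).natTrans.app (x.2 ⊗ y.2)

variable (K L V) in
/-- The universal map `𝟙 ⟶ 𝟙(𝟙, 𝟙)` of the unit of the iterated Day convolution. -/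
def bν : 𝟙_ V ⟶ (bi (𝟙_ (DayFunctor K (DayFunctor L V)))).obj (𝟙_ (K × L)) :=
  dayν L V ≫ (dayν K (DayFunctor L V)).natTrans.app (𝟙_ L)

lemma bη_natural_left (F G : DayFunctor K (DayFunctor L V)) {x x' : K × L} (f : x ⟶ x')
    (y : K × L) :
    (bi F).map f ▷ (bi G).obj y ≫ bη F G x' y = bη F G x y ≫ (bi (F ⊗ G)).map (f ▷ y) := by
  obtain ⟨x, a⟩ := x
  obtain ⟨x', a'⟩ := x'
  obtain ⟨y, b⟩ := y
  obtain ⟨f, g⟩ := f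
  have h₁ := congrArg (fun t => t.natTrans.app (a ⊗ b)) (dη_natural_left F G f y)
  simp only [day_comp_app] at h₁
  have h₂ := dη_whiskerRight (F.functor.map f) (G.functor.obj y) a b
  have h₃ := dη_natural_left (F.functor.obj x') (G.functor.obj y) g b
  have h₄ := (dη F G x' y).natTrans.naturality (g ▷ b)
  change ((F.functor.map f).natTrans.app a ≫ (F.functor.obj x').functor.map g) ▷
      (G.functor.obj y).functor.obj b ≫ dη (F.functor.obj x') (G.functor.obj y) a' b ≫
      (dη F G x' y).natTrans.app (a' ⊗ b) = (dη (F.functor.obj x) (G.functor.obj y) a b ≫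
      (dη F G x y).natTrans.app (a ⊗ b)) ≫ ((F ⊗ G).functor.map (f ▷ y)).natTrans.app (a ⊗ b) ≫
        ((F ⊗ G).functor.obj (x' ⊗ y)).functor.map (g ▷ b)
  rw [comp_whiskerRight, Category.assoc, reassoc_of% h₃, h₄, ← reassoc_of% h₂, Category.assoc,
    ← reassoc_of% h₁]

lemma bη_natural_right (F G : DayFunctor K (DayFunctor L V)) (x : K × L) {y y' : K × L}
    (f : y ⟶ y') :
    (bi F).obj x ◁ (bi G).map f ≫ bη F G x y' = bη F G x y ≫ (bi (F ⊗ G)).map (x ◁ f) := by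
  obtain ⟨x, a⟩ := x
  obtain ⟨y, b⟩ := y
  obtain ⟨y', b'⟩ := y'
  obtain ⟨f, g⟩ := f
  have h₁ := congrArg (fun t => t.natTrans.app (a ⊗ b)) (dη_natural_right F G x f)
  simp only [day_comp_app] at h₁
  have h₂ := dη_whiskerLeft (F.functor.obj x) (G.functor.map f) a b
  have h₃ := dη_natural_right (F.functor.obj x) (G.functor.obj y') a g
  have h₄ := (dη F G x y').natTrans.naturality (a ◁ g)
  change (F.functor.obj x).functor.obj a ◁ ((G.functor.map f).natTrans.app b ≫
      (G.functor.obj y').functor.map g) ≫ dη (F.functor.obj x) (G.functor.obj y') a b' ≫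
      (dη F G x y').natTrans.app (a ⊗ b') = (dη (F.functor.obj x) (G.functor.obj y) a b ≫
      (dη F G x y).natTrans.app (a ⊗ b)) ≫ ((F ⊗ G).functor.map (x ◁ f)).natTrans.app (a ⊗ b) ≫
        ((F ⊗ G).functor.obj (x ⊗ y')).functor.map (a ◁ g)
  rw [whiskerLeft_comp, Category.assoc, reassoc_of% h₃, h₄, ← reassoc_of% h₂, Category.assoc,
    ← reassoc_of% h₁]

lemma bη_whiskerLeft (F : DayFunctor K (DayFunctor L V)) {G H : DayFunctor K (DayFunctor L V)}
    (g : G ⟶ H) (x y : K × L) :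
    bη F G x y ≫ (biMap (F ◁ g)).app (x ⊗ y) = (bi F).obj x ◁ (biMap g).app y ≫ bη F H x y := by
  have h₁ := congrArg (fun t => t.natTrans.app (x.2 ⊗ y.2)) (dη_whiskerLeft F g x.1 y.1)
  simp only [day_comp_app] at h₁
  have h₂ := dη_whiskerLeft (F.functor.obj x.1) (g.natTrans.app y.1) x.2 y.2
  refine (Category.assoc _ _ _).trans ((congrArg (_ ≫ ·) h₁).trans ?_)
  exact (comp_comp_eq h₂ _).trans (Category.assoc _ _ _)

lemma bη_whiskerRight {G H : DayFunctor K (DayFunctor L V)} (g : G ⟶ H)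
    (F : DayFunctor K (DayFunctor L V)) (x y : K × L) :
    bη G F x y ≫ (biMap (g ▷ F)).app (x ⊗ y) = (biMap g).app x ▷ (bi F).obj y ≫ bη H F x y := by
  have h₁ := congrArg (fun t => t.natTrans.app (x.2 ⊗ y.2)) (dη_whiskerRight g F x.1 y.1)
  simp only [day_comp_app] at h₁
  have h₂ := dη_whiskerRight (g.natTrans.app x.1) (F.functor.obj y.1) x.2 y.2
  refine (Category.assoc _ _ _).trans ((congrArg (_ ≫ ·) h₁).trans ?_)
  exact (comp_comp_eq h₂ _).trans (Category.assoc _ _ _)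

lemma bη_braiding (F G : DayFunctor K (DayFunctor L V)) (x y : K × L) :
    bη F G x y ≫ (biMap (β_ F G).hom).app (x ⊗ y) =
      (β_ ((bi F).obj x) ((bi G).obj y)).hom ≫ bη G F y x ≫
        (bi (G ⊗ F)).map (X := y ⊗ x) (Y := x ⊗ y) ((β_ y.1 x.1).hom, (β_ y.2 x.2).hom) := by
  have h₁ := congrArg (fun t => t.natTrans.app (x.2 ⊗ y.2)) (dη_braiding F G x.1 y.1)
  simp only [day_comp_app] at h₁
  have h₂ := dη_braiding (F.functor.obj x.1) (G.functor.obj y.1) x.2 y.2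
  have h₃ := (dη G F y.1 x.1).natTrans.naturality (β_ y.2 x.2).hom
  have h₄ := ((G ⊗ F).functor.map (β_ y.1 x.1).hom).natTrans.naturality (β_ y.2 x.2).hom
  refine (Category.assoc _ _ _).trans ((congrArg (_ ≫ ·) h₁).trans ?_)
  refine (comp_comp_eq h₂ _).trans ((Category.assoc _ _ _).trans (congrArg (_ ≫ ·) ?_))
  refine Eq.trans ?_ (Category.assoc _ _ _).symm
  rw [Category.assoc, reassoc_of% h₃, h₄]
  rfl

lemma bη_associator (F G H : DayFunctor K (DayFunctor L V)) (x y z : K × L) :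
    bη F G x y ▷ (bi H).obj z ≫ bη (F ⊗ G) H (x ⊗ y) z ≫
      (biMap (α_ F G H).hom).app ((x ⊗ y) ⊗ z) =
    (α_ _ _ _).hom ≫ (bi F).obj x ◁ bη G H y z ≫ bη F (G ⊗ H) x (y ⊗ z) ≫
      (bi (F ⊗ G ⊗ H)).map (α_ x y z).inv := by
  have h₁ := congrArg (fun t => t.natTrans.app ((x.2 ⊗ y.2) ⊗ z.2)) (dη_associator F G H x.1 y.1 z.1)
  simp only [day_comp_app] at h₁
  have h₂ := dη_whiskerRight (dη F G x.1 y.1) (H.functor.obj z.1) (x.2 ⊗ y.2) z.2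
  have h₃ := dη_associator (F.functor.obj x.1) (G.functor.obj y.1) (H.functor.obj z.1) x.2 y.2 z.2
  have h₄ := dη_whiskerLeft (F.functor.obj x.1) (dη G H y.1 z.1) x.2 (y.2 ⊗ z.2)
  have h₅ := (F.functor.obj x.1 ◁ dη G H y.1 z.1).natTrans.naturality (α_ x.2 y.2 z.2).inv
  have h₆ := (dη F (G ⊗ H) x.1 (y.1 ⊗ z.1)).natTrans.naturality (α_ x.2 y.2 z.2).inv
  have h₇ := ((F ⊗ G ⊗ H).functor.map (α_ x.1 y.1 z.1).inv).natTrans.naturality (α_ x.2 y.2 z.2).inv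
  change (dη (F.functor.obj x.1) (G.functor.obj y.1) x.2 y.2 ≫
      (dη F G x.1 y.1).natTrans.app (x.2 ⊗ y.2)) ▷ (H.functor.obj z.1).functor.obj z.2 ≫
      (dη ((F ⊗ G).functor.obj (x.1 ⊗ y.1)) (H.functor.obj z.1) (x.2 ⊗ y.2) z.2 ≫
        (dη (F ⊗ G) H (x.1 ⊗ y.1) z.1).natTrans.app ((x.2 ⊗ y.2) ⊗ z.2)) ≫
      ((α_ F G H).hom.natTrans.app ((x.1 ⊗ y.1) ⊗ z.1)).natTrans.app ((x.2 ⊗ y.2) ⊗ z.2) =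
    (α_ _ _ _).hom ≫ (F.functor.obj x.1).functor.obj x.2 ◁
      (dη (G.functor.obj y.1) (H.functor.obj z.1) y.2 z.2 ≫
        (dη G H y.1 z.1).natTrans.app (y.2 ⊗ z.2)) ≫
      (dη (F.functor.obj x.1) ((G ⊗ H).functor.obj (y.1 ⊗ z.1)) x.2 (y.2 ⊗ z.2) ≫
        (dη F (G ⊗ H) x.1 (y.1 ⊗ z.1)).natTrans.app (x.2 ⊗ y.2 ⊗ z.2)) ≫
      ((F ⊗ G ⊗ H).functor.map (α_ x.1 y.1 z.1).inv).natTrans.app (x.2 ⊗ y.2 ⊗ z.2) ≫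
        ((F ⊗ G ⊗ H).functor.obj ((x.1 ⊗ y.1) ⊗ z.1)).functor.map (α_ x.2 y.2 z.2).inv
  simp only [comp_whiskerRight, whiskerLeft_comp, Category.assoc]
  rw [← reassoc_of% h₂, h₁, reassoc_of% h₃, ← reassoc_of% h₄, ← h₇, ← reassoc_of% h₆,
    ← reassoc_of% h₅]

lemma bν_leftUnitor (F : DayFunctor K (DayFunctor L V)) (y : K × L) :
    bν K L V ▷ (bi F).obj y ≫ bη (𝟙_ _) F (𝟙_ _) y ≫ (biMap (λ_ F).hom).app (𝟙_ (K × L) ⊗ y) =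
      (λ_ ((bi F).obj y)).hom ≫ (bi F).map (X := y) (Y := 𝟙_ (K × L) ⊗ y)
        ((λ_ y.1).inv, (λ_ y.2).inv) := by
  have h₁ := congrArg (fun t => t.natTrans.app (𝟙_ L ⊗ y.2)) (dν_leftUnitor F y.1)
  simp only [day_comp_app] at h₁
  have h₂ := dη_whiskerRight (dayν K (DayFunctor L V)) (F.functor.obj y.1) (𝟙_ L) y.2
  have h₃ := dν_leftUnitor (F.functor.obj y.1) y.2
  have h₄ := (F.functor.map (λ_ y.1).inv).natTrans.naturality (λ_ y.2).inv
  change (dayν L V ≫ (dayν K (DayFunctor L V)).natTrans.app (𝟙_ L)) ▷ _ ≫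
    (dη ((𝟙_ (DayFunctor K (DayFunctor L V))).functor.obj (𝟙_ K)) (F.functor.obj y.1) (𝟙_ L) y.2 ≫
      (dη (𝟙_ _) F (𝟙_ K) y.1).natTrans.app (𝟙_ L ⊗ y.2)) ≫
      ((λ_ F).hom.natTrans.app (𝟙_ K ⊗ y.1)).natTrans.app (𝟙_ L ⊗ y.2) =
    (λ_ _).hom ≫ (F.functor.map (λ_ y.1).inv).natTrans.app y.2 ≫
      (F.functor.obj (𝟙_ K ⊗ y.1)).functor.map (λ_ y.2).inv
  rw [comp_whiskerRight, Category.assoc, Category.assoc, ← reassoc_of% h₂, h₁, reassoc_of% h₃, h₄]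

lemma bi_hom_ext {F G H : DayFunctor K (DayFunctor L V)} {f g : F ⊗ G ⟶ H}
    (h : ∀ x y, bη F G x y ≫ (biMap f).app (x ⊗ y) = bη F G x y ≫ (biMap g).app (x ⊗ y)) :
    f = g := by
  apply day_hom_ext
  intro x y
  apply day_hom_ext
  intro a b
  exact (Category.assoc _ _ _).symm.trans ((h (x, a) (y, b)).trans (Category.assoc _ _ _))

lemma bi_hom_ext₃ {F G H P : DayFunctor K (DayFunctor L V)} {f g : (F ⊗ G) ⊗ H ⟶ P}
    (h : ∀ x y z, bη F G x y ▷ (bi H).obj z ≫ bη (F ⊗ G) H (x ⊗ y) z ≫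
        (biMap f).app ((x ⊗ y) ⊗ z) =
      bη F G x y ▷ (bi H).obj z ≫ bη (F ⊗ G) H (x ⊗ y) z ≫ (biMap g).app ((x ⊗ y) ⊗ z)) :
    f = g := by
  apply day_hom_ext₃
  intro x y z
  apply day_hom_ext₃
  intro a b c
  have := h (x, a) (y, b) (z, c)
  have h₂ := dη_whiskerRight (dη F G x y) (H.functor.obj z) (a ⊗ b) c
  have e (f : (F ⊗ G) ⊗ H ⟶ P) : bη F G (x, a) (y, b) ▷ (bi H).obj (z, c) ≫
      bη (F ⊗ G) H ((x, a) ⊗ (y, b)) (z, c) ≫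
        (biMap f).app (((x, a) ⊗ (y, b)) ⊗ (z, c)) =
      dη (F.functor.obj x) (G.functor.obj y) a b ▷ (H.functor.obj z).functor.obj c ≫
        dη (F.functor.obj x ⊗ G.functor.obj y) (H.functor.obj z) (a ⊗ b) c ≫
        NatTrans.app (DayFunctor.Hom.natTrans (dη F G x y ▷ H.functor.obj z ≫
          dη (F ⊗ G) H (x ⊗ y) z ≫ f.natTrans.app ((x ⊗ y) ⊗ z))) ((a ⊗ b) ⊗ c) := by
    rw [day_comp_app, day_comp_app, reassoc_of% h₂]
    change (dη (F.functor.obj x) (G.functor.obj y) a b ≫ (dη F G x y).natTrans.app (a ⊗ b)) ▷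
        (H.functor.obj z).functor.obj c ≫
        (dη ((F ⊗ G).functor.obj (x ⊗ y)) (H.functor.obj z) (a ⊗ b) c ≫
          (dη (F ⊗ G) H (x ⊗ y) z).natTrans.app ((a ⊗ b) ⊗ c)) ≫
        (f.natTrans.app ((x ⊗ y) ⊗ z)).natTrans.app ((a ⊗ b) ⊗ c) = _
    rw [comp_whiskerRight, Category.assoc, Category.assoc]
  rwa [e, e] at this

lemma bi_unit_hom_ext {F : DayFunctor K (DayFunctor L V)} {f g : 𝟙_ _ ⟶ F}
    (h : bν K L V ≫ (biMap f).app (𝟙_ _) = bν K L V ≫ (biMap g).app (𝟙_ _)) : f = g := by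
  apply DayFunctor.unit_hom_ext
  apply DayFunctor.unit_hom_ext
  exact (Category.assoc _ _ _).symm.trans (h.trans (Category.assoc _ _ _))

/-- A map out of the unit from a map `𝟙 ⟶ F(𝟙, 𝟙)`. -/
def biUnitDesc {F : DayFunctor K (DayFunctor L V)} (u : 𝟙_ V ⟶ (bi F).obj (𝟙_ (K × L))) :
    𝟙_ _ ⟶ F :=
  DayFunctor.unitDesc (DayFunctor.unitDesc u)

lemma bν_biUnitDesc {F : DayFunctor K (DayFunctor L V)}
    (u : 𝟙_ V ⟶ (bi F).obj (𝟙_ (K × L))) :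
    bν K L V ≫ (biMap (biUnitDesc (F := F) u)).app (𝟙_ (K × L)) = u := by
  have h₁ := congrArg (fun t => t.natTrans.app (𝟙_ L))
    (dν_unitDesc (K := K) (F := F) (DayFunctor.unitDesc u))
  simp only [day_comp_app] at h₁
  have h₂ := dν_unitDesc (F := F.functor.obj (𝟙_ K)) u
  exact (Category.assoc _ _ _).trans ((congrArg (_ ≫ ·) h₁).trans h₂)

section Desc

variable {F G H : DayFunctor K (DayFunctor L V)}
    (m : ∀ x y, (bi F).obj x ⊗ (bi G).obj y ⟶ (bi H).obj (x ⊗ y))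
    (h₁ : ∀ {x x' : K × L} (f : x ⟶ x') (y : K × L),
      (bi F).map f ▷ (bi G).obj y ≫ m x' y = m x y ≫ (bi H).map (f ▷ y))
    (h₂ : ∀ (x : K × L) {y y' : K × L} (g : y ⟶ y'),
      (bi F).obj x ◁ (bi G).map g ≫ m x y' = m x y ≫ (bi H).map (x ◁ g))

/-- The value at `(x, y)` of the map given by a family natural in both variables. -/
def biDescAux (x y : K) : F.functor.obj x ⊗ G.functor.obj y ⟶ H.functor.obj (x ⊗ y) :=
  dayDesc (fun a b => m (x, a) (y, b))
    (fun {a a'} f b => by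
      have h := h₁ (x := (x, a)) (x' := (x, a')) (𝟙 x, f) (y, b)
      rw [bi_map_right] at h
      refine h.trans (congrArg (_ ≫ ·) ?_)
      refine Eq.trans ?_ (bi_map_right H (x ⊗ y) (f ▷ b))
      rw [← id_whiskerRight]
      rfl)
    (fun a {b b'} f => by
      have h := h₂ (x, a) (y := (y, b)) (y' := (y, b')) (𝟙 y, f)
      rw [bi_map_right] at h
      refine h.trans (congrArg (_ ≫ ·) ?_)
      refine Eq.trans ?_ (bi_map_right H (x ⊗ y) (a ◁ f))
      rw [← whiskerLeft_id]
      rfl)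

lemma dη_biDescAux (x y : K) (a b : L) :
    dη (F.functor.obj x) (G.functor.obj y) a b ≫
      (biDescAux m h₁ h₂ x y).natTrans.app (a ⊗ b) = m (x, a) (y, b) :=
  dη_dayDesc _ _ _ a b

/-- A map out of `F ⊗ G` from a family `F(x) ⊗ G(y) ⟶ H(x ⊗ y)` that is natural in both
variables. -/
def biDesc : F ⊗ G ⟶ H :=
  dayDesc (biDescAux m h₁ h₂)
    (fun {x x'} f y => by
      apply day_hom_ext
      intro a b
      rw [day_comp_app, day_comp_app, reassoc_of% dη_whiskerRight, dη_biDescAux]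
      refine Eq.trans ?_ (comp_comp_eq (dη_biDescAux m h₁ h₂ x y a b) _).symm
      have h := h₁ (x := (x, a)) (x' := (x', a)) (f, 𝟙 a) (y, b)
      rw [bi_map_left] at h
      refine h.trans (congrArg (_ ≫ ·) ?_)
      refine Eq.trans ?_ (bi_map_left H (f ▷ y) (a ⊗ b))
      rw [← id_whiskerRight]
      rfl)
    (fun x {y y'} f => by
      apply day_hom_ext
      intro a b
      rw [day_comp_app, day_comp_app, reassoc_of% dη_whiskerLeft, dη_biDescAux]
      refine Eq.trans ?_ (comp_comp_eq (dη_biDescAux m h₁ h₂ x y a b) _).symm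
      have h := h₂ (x, a) (y := (y, b)) (y' := (y', b)) (f, 𝟙 b)
      rw [bi_map_left] at h
      refine h.trans (congrArg (_ ≫ ·) ?_)
      refine Eq.trans ?_ (bi_map_left H (x ◁ f) (a ⊗ b))
      rw [← whiskerLeft_id]
      rfl)

lemma bη_biDesc (x y : K × L) :
    bη F G x y ≫ (biMap (biDesc m h₁ h₂)).app (x ⊗ y) = m x y := by
  have e : dη F G x.1 y.1 ≫ (biDesc m h₁ h₂).natTrans.app (x.1 ⊗ y.1) =
      biDescAux m h₁ h₂ x.1 y.1 := dη_dayDesc _ _ _ x.1 y.1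
  have e' := congrArg (fun t => t.natTrans.app (x.2 ⊗ y.2)) e
  simp only [day_comp_app] at e'
  exact (Category.assoc _ _ _).trans ((congrArg (_ ≫ ·) e').trans
    (dη_biDescAux m h₁ h₂ x.1 y.1 x.2 y.2))

end Desc

end Bi

/-! ### Elements of Day convolutions -/

section Elements

variable {K : Type} [Category.{0} K] [MonoidalCategory K] [SymmetricCategory K]
  {V : Type u} [Category.{v} V] [MonoidalCategory V] [SymmetricCategory V]
  [HasColimitsOfSize.{0, 0} V] [∀ v : V, PreservesColimitsOfSize.{0, 0} (tensorLeft v)]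

/-- The product of two elements `𝟙 ⟶ F(x)` and `𝟙 ⟶ G(y)`, an element of `(F ⊗ G)(x ⊗ y)`. -/
def dmul {F G : DayFunctor K V} {x y : K} (a : 𝟙_ V ⟶ F.functor.obj x)
    (b : 𝟙_ V ⟶ G.functor.obj y) : 𝟙_ V ⟶ (F ⊗ G).functor.obj (x ⊗ y) :=
  (λ_ (𝟙_ V)).inv ≫ (a ⊗ₘ b) ≫ dη F G x y

lemma dmul_map {F G : DayFunctor K V} {x x' y y' : K} (a : 𝟙_ V ⟶ F.functor.obj x)
    (b : 𝟙_ V ⟶ G.functor.obj y) (f : x ⟶ x') (g : y ⟶ y') :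
    dmul a b ≫ (F ⊗ G).functor.map (f ⊗ₘ g) =
      dmul (a ≫ F.functor.map f) (b ≫ G.functor.map g) := by
  unfold dmul
  rw [← tensorHom_comp_tensorHom, Category.assoc, Category.assoc, Category.assoc, dη_natural]

lemma dmul_map_left {F G : DayFunctor K V} {x x' y : K} (a : 𝟙_ V ⟶ F.functor.obj x)
    (b : 𝟙_ V ⟶ G.functor.obj y) (f : x ⟶ x') :
    dmul a b ≫ (F ⊗ G).functor.map (f ▷ y) = dmul (a ≫ F.functor.map f) b := by
  rw [← tensorHom_id, dmul_map, CategoryTheory.Functor.map_id, Category.comp_id]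

lemma dmul_map_right {F G : DayFunctor K V} {x y y' : K} (a : 𝟙_ V ⟶ F.functor.obj x)
    (b : 𝟙_ V ⟶ G.functor.obj y) (g : y ⟶ y') :
    dmul a b ≫ (F ⊗ G).functor.map (x ◁ g) = dmul a (b ≫ G.functor.map g) := by
  rw [← id_tensorHom, dmul_map, CategoryTheory.Functor.map_id, Category.comp_id]

lemma dmul_whiskerRight {F F' : DayFunctor K V} (φ : F ⟶ F') (G : DayFunctor K V) {x y : K}
    (a : 𝟙_ V ⟶ F.functor.obj x) (b : 𝟙_ V ⟶ G.functor.obj y) :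
    dmul a b ≫ (φ ▷ G).natTrans.app (x ⊗ y) = dmul (a ≫ φ.natTrans.app x) b := by
  unfold dmul
  rw [Category.assoc, Category.assoc, dη_whiskerRight]
  simp [MonoidalCategory.tensorHom_def']

lemma dmul_whiskerLeft (F : DayFunctor K V) {G G' : DayFunctor K V} (φ : G ⟶ G') {x y : K}
    (a : 𝟙_ V ⟶ F.functor.obj x) (b : 𝟙_ V ⟶ G.functor.obj y) :
    dmul a b ≫ (F ◁ φ).natTrans.app (x ⊗ y) = dmul a (b ≫ φ.natTrans.app y) := by
  unfold dmul
  rw [Category.assoc, Category.assoc, dη_whiskerLeft]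
  simp [MonoidalCategory.tensorHom_def]

lemma dmul_braiding {F G : DayFunctor K V} {x y : K} (a : 𝟙_ V ⟶ F.functor.obj x)
    (b : 𝟙_ V ⟶ G.functor.obj y) :
    dmul a b ≫ (β_ F G).hom.natTrans.app (x ⊗ y) =
      dmul b a ≫ (G ⊗ F).functor.map (β_ y x).hom := by
  unfold dmul
  rw [Category.assoc, Category.assoc, dη_braiding, BraidedCategory.braiding_naturality_assoc,
    Category.assoc, Category.assoc]
  simp [unitors_inv_equal]

lemma dmul_associator {F G H : DayFunctor K V} {x y z : K} (a : 𝟙_ V ⟶ F.functor.obj x)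
    (b : 𝟙_ V ⟶ G.functor.obj y) (c : 𝟙_ V ⟶ H.functor.obj z) :
    dmul (dmul a b) c ≫ (α_ F G H).hom.natTrans.app ((x ⊗ y) ⊗ z) =
      dmul a (dmul b c) ≫ (F ⊗ G ⊗ H).functor.map (α_ x y z).inv := by
  have h := dη_associator F G H x y z
  unfold dmul
  have e₁ : ((λ_ (𝟙_ V)).inv ≫ (a ⊗ₘ b) ≫ dη F G x y) ⊗ₘ c =
      (λ_ (𝟙_ V)).inv ▷ 𝟙_ V ≫ ((a ⊗ₘ b) ⊗ₘ c) ≫ dη F G x y ▷ H.functor.obj z := by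
    simp only [← tensorHom_id, tensorHom_comp_tensorHom, Category.id_comp, Category.comp_id]
  have e₂ : a ⊗ₘ ((λ_ (𝟙_ V)).inv ≫ (b ⊗ₘ c) ≫ dη G H y z) =
      𝟙_ V ◁ (λ_ (𝟙_ V)).inv ≫ (a ⊗ₘ (b ⊗ₘ c)) ≫ F.functor.obj x ◁ dη G H y z := by
    simp only [← id_tensorHom, tensorHom_comp_tensorHom, Category.id_comp, Category.comp_id]
  rw [e₁, e₂]
  simp only [Category.assoc]
  rw [h, associator_naturality_assoc]
  have e₃ : (λ_ (𝟙_ V)).inv ≫ (λ_ (𝟙_ V)).inv ▷ 𝟙_ V ≫ (α_ (𝟙_ V) (𝟙_ V) (𝟙_ V)).hom =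
      (λ_ (𝟙_ V)).inv ≫ 𝟙_ V ◁ (λ_ (𝟙_ V)).inv := by
    monoidal
  rw [reassoc_of% e₃]

lemma dmul_leftUnitor {F : DayFunctor K V} {y : K} (a : 𝟙_ V ⟶ F.functor.obj y) :
    dmul (dayν K V) a ≫ (λ_ F).hom.natTrans.app (𝟙_ K ⊗ y) = a ≫ F.functor.map (λ_ y).inv := by
  have h := dν_leftUnitor F y
  unfold dmul
  rw [MonoidalCategory.tensorHom_def', Category.assoc, Category.assoc, Category.assoc, h]
  simp

lemma dmul_rightUnitor {F : DayFunctor K V} {y : K} (a : 𝟙_ V ⟶ F.functor.obj y) :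
    dmul a (dayν K V) ≫ (ρ_ F).hom.natTrans.app (y ⊗ 𝟙_ K) = a ≫ F.functor.map (ρ_ y).inv := by
  have h := dν_rightUnitor F y
  unfold dmul
  rw [MonoidalCategory.tensorHom_def, Category.assoc, Category.assoc, Category.assoc, h]
  simp [unitors_inv_equal]

/-- The functor `y ↦ F(x ⊗ y)`. -/
def shift (x : K) (F : DayFunctor K V) : DayFunctor K V := .mk
  { obj y := F.functor.obj (x ⊗ y)
    map f := F.functor.map (x ◁ f) }

end Elements

/-! ### The universal property of the powers of `T` -/

section Gen

variable (C : Type u) [Category.{v} C] [MonoidalCategory C] [SymmetricCategory C]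
  [HasColimitsOfSize.{0, 0} C] [∀ X : C, PreservesColimitsOfSize.{0, 0} (tensorLeft X)]

/-- The fundamental element of `T` in degree `1`, the identity of `𝟙`. -/
def genT : 𝟙_ C ⟶ (sphereT C).functor.obj ⟨1⟩ := 𝟙 (𝟙_ C)

instance : IsIso (genT C) := inferInstanceAs (IsIso (𝟙 (𝟙_ C)))

/-- The fundamental element of `T^{⊗ p}` in degree `p`. -/
def gen : ∀ p : ℕ, 𝟙_ C ⟶ (pw (sphereT C) p).functor.obj ⟨p⟩
  | 0 => dayν Sym C
  | p + 1 => dmul (gen p) (genT C)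

lemma gen_succ (p : ℕ) : gen C (p + 1) = dmul (gen C p) (genT C) := rfl

variable {C}

lemma sphere_initial {k : ℕ} (hk : k ≠ 1) : Nonempty (IsInitial ((sphereT C).functor.obj ⟨k⟩)) := by
  have : HasColimitsOfShape (Discrete PEmpty.{1}) C := inferInstance
  match k, hk with
  | 0, _ => exact ⟨initialIsInitial⟩
  | k + 2, _ => exact ⟨initialIsInitial⟩

lemma initial_tensor {X : C} (h : Nonempty (IsInitial X)) (Y : C) :
    Nonempty (IsInitial (X ⊗ Y)) :=
  h.map fun i => IsInitial.isInitialObj (tensorRight Y) X i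

lemma tensor_initial {X : C} (h : Nonempty (IsInitial X)) (Y : C) :
    Nonempty (IsInitial (Y ⊗ X)) :=
  h.map fun i => IsInitial.isInitialObj (tensorLeft Y) X i

lemma initial_hom_ext {X Y : C} (h : Nonempty (IsInitial X)) (f g : X ⟶ Y) : f = g :=
  h.some.hom_ext f g

/-- The images of the fundamental element cover `T^{⊗ p}`, also after tensoring with an object. -/
lemma pw_tensor_hom_ext (p : ℕ) (z : Sym) (W : C) {Z : C}
    {f g : (pw (sphereT C) p).functor.obj z ⊗ W ⟶ Z}
    (h : ∀ s : (⟨p⟩ : Sym) ⟶ z, (gen C p ≫ (pw (sphereT C) p).functor.map s) ▷ W ≫ f =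
      (gen C p ≫ (pw (sphereT C) p).functor.map s) ▷ W ≫ g) : f = g := by
  induction p generalizing z W Z with
  | zero => exact unit_obj_tensor_hom_ext z W h
  | succ p ih =>
    apply day_obj_tensor_hom_ext
    intro x y s
    by_cases hy : y.n = 1
    · obtain ⟨k⟩ := y
      obtain rfl : k = 1 := hy
      rw [← cancel_epi (α_ _ _ _).inv]
      apply ih
      intro t
      rw [← cancel_epi ((𝟙_ C) ◁ (genT C ▷ W)), ← cancel_epi (α_ _ _ _).hom,
        ← cancel_epi ((λ_ (𝟙_ C)).inv ▷ W)]
      have e (f : (pw (sphereT C) (p + 1)).functor.obj z ⊗ W ⟶ Z) :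
          (λ_ (𝟙_ C)).inv ▷ W ≫ (α_ _ _ _).hom ≫ (𝟙_ C) ◁ (genT C ▷ W) ≫
          (gen C p ≫ (pw (sphereT C) p).functor.map t) ▷ ((sphereT C).functor.obj ⟨1⟩ ⊗ W) ≫
          (α_ _ _ _).inv ≫ (dη (pw (sphereT C) p) (sphereT C) x ⟨1⟩ ≫
            (pw (sphereT C) p ⊗ sphereT C).functor.map s) ▷ W ≫ f =
          (gen C (p + 1) ≫ (pw (sphereT C) (p + 1)).functor.map (t ▷ ⟨1⟩ ≫ s)) ▷ W ≫ f := by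
        have e₁ : gen C (p + 1) ≫ (pw (sphereT C) (p + 1)).functor.map (t ▷ ⟨1⟩ ≫ s) =
            dmul (gen C p ≫ (pw (sphereT C) p).functor.map t) (genT C) ≫
              (pw (sphereT C) p ⊗ sphereT C).functor.map s := by
          rw [← dmul_map_left, Category.assoc, ← CategoryTheory.Functor.map_comp]
          rfl
        rw [e₁]
        unfold dmul
        simp [MonoidalCategory.tensorHom_def']
      rw [e f, e g]
      exact h _
    · exact initial_hom_ext (initial_tensor (tensor_initial (sphere_initial hy) _) _) _ _

/-- A morphism out of `T^{⊗ p} ⊗ N` is determined by its values on the fundamental element. -/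
lemma pw_hom_ext {p : ℕ} {N N' : DayFunctor Sym C} {f g : pw (sphereT C) p ⊗ N ⟶ N'}
    (h : ∀ n, gen C p ▷ N.functor.obj n ≫ dη (pw (sphereT C) p) N ⟨p⟩ n ≫
        f.natTrans.app (⟨p⟩ ⊗ n) =
      gen C p ▷ N.functor.obj n ≫ dη (pw (sphereT C) p) N ⟨p⟩ n ≫ g.natTrans.app (⟨p⟩ ⊗ n)) :
    f = g := by
  apply day_hom_ext
  intro x y
  apply pw_tensor_hom_ext
  intro s
  have e (f : pw (sphereT C) p ⊗ N ⟶ N') :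
      (gen C p ≫ (pw (sphereT C) p).functor.map s) ▷ N.functor.obj y ≫
        dη (pw (sphereT C) p) N x y ≫ f.natTrans.app (x ⊗ y) =
      (gen C p ▷ N.functor.obj y ≫ dη (pw (sphereT C) p) N ⟨p⟩ y ≫
        f.natTrans.app (⟨p⟩ ⊗ y)) ≫ N'.functor.map (s ▷ y) := by
    rw [comp_whiskerRight, Category.assoc, reassoc_of% dη_natural_left,
      f.natTrans.naturality, Category.assoc, Category.assoc]
  rw [e, e, h]

/-- The values at `(k, y)` of the morphism `T ⊗ N ⟶ N'` given by maps `N(y) ⟶ N'(1 ⊗ y)`. For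
`k ≠ 1` the source is initial. -/
def sphereDescApp {N N' : DayFunctor Sym C}
    (u : ∀ y, N.functor.obj y ⟶ N'.functor.obj (⟨1⟩ ⊗ y)) (k : ℕ) (y : Sym) :
    (sphereT C).functor.obj ⟨k⟩ ⊗ N.functor.obj y ⟶ N'.functor.obj (⟨k⟩ ⊗ y) :=
  if h : k = 1 then by
    subst h
    exact inv (genT C) ▷ _ ≫ (λ_ _).hom ≫ u y
  else (initial_tensor (sphere_initial h) _).some.to _

lemma sphereDescApp_one {N N' : DayFunctor Sym C}
    (u : ∀ y, N.functor.obj y ⟶ N'.functor.obj (⟨1⟩ ⊗ y)) (y : Sym) :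
    sphereDescApp u 1 y = inv (genT C) ▷ _ ≫ (λ_ _).hom ≫ u y :=
  dif_pos rfl

/-- Morphisms `T ⊗ N ⟶ N'` from natural maps `N(y) ⟶ N'(1 ⊗ y)`. -/
lemma exists_sphereDesc {N N' : DayFunctor Sym C}
    (u : ∀ y, N.functor.obj y ⟶ N'.functor.obj (⟨1⟩ ⊗ y))
    (hu : ∀ {y y' : Sym} (f : y ⟶ y'),
      N.functor.map f ≫ u y' = u y ≫ N'.functor.map ((⟨1⟩ : Sym) ◁ f)) :
    ∃ f : sphereT C ⊗ N ⟶ N', ∀ y, genT C ▷ N.functor.obj y ≫ dη (sphereT C) N ⟨1⟩ y ≫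
      f.natTrans.app (⟨1⟩ ⊗ y) = (λ_ _).hom ≫ u y := by
  refine ⟨dayDesc (fun x y => sphereDescApp u x.n y) ?_ ?_, ?_⟩
  · rintro ⟨k⟩ ⟨k'⟩ f y
    obtain rfl : k = k' := Fin.equiv_iff_eq.1 ⟨f⟩
    by_cases hk : k = 1
    · subst hk
      obtain rfl : f = 𝟙 _ := Subsingleton.elim (α := Fin 1 ≃ Fin 1) _ _
      rw [CategoryTheory.Functor.map_id, id_whiskerRight, id_whiskerRight,
        CategoryTheory.Functor.map_id, Category.id_comp, Category.comp_id]
    · exact initial_hom_ext (initial_tensor (sphere_initial hk) _) _ _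
  · rintro ⟨k⟩ y y' f
    by_cases hk : k = 1
    · subst hk
      have h := hu f
      change _ ◁ _ ≫ sphereDescApp u 1 y' = sphereDescApp u 1 y ≫ _
      rw [sphereDescApp_one, sphereDescApp_one, whisker_exchange_assoc, leftUnitor_naturality_assoc,
        h, Category.assoc, Category.assoc]
    · exact initial_hom_ext (initial_tensor (sphere_initial hk) _) _ _
  · intro y
    rw [dη_dayDesc]
    change _ ≫ sphereDescApp u 1 y = _
    rw [sphereDescApp_one, ← comp_whiskerRight_assoc]
    simp

/-- Morphisms `T^{⊗ p} ⊗ N ⟶ N'` from natural maps `N(y) ⟶ N'(p ⊗ y)`. -/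
lemma exists_pwDesc (p : ℕ) {N N' : DayFunctor Sym C}
    (u : ∀ y, N.functor.obj y ⟶ N'.functor.obj (⟨p⟩ ⊗ y))
    (hu : ∀ {y y' : Sym} (f : y ⟶ y'),
      N.functor.map f ≫ u y' = u y ≫ N'.functor.map ((⟨p⟩ : Sym) ◁ f)) :
    ∃ f : pw (sphereT C) p ⊗ N ⟶ N', ∀ y, gen C p ▷ N.functor.obj y ≫
      dη (pw (sphereT C) p) N ⟨p⟩ y ≫ f.natTrans.app (⟨p⟩ ⊗ y) = (λ_ _).hom ≫ u y := by
  induction p generalizing N N' with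
  | zero =>
    let u' : N ⟶ N' := .mk
      { app y := u y ≫ N'.functor.map (λ_ y).hom
        naturality y y' f := by
          have h := hu f
          have h₂ : (⟨0⟩ : Sym) ◁ f ≫ (λ_ y').hom = (λ_ y).hom ≫ f := leftUnitor_naturality f
          rw [reassoc_of% h, Category.assoc, ← CategoryTheory.Functor.map_comp,
            ← CategoryTheory.Functor.map_comp, h₂] }
    refine ⟨(λ_ N).hom ≫ u', fun y => ?_⟩
    have h := dν_leftUnitor N y
    have h₂ := u'.natTrans.naturality (λ_ y).inv
    have h₃ : u'.natTrans.app y ≫ N'.functor.map (λ_ y).inv = u y := by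
      change (u y ≫ N'.functor.map (λ_ y).hom) ≫ N'.functor.map (λ_ y).inv = _
      rw [Category.assoc, ← CategoryTheory.Functor.map_comp, Iso.hom_inv_id]
      exact (congrArg (_ ≫ ·) (CategoryTheory.Functor.map_id _ _)).trans (Category.comp_id _)
    change dayν Sym C ▷ N.functor.obj y ≫ dη (𝟙_ _) N (𝟙_ Sym) y ≫
      (λ_ N).hom.natTrans.app (𝟙_ Sym ⊗ y) ≫ u'.natTrans.app (𝟙_ Sym ⊗ y) = _
    rw [reassoc_of% h, h₂, h₃]
  | succ p ih =>
    have hn {y y' : Sym} (f : y ⟶ y') :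
        N.functor.map f ≫ u y' ≫ N'.functor.map (α_ (⟨p⟩ : Sym) ⟨1⟩ y').hom =
        (u y ≫ N'.functor.map (α_ (⟨p⟩ : Sym) ⟨1⟩ y).hom) ≫
          N'.functor.map ((⟨p⟩ : Sym) ◁ (⟨1⟩ : Sym) ◁ f) := by
      have h := hu f
      have h₂ : (⟨p + 1⟩ : Sym) ◁ f ≫ (α_ (⟨p⟩ : Sym) ⟨1⟩ y').hom =
        (α_ (⟨p⟩ : Sym) ⟨1⟩ y).hom ≫ (⟨p⟩ : Sym) ◁ (⟨1⟩ : Sym) ◁ f :=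
          associator_naturality_right _ _ f
      rw [reassoc_of% h, Category.assoc, ← CategoryTheory.Functor.map_comp,
        ← CategoryTheory.Functor.map_comp, h₂]
    obtain ⟨v, hv, hv₁⟩ : ∃ v : ∀ z, (sphereT C ⊗ N).functor.obj z ⟶ N'.functor.obj (⟨p⟩ ⊗ z),
        (∀ {z z' : Sym} (f : z ⟶ z'), (sphereT C ⊗ N).functor.map f ≫ v z' =
          v z ≫ N'.functor.map ((⟨p⟩ : Sym) ◁ f)) ∧
        ∀ y, genT C ▷ N.functor.obj y ≫ dη (sphereT C) N ⟨1⟩ y ≫ v (⟨1⟩ ⊗ y) =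
          (λ_ _).hom ≫ u y ≫ N'.functor.map (α_ (⟨p⟩ : Sym) ⟨1⟩ y).hom := by
      obtain ⟨f₁, hf₁⟩ := exists_sphereDesc (N := N) (N' := shift ⟨p⟩ N')
        (fun y => u y ≫ N'.functor.map (α_ (⟨p⟩ : Sym) ⟨1⟩ y).hom) hn
      exact ⟨fun y => f₁.natTrans.app y, fun f => f₁.natTrans.naturality f, hf₁⟩
    obtain ⟨f₂, hf₂⟩ := ih (N := sphereT C ⊗ N) (N' := N') v hv
    refine ⟨(α_ _ _ _).hom ≫ f₂, fun y => ?_⟩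
    have h₂ := hf₂ (⟨1⟩ ⊗ y)
    have h := dη_associator (pw (sphereT C) p) (sphereT C) N ⟨p⟩ ⟨1⟩ y
    have h₃ := f₂.natTrans.naturality (α_ (⟨p⟩ : Sym) ⟨1⟩ y).inv
    have h₅ : dmul (gen C p) (genT C) ▷ N.functor.obj y = (λ_ (𝟙_ C)).inv ▷ _ ≫
      (gen C p ⊗ₘ genT C) ▷ _ ≫ dη (pw (sphereT C) p) (sphereT C) ⟨p⟩ ⟨1⟩ ▷ N.functor.obj y := by
      simp [dmul]
    have h₆ : (λ_ (𝟙_ C)).inv ▷ N.functor.obj y ≫ (gen C p ⊗ₘ genT C) ▷ N.functor.obj y ≫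
        (α_ _ _ _).hom = (λ_ _).inv ≫ 𝟙_ C ◁ genT C ▷ N.functor.obj y ≫
          gen C p ▷ ((sphereT C).functor.obj ⟨1⟩ ⊗ N.functor.obj y) := by
      simp [MonoidalCategory.tensorHom_def']
    have h₇ : N'.functor.map (α_ (⟨p⟩ : Sym) ⟨1⟩ y).hom ≫
        N'.functor.map (α_ (⟨p⟩ : Sym) ⟨1⟩ y).inv = 𝟙 _ := by
      rw [← CategoryTheory.Functor.map_comp, Iso.hom_inv_id, CategoryTheory.Functor.map_id]
    change dmul (gen C p) (genT C) ▷ N.functor.obj y ≫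
      dη (pw (sphereT C) p ⊗ sphereT C) N (⟨p⟩ ⊗ ⟨1⟩) y ≫
      (α_ (pw (sphereT C) p) (sphereT C) N).hom.natTrans.app ((⟨p⟩ ⊗ ⟨1⟩) ⊗ y) ≫
        f₂.natTrans.app ((⟨p⟩ ⊗ ⟨1⟩) ⊗ y) = _
    rw [h₅, Category.assoc, Category.assoc, reassoc_of% h, h₃, reassoc_of% h₆,
      ← whisker_exchange_assoc, reassoc_of% h₂, leftUnitor_naturality_assoc,
      leftUnitor_naturality_assoc, Iso.inv_hom_id_assoc, reassoc_of% (hv₁ y), h₇]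
    exact congrArg ((λ_ _).hom ≫ ·) (Category.comp_id _)

end Gen

/-! ### The symmetry and the product of the fundamental elements -/

section GenSym

variable {C : Type u} [Category.{v} C] [MonoidalCategory C] [SymmetricCategory C]
  [HasColimitsOfSize.{0, 0} C] [∀ X : C, PreservesColimitsOfSize.{0, 0} (tensorLeft X)]

/-- A bijection as a morphism of `Σ`. -/
abbrev symHom {m n : ℕ} (e : Fin m ≃ Fin n) : (⟨m⟩ : Sym) ⟶ ⟨n⟩ := e

/-- The transposition of the last two elements. -/
def lastSwap (n : ℕ) : (⟨n + 1 + 1⟩ : Sym) ⟶ ⟨n + 1 + 1⟩ :=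
  (α_ (⟨n⟩ : Sym) ⟨1⟩ ⟨1⟩).hom ≫ (⟨n⟩ : Sym) ◁ (β_ (⟨1⟩ : Sym) ⟨1⟩).hom ≫
    (α_ (⟨n⟩ : Sym) ⟨1⟩ ⟨1⟩).inv

lemma gen_associator (n : ℕ) : gen C (n + 1 + 1) ≫
    (α_ (pw (sphereT C) n) (sphereT C) (sphereT C)).hom.natTrans.app ((⟨n⟩ ⊗ ⟨1⟩) ⊗ ⟨1⟩) =
    dmul (gen C n) (dmul (genT C) (genT C)) ≫
      (pw (sphereT C) n ⊗ sphereT C ⊗ sphereT C).functor.map (α_ (⟨n⟩ : Sym) ⟨1⟩ ⟨1⟩).inv :=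
  dmul_associator (gen C n) (genT C) (genT C)

lemma gen_associator_inv (n : ℕ) : dmul (gen C n) (dmul (genT C) (genT C)) ≫
    (α_ (pw (sphereT C) n) (sphereT C) (sphereT C)).inv.natTrans.app (⟨n⟩ ⊗ ⟨1⟩ ⊗ ⟨1⟩) =
    gen C (n + 1 + 1) ≫ ((pw (sphereT C) n ⊗ sphereT C) ⊗ sphereT C).functor.map
      (α_ (⟨n⟩ : Sym) ⟨1⟩ ⟨1⟩).hom := by
  have h := gen_associator (C := C) n
  have h₁ := (α_ (pw (sphereT C) n) (sphereT C) (sphereT C)).inv.natTrans.naturality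
    (α_ (⟨n⟩ : Sym) ⟨1⟩ ⟨1⟩).hom
  have h₂ : (α_ (pw (sphereT C) n) (sphereT C) (sphereT C)).hom.natTrans.app ((⟨n⟩ ⊗ ⟨1⟩) ⊗ ⟨1⟩) ≫
      (α_ (pw (sphereT C) n) (sphereT C) (sphereT C)).inv.natTrans.app ((⟨n⟩ ⊗ ⟨1⟩) ⊗ ⟨1⟩) = 𝟙 _ :=
    congrArg (fun t => t.natTrans.app ((⟨n⟩ ⊗ ⟨1⟩) ⊗ ⟨1⟩))
      (α_ (pw (sphereT C) n) (sphereT C) (sphereT C)).hom_inv_id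
  have h₃ : (pw (sphereT C) n ⊗ sphereT C ⊗ sphereT C).functor.map (α_ (⟨n⟩ : Sym) ⟨1⟩ ⟨1⟩).inv ≫
      (pw (sphereT C) n ⊗ sphereT C ⊗ sphereT C).functor.map (α_ (⟨n⟩ : Sym) ⟨1⟩ ⟨1⟩).hom = 𝟙 _ := by
    rw [← CategoryTheory.Functor.map_comp, Iso.inv_hom_id, CategoryTheory.Functor.map_id]
  have h₄ : dmul (gen C n) (dmul (genT C) (genT C)) = gen C (n + 1 + 1) ≫
      (α_ (pw (sphereT C) n) (sphereT C) (sphereT C)).hom.natTrans.app ((⟨n⟩ ⊗ ⟨1⟩) ⊗ ⟨1⟩) ≫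
      (pw (sphereT C) n ⊗ sphereT C ⊗ sphereT C).functor.map (α_ (⟨n⟩ : Sym) ⟨1⟩ ⟨1⟩).hom := by
    rw [reassoc_of% h, h₃, Category.comp_id]
  rw [h₄, Category.assoc, Category.assoc, h₁, reassoc_of% h₂]

/-- The symmetry of the last two factors of `T^{⊗ (n + 2)}` moves the fundamental element as the
transposition of the last two points does. -/
lemma gen_swap (n : ℕ) : gen C (n + 1 + 1) ≫
    (swap (pw (sphereT C) n) (sphereT C)).natTrans.app ⟨n + 1 + 1⟩ =
      gen C (n + 1 + 1) ≫ (pw (sphereT C) (n + 1 + 1)).functor.map (lastSwap n) := by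
  have h := gen_associator (C := C) n
  have h' := gen_associator_inv (C := C) n
  have hb : dmul (genT C) (genT C) ≫ (β_ (sphereT C) (sphereT C)).hom.natTrans.app (⟨1⟩ ⊗ ⟨1⟩) =
      dmul (genT C) (genT C) ≫ (sphereT C ⊗ sphereT C).functor.map (β_ (⟨1⟩ : Sym) ⟨1⟩).hom :=
    dmul_braiding _ _
  have h₁ := (pw (sphereT C) n ◁ (β_ (sphereT C) (sphereT C)).hom).natTrans.naturality
    (α_ (⟨n⟩ : Sym) ⟨1⟩ ⟨1⟩).inv
  have h₂ := (α_ (pw (sphereT C) n) (sphereT C) (sphereT C)).inv.natTrans.naturality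
    (α_ (⟨n⟩ : Sym) ⟨1⟩ ⟨1⟩).inv
  have h₃ := (α_ (pw (sphereT C) n) (sphereT C) (sphereT C)).inv.natTrans.naturality
    ((⟨n⟩ : Sym) ◁ (β_ (⟨1⟩ : Sym) ⟨1⟩).hom)
  have h₄ := dmul_whiskerLeft (pw (sphereT C) n) (β_ (sphereT C) (sphereT C)).hom
    (gen C n) (dmul (genT C) (genT C))
  change gen C (n + 1 + 1) ≫
    (α_ (pw (sphereT C) n) (sphereT C) (sphereT C)).hom.natTrans.app ((⟨n⟩ ⊗ ⟨1⟩) ⊗ ⟨1⟩) ≫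
    (pw (sphereT C) n ◁ (β_ (sphereT C) (sphereT C)).hom).natTrans.app ((⟨n⟩ ⊗ ⟨1⟩) ⊗ ⟨1⟩) ≫
    (α_ (pw (sphereT C) n) (sphereT C) (sphereT C)).inv.natTrans.app ((⟨n⟩ ⊗ ⟨1⟩) ⊗ ⟨1⟩) =
    gen C (n + 1 + 1) ≫ ((pw (sphereT C) n ⊗ sphereT C) ⊗ sphereT C).functor.map
      ((α_ (⟨n⟩ : Sym) ⟨1⟩ ⟨1⟩).hom ≫ (⟨n⟩ : Sym) ◁ (β_ (⟨1⟩ : Sym) ⟨1⟩).hom ≫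
        (α_ (⟨n⟩ : Sym) ⟨1⟩ ⟨1⟩).inv)
  rw [reassoc_of% h, reassoc_of% h₁, reassoc_of% h₄, hb, ← dmul_map_right, Category.assoc, h₂,
    reassoc_of% h₃, reassoc_of% h', CategoryTheory.Functor.map_comp,
    CategoryTheory.Functor.map_comp]

lemma lastSwap_apply (n : ℕ) (x : Fin (n + 1 + 1)) :
    (show Fin (n + 1 + 1) ≃ Fin (n + 1 + 1) from lastSwap n) x =
      Sym.blockSum (Equiv.refl (Fin n)) (shuffle 1 1) x := rfl

lemma lastSwap_last (n : ℕ) : (show Fin (n + 1 + 1) ≃ Fin (n + 1 + 1) from lastSwap n)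
    (Fin.last _) = (Fin.last n).castSucc := by
  rw [lastSwap_apply]
  refine (blockSum_natAdd (Equiv.refl (Fin n)) (shuffle 1 1) 1).trans ?_
  ext
  rw [Fin.val_natAdd, val_shuffle]
  rfl

lemma lastSwap_castSucc_last (n : ℕ) : (show Fin (n + 1 + 1) ≃ Fin (n + 1 + 1) from lastSwap n)
    (Fin.last n).castSucc = Fin.last _ := by
  rw [lastSwap_apply]
  refine (blockSum_natAdd (Equiv.refl (Fin n)) (shuffle 1 1) 0).trans ?_
  ext
  rw [Fin.val_natAdd, val_shuffle]
  rfl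

lemma lastSwap_castSucc_castSucc (n : ℕ) (i : Fin n) :
    (show Fin (n + 1 + 1) ≃ Fin (n + 1 + 1) from lastSwap n)
    i.castSucc.castSucc = i.castSucc.castSucc := by
  rw [lastSwap_apply]
  exact blockSum_castAdd (Equiv.refl (Fin n)) (shuffle 1 1) i

/-- The value of `e ⊕ 1` at the last point. -/
lemma whiskerRight_last {m n : ℕ} (e : Fin m ≃ Fin n) :
    (show Fin (m + 1) ≃ Fin (n + 1) from
      symHom e ▷ (⟨1⟩ : Sym)) (Fin.last m) = Fin.last n :=
  blockSum_natAdd e (Equiv.refl (Fin 1)) 0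

lemma whiskerRight_castSucc {m n : ℕ} (e : Fin m ≃ Fin n) (i : Fin m) :
    (show Fin (m + 1) ≃ Fin (n + 1) from
      symHom e ▷ (⟨1⟩ : Sym)) i.castSucc = (e i).castSucc :=
  blockSum_castAdd e (Equiv.refl (Fin 1)) i

/-- The cyclic permutation that moves the last point to the position `i`. -/
def moveLast (n : ℕ) (i : Fin (n + 1)) : Fin (n + 1) ≃ Fin (n + 1) :=
  (finSuccEquiv' (Fin.last n)).trans (finSuccEquiv' i).symm

lemma moveLast_last (n : ℕ) (i : Fin (n + 1)) : moveLast n i (Fin.last n) = i := by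
  simp [moveLast]

lemma moveLast_castSucc (n : ℕ) (i : Fin (n + 1)) (j : Fin n) :
    moveLast n i j.castSucc = i.succAbove j := by
  have h : finSuccEquiv' (Fin.last n) j.castSucc = some j := by
    rw [← Fin.succAbove_last, finSuccEquiv'_succAbove]
  exact (congrArg (finSuccEquiv' i).symm h).trans (finSuccEquiv'_symm_some i j)

/-- A bijection is a bijection of the first points followed by the cycle that moves the last
point to its image. This mirrors the recursion that defines `permMap`. -/
lemma moveLast_eq {m n : ℕ} (e : Fin (m + 1) ≃ Fin (n + 1)) :
    symHom e =
      symHom (rem e (Fin.last m)) ▷ (⟨1⟩ : Sym) ≫ symHom (moveLast n (e (Fin.last m))) := by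
  refine Equiv.ext fun (x : Fin (m + 1)) => ?_
  refine Eq.trans ?_ (Equiv.trans_apply _ (moveLast n (e (Fin.last m))) x).symm
  cases x using Fin.lastCases with
  | last => exact ((congrArg _ (whiskerRight_last _)).trans (moveLast_last _ _)).symm
  | cast x =>
    refine ((congrArg _ (whiskerRight_castSucc _ x)).trans ((moveLast_castSucc _ _ _).trans ?_)).symm
    rw [succAbove_rem, Fin.succAbove_last]

/-- The recursion of the cycles `moveLast`, which mirrors that of the insertions `ins`. -/
lemma moveLast_castSucc_eq (n : ℕ) (j : Fin (n + 1)) :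
    symHom (moveLast (n + 1) j.castSucc) =
      lastSwap n ≫ symHom (moveLast n j) ▷ (⟨1⟩ : Sym) := by
  refine Equiv.ext fun (x : Fin (n + 1 + 1)) => ?_
  refine Eq.trans ?_ (Equiv.trans_apply (lastSwap n) _ x).symm
  cases x using Fin.lastCases with
  | last =>
    refine (moveLast_last _ _).trans ((congrArg _ (lastSwap_last n)).trans
      ((whiskerRight_castSucc _ _).trans ?_)).symm
    rw [moveLast_last]
  | cast x =>
    refine (moveLast_castSucc _ _ _).trans ?_
    cases x using Fin.lastCases with
    | last =>
      refine Eq.trans ?_ ((congrArg _ (lastSwap_castSucc_last n)).trans (whiskerRight_last _)).symm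
      ext
      have := j.isLt
      simp only [val_succAbove, Fin.val_last, Fin.val_castSucc]
      split_ifs <;> omega
    | cast x =>
      refine Eq.trans ?_ ((congrArg _ (lastSwap_castSucc_castSucc n x)).trans
        (whiskerRight_castSucc _ _)).symm
      rw [moveLast_castSucc]
      ext
      simp only [val_succAbove, Fin.val_castSucc]

lemma moveLast_self (n : ℕ) : moveLast n (Fin.last n) = Equiv.refl _ := by
  simp [moveLast]

/-- Inserting the last factor of `T^{⊗ (n + 1)}` at the position `i` and applying the same cycle to
the degree fixes the fundamental element. -/
lemma gen_ins (n : ℕ) (i : Fin (n + 1)) : gen C (n + 1) ≫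
    (ins (sphereT C) n i).natTrans.app ⟨n + 1⟩ ≫ (pw (sphereT C) (n + 1)).functor.map
      (symHom (moveLast n i)) = gen C (n + 1) := by
  have hl (n : ℕ) : gen C (n + 1) ≫
    (ins (sphereT C) n (Fin.last n)).natTrans.app ⟨n + 1⟩ ≫ (pw (sphereT C) (n + 1)).functor.map
      (symHom (moveLast n (Fin.last n))) = gen C (n + 1) := by
    rw [ins_last, moveLast_self]
    have e : (pw (sphereT C) (n + 1)).functor.map
      (symHom (Equiv.refl (Fin (n + 1)))) = 𝟙 _ :=
      CategoryTheory.Functor.map_id _ _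
    rw [e]
    exact (congrArg (gen C (n + 1) ≫ ·) (Category.id_comp _)).trans (Category.comp_id _)
  induction n with
  | zero =>
    obtain rfl : i = Fin.last 0 := Subsingleton.elim (α := Fin 1) _ _
    exact hl 0
  | succ n ih =>
    cases i using Fin.lastCases with
    | last => exact hl (n + 1)
    | cast j =>
      have h := ih j
      have hs := gen_swap (C := C) n
      have h₁ : (pw (sphereT C) (n + 1 + 1)).functor.map (lastSwap n) ≫
          (ins (sphereT C) n j ▷ sphereT C).natTrans.app (⟨n + 1⟩ ⊗ ⟨1⟩) =
          (ins (sphereT C) n j ▷ sphereT C).natTrans.app (⟨n + 1⟩ ⊗ ⟨1⟩) ≫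
          (pw (sphereT C) (n + 1) ⊗ sphereT C).functor.map (lastSwap n) :=
        (ins (sphereT C) n j ▷ sphereT C).natTrans.naturality (lastSwap n)
      have h₂ := dmul_whiskerRight (ins (sphereT C) n j) (sphereT C) (gen C (n + 1)) (genT C)
      have h₃ := dmul_map_left (gen C (n + 1) ≫ (ins (sphereT C) n j).natTrans.app ⟨n + 1⟩)
        (genT C) (symHom (moveLast n j))
      have h₄ : lastSwap n ≫ lastSwap n = 𝟙 _ := by
        simp [lastSwap, ← whiskerLeft_comp_assoc]
      rw [ins_castSucc, moveLast_castSucc_eq]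
      change gen C (n + 1 + 1) ≫
        ((swap (pw (sphereT C) n) (sphereT C)).natTrans.app ⟨n + 1 + 1⟩ ≫
        (ins (sphereT C) n j ▷ sphereT C).natTrans.app (⟨n + 1⟩ ⊗ ⟨1⟩)) ≫
        (pw (sphereT C) (n + 1) ⊗ sphereT C).functor.map (lastSwap n ≫
          symHom (moveLast n j) ▷ (⟨1⟩ : Sym)) = _
      have h₅ : (pw (sphereT C) (n + 1) ⊗ sphereT C).functor.map (lastSwap n) ≫
          (pw (sphereT C) (n + 1) ⊗ sphereT C).functor.map (lastSwap n) = 𝟙 _ := by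
        rw [← CategoryTheory.Functor.map_comp, h₄, CategoryTheory.Functor.map_id]
      rw [Category.assoc, reassoc_of% hs, CategoryTheory.Functor.map_comp, reassoc_of% h₁,
        reassoc_of% h₅]
      refine (comp_comp_eq h₂ _).trans (h₃.trans ?_)
      rw [Category.assoc, h]
      rfl

/-- The fundamental elements are invariant under the symmetric groups: the permutation of the
factors of `T^{⊗ n}` undoes the action of `Σ_n` on the degree. -/
lemma gen_permMap : ∀ (m n : ℕ) (e : Fin m ≃ Fin n), gen C m ≫
    (permMap (sphereT C) m n e).natTrans.app ⟨m⟩ ≫ (pw (sphereT C) n).functor.map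
      (symHom e) = gen C n
  | 0, 0, e => by
    obtain rfl : e = Equiv.refl _ := Subsingleton.elim _ _
    have h : (pw (sphereT C) 0).functor.map (symHom (Equiv.refl (Fin 0))) = 𝟙 _ :=
      CategoryTheory.Functor.map_id _ _
    rw [h]
    exact (congrArg (gen C 0 ≫ ·) (Category.id_comp _)).trans (Category.comp_id _)
  | 0, _ + 1, e => (e.symm 0).elim0
  | _ + 1, 0, e => (e 0).elim0
  | m + 1, n + 1, e => by
    have ih := gen_permMap m n (rem e (Fin.last m))
    have hi := gen_ins (C := C) n (e (Fin.last m))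
    have h₁ := dmul_whiskerRight (permMap (sphereT C) m n (rem e (Fin.last m))) (sphereT C)
      (gen C m) (genT C)
    have h₂ := (ins (sphereT C) n (e (Fin.last m))).natTrans.naturality
      (symHom (rem e (Fin.last m)) ▷ (⟨1⟩ : Sym))
    have h₃ := dmul_map_left (gen C m ≫ (permMap (sphereT C) m n (rem e (Fin.last m))).natTrans.app
      ⟨m⟩) (genT C) (symHom (rem e (Fin.last m)))
    rw [Category.assoc, ih, ← gen_succ] at h₃
    rw [permMap_succ, moveLast_eq]
    change dmul (gen C m) (genT C) ≫
      ((permMap (sphereT C) m n (rem e (Fin.last m)) ▷ sphereT C).natTrans.app (⟨m⟩ ⊗ ⟨1⟩) ≫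
        (ins (sphereT C) n (e (Fin.last m))).natTrans.app (⟨m⟩ ⊗ ⟨1⟩)) ≫
      (pw (sphereT C) (n + 1)).functor.map
        (symHom (rem e (Fin.last m)) ▷ (⟨1⟩ : Sym) ≫
        symHom (moveLast n (e (Fin.last m)))) = _
    rw [CategoryTheory.Functor.map_comp, Category.assoc, ← reassoc_of% h₂, reassoc_of% h₁]
    exact (comp_comp_eq h₃ _).trans hi

/-- The fundamental elements are multiplicative for concatenation. -/
lemma gen_cat (m n : ℕ) : dmul (gen C m) (gen C n) ≫
    (cat (sphereT C) m n).natTrans.app (⟨m⟩ ⊗ ⟨n⟩) = gen C (m + n) := by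
  induction n with
  | zero =>
    refine (dmul_rightUnitor (gen C m)).trans ?_
    exact (congrArg (gen C m ≫ ·) (CategoryTheory.Functor.map_id _ _)).trans (Category.comp_id _)
  | succ n ih =>
    have h₁ := dmul_associator (gen C m) (gen C n) (genT C)
    have h₂ := dmul_whiskerRight (cat (sphereT C) m n) (sphereT C) (dmul (gen C m) (gen C n))
      (genT C)
    have h₃ : (α_ (pw (sphereT C) m) (pw (sphereT C) n) (sphereT C)).hom.natTrans.app
        ((⟨m⟩ ⊗ ⟨n⟩) ⊗ ⟨1⟩) ≫ (α_ (pw (sphereT C) m) (pw (sphereT C) n)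
          (sphereT C)).inv.natTrans.app ((⟨m⟩ ⊗ ⟨n⟩) ⊗ ⟨1⟩) = 𝟙 _ :=
      congrArg (fun t => t.natTrans.app ((⟨m⟩ ⊗ ⟨n⟩) ⊗ ⟨1⟩))
        (α_ (pw (sphereT C) m) (pw (sphereT C) n) (sphereT C)).hom_inv_id
    have h₄ : (pw (sphereT C) m ⊗ pw (sphereT C) n ⊗ sphereT C).functor.map
        (α_ (⟨m⟩ : Sym) ⟨n⟩ ⟨1⟩).inv = 𝟙 _ := CategoryTheory.Functor.map_id _ _
    have h₅ : dmul (dmul (gen C m) (gen C n)) (genT C) ≫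
        (α_ (pw (sphereT C) m) (pw (sphereT C) n) (sphereT C)).hom.natTrans.app
        ((⟨m⟩ ⊗ ⟨n⟩) ⊗ ⟨1⟩) = dmul (gen C m) (dmul (gen C n) (genT C)) := by
      refine h₁.trans ((congrArg (_ ≫ ·) h₄).trans (Category.comp_id _))
    have h₆ : dmul (gen C m) (dmul (gen C n) (genT C)) ≫
        (α_ (pw (sphereT C) m) (pw (sphereT C) n) (sphereT C)).inv.natTrans.app
        ((⟨m⟩ ⊗ ⟨n⟩) ⊗ ⟨1⟩) = dmul (dmul (gen C m) (gen C n)) (genT C) := by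
      rw [← h₅, Category.assoc, h₃, Category.comp_id]
    refine (comp_comp_eq h₆ _).trans (h₂.trans ?_)
    rw [ih]
    rfl

end GenSym

/-! ### Actions of `Sym(T)` -/

section Actions

variable (C : Type u) [Category.{v} C] [MonoidalCategory C] [SymmetricCategory C]
  [HasColimitsOfSize.{0, 0} C] [∀ X : C, PreservesColimitsOfSize.{0, 0} (tensorLeft X)]

/-- The commutative monoid `Sym(T)`. -/
abbrev sph : DayFunctor Sym (DayFunctor Sym C) := symPow (sphereT C)

/-- The object `(p, p)` of `Σ × Σ`. -/
abbrev dg (p : ℕ) : Sym × Sym := (⟨p⟩, ⟨p⟩)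

/-- The morphism `(σ, σ)` of `Σ × Σ`. -/
abbrev dgMap {p q : ℕ} (σ : (⟨p⟩ : Sym) ⟶ ⟨q⟩) : dg p ⟶ dg q := (σ, σ)

/-- The fundamental elements as elements of `Sym(T)`. -/
def bgen (p : ℕ) : 𝟙_ C ⟶ (bi (sph C)).obj (dg p) := gen C p

variable {C}

/-- A permutation of the factors and of the degree together fixes the fundamental element. -/
lemma bgen_map {p q : ℕ} (σ : (⟨p⟩ : Sym) ⟶ ⟨q⟩) :
    bgen C p ≫ (bi (sph C)).map (dgMap σ) = bgen C q :=
  gen_permMap p q σ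

lemma bgen_mul (p q : ℕ) : (λ_ (𝟙_ C)).inv ≫ (bgen C p ⊗ₘ bgen C q) ≫
    bη (sph C) (sph C) (dg p) (dg q) ≫ (biMap (symMul (sphereT C))).app (dg p ⊗ dg q) =
      bgen C (p + q) := by
  have h : dη (sph C) (sph C) ⟨p⟩ ⟨q⟩ ≫ (symMul (sphereT C)).natTrans.app (⟨p⟩ ⊗ ⟨q⟩) =
      cat (sphereT C) p q := dη_tensorDesc _ _ _
  have h' := congrArg (fun t => t.natTrans.app (⟨p⟩ ⊗ ⟨q⟩)) h
  simp only [day_comp_app] at h'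
  refine Eq.trans ?_ (gen_cat p q)
  refine Eq.trans ?_ (congrArg (dmul (gen C p) (gen C q) ≫ ·) h')
  change (λ_ (𝟙_ C)).inv ≫ (gen C p ⊗ₘ gen C q) ≫
    (dη (pw (sphereT C) p) (pw (sphereT C) q) ⟨p⟩ ⟨q⟩ ≫
      (dη (sph C) (sph C) ⟨p⟩ ⟨q⟩).natTrans.app (⟨p⟩ ⊗ ⟨q⟩)) ≫
      ((symMul (sphereT C)).natTrans.app (⟨p⟩ ⊗ ⟨q⟩)).natTrans.app (⟨p⟩ ⊗ ⟨q⟩) =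
    ((λ_ (𝟙_ C)).inv ≫ (gen C p ⊗ₘ gen C q) ≫
      dη (pw (sphereT C) p) (pw (sphereT C) q) ⟨p⟩ ⟨q⟩) ≫ _
  exact (congrArg (fun t => _ ≫ _ ≫ t) (Category.assoc _ _ _)).trans
    ((congrArg (_ ≫ ·) (Category.assoc _ _ _).symm).trans (Category.assoc _ _ _).symm)

lemma bgen_one : bν Sym Sym C ≫ (biMap (symOne (sphereT C))).app (𝟙_ (Sym × Sym)) = bgen C 0 := by
  have h : dayν Sym (DayFunctor Sym C) ≫ (symOne (sphereT C)).natTrans.app (𝟙_ Sym) =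
    𝟙 (𝟙_ (DayFunctor Sym C)) := dν_unitDesc (K := Sym) (F := sph C) _
  have h' := congrArg (fun t => t.natTrans.app (𝟙_ Sym)) h
  simp only [day_comp_app] at h'
  exact (Category.assoc _ _ _).trans ((congrArg (dayν Sym C ≫ ·) h').trans (Category.comp_id _))

/-- The fundamental elements generate `Sym(T)`, also after tensoring with an object. -/
lemma bgen_tensor_hom_ext {x : Sym × Sym} {W Z : C} {f g : (bi (sph C)).obj x ⊗ W ⟶ Z}
    (h : ∀ p (s : dg p ⟶ x), (bgen C p ≫ (bi (sph C)).map s) ▷ W ≫ f =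
      (bgen C p ≫ (bi (sph C)).map s) ▷ W ≫ g) : f = g := by
  obtain ⟨⟨p⟩, z⟩ := x
  apply pw_tensor_hom_ext p z W
  intro s
  have e := bi_map_right (sph C) ⟨p⟩ (a := ⟨p⟩) s
  have := h p (𝟙 _, s)
  rw [e] at this
  exact this

/-- The map `M(x) ⟶ N(p + x)` by which the fundamental element of degree `p` acts under
`f : Sym(T) ⊗ M ⟶ N`. -/
def opr {M N : DayFunctor Sym (DayFunctor Sym C)} (f : sph C ⊗ M ⟶ N) (p : ℕ) (x : Sym × Sym) :
    (bi M).obj x ⟶ (bi N).obj (dg p ⊗ x) :=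
  (λ_ _).inv ≫ bgen C p ▷ (bi M).obj x ≫ bη (sph C) M (dg p) x ≫ (biMap f).app (dg p ⊗ x)

section Opr

variable {M N P : DayFunctor Sym (DayFunctor Sym C)}

lemma bgen_opr (f : sph C ⊗ M ⟶ N) (p : ℕ) (x : Sym × Sym) :
    bgen C p ▷ (bi M).obj x ≫ bη (sph C) M (dg p) x ≫ (biMap f).app (dg p ⊗ x) =
      (λ_ _).hom ≫ opr f p x := by
  unfold opr
  rw [Iso.hom_inv_id_assoc]

/-- Morphisms out of `Sym(T) ⊗ M` are determined by the operations of the fundamental elements. -/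
lemma opr_ext {f g : sph C ⊗ M ⟶ N} (h : ∀ p x, opr f p x = opr g p x) : f = g := by
  apply bi_hom_ext
  intro x y
  apply bgen_tensor_hom_ext
  intro p s
  have e (f : sph C ⊗ M ⟶ N) : (bgen C p ≫ (bi (sph C)).map s) ▷ (bi M).obj y ≫
      bη (sph C) M x y ≫ (biMap f).app (x ⊗ y) =
      ((λ_ _).hom ≫ opr f p y) ≫ (bi N).map (s ▷ y) := by
    rw [← bgen_opr, comp_whiskerRight, Category.assoc]
    refine (congrArg (_ ≫ ·) ((comp_comp_eq (bη_natural_left _ _ s y) _).trans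
      (Category.assoc _ _ _))).trans ?_
    rw [(biMap f).naturality, Category.assoc, Category.assoc]
  rw [e, e, h]

lemma opr_natural (f : sph C ⊗ M ⟶ N) (p : ℕ) {x y : Sym × Sym} (g : x ⟶ y) :
    (bi M).map g ≫ opr f p y = opr f p x ≫ (bi N).map (dg p ◁ g) := by
  unfold opr
  rw [leftUnitor_inv_naturality_assoc, whisker_exchange_assoc, Category.assoc, Category.assoc,
    Category.assoc, ← (biMap f).naturality]
  exact congrArg (fun t => _ ≫ _ ≫ t) ((comp_comp_eq (bη_natural_right _ _ (dg p) g) _).trans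
    (Category.assoc _ _ _))

/-- The operations of the fundamental elements land in the invariants for the diagonal action of
the symmetric group. -/
lemma opr_invariant (f : sph C ⊗ M ⟶ N) {p q : ℕ} (σ : (⟨p⟩ : Sym) ⟶ ⟨q⟩) (x : Sym × Sym) :
    opr f p x ≫ (bi N).map (dgMap σ ▷ x) = opr f q x := by
  unfold opr
  rw [← bgen_map σ, comp_whiskerRight, Category.assoc, Category.assoc, Category.assoc,
    Category.assoc, ← (biMap f).naturality]
  exact congrArg (fun t => _ ≫ _ ≫ t) ((comp_comp_eq (bη_natural_left _ _ (dgMap σ) x) _).trans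
    (Category.assoc _ _ _)).symm

lemma opr_comp (f : sph C ⊗ M ⟶ N) (g : N ⟶ P) (p : ℕ) (x : Sym × Sym) :
    opr (f ≫ g) p x = opr f p x ≫ (biMap g).app (dg p ⊗ x) := by
  unfold opr
  rw [biMap_comp_app]
  simp only [Category.assoc]

lemma opr_whiskerLeft (g : P ⟶ M) (f : sph C ⊗ M ⟶ N) (p : ℕ) (x : Sym × Sym) :
    opr (sph C ◁ g ≫ f) p x = (biMap g).app x ≫ opr f p x := by
  unfold opr
  rw [biMap_comp_app, reassoc_of% bη_whiskerLeft, ← whisker_exchange_assoc,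
    leftUnitor_inv_naturality_assoc]

end Opr

/-- Maps out of `Sym(T) ⊗ M` from invariant families of natural maps `M(x) ⟶ N(p + x)`. -/
lemma exists_opr {M N : DayFunctor Sym (DayFunctor Sym C)}
    (b : ∀ p x, (bi M).obj x ⟶ (bi N).obj (dg p ⊗ x))
    (h₁ : ∀ p {x y : Sym × Sym} (g : x ⟶ y),
      (bi M).map g ≫ b p y = b p x ≫ (bi N).map (dg p ◁ g))
    (h₂ : ∀ {p q : ℕ} (σ : (⟨p⟩ : Sym) ⟶ ⟨q⟩) (x : Sym × Sym),
      b p x ≫ (bi N).map (dgMap σ ▷ x) = b q x) :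
    ∃ f : sph C ⊗ M ⟶ N, ∀ p x, opr f p x = b p x := by
  obtain ⟨c, hc, k₁, k₂, k₃⟩ : ∃ c : ∀ p y a, (M.functor.obj y).functor.obj a ⟶
        (N.functor.obj (⟨p⟩ ⊗ y)).functor.obj (⟨p⟩ ⊗ a), (∀ p y a, c p y a = b p (y, a)) ∧
      (∀ p y {a a' : Sym} (g : a ⟶ a'), (M.functor.obj y).functor.map g ≫ c p y a' =
        c p y a ≫ (N.functor.obj (⟨p⟩ ⊗ y)).functor.map ((⟨p⟩ : Sym) ◁ g)) ∧
      (∀ p {y y' : Sym} (g : y ⟶ y') a, (M.functor.map g).natTrans.app a ≫ c p y' a =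
        c p y a ≫ (N.functor.map ((⟨p⟩ : Sym) ◁ g)).natTrans.app (⟨p⟩ ⊗ a)) ∧
      ∀ {p q} (σ : Fin p ≃ Fin q) y a, c p y a ≫
        (N.functor.map (symHom σ ▷ y)).natTrans.app (⟨p⟩ ⊗ a) ≫
        (N.functor.obj (⟨q⟩ ⊗ y)).functor.map (symHom σ ▷ a) = c q y a := by
    refine ⟨fun p y a => b p (y, a), fun p y a => rfl, fun p y a a' g => ?_, fun p y y' g a => ?_,
      fun σ y a => h₂ σ (y, a)⟩
    · have h := h₁ p (x := (y, a)) (y := (y, a')) (𝟙 y, g)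
      rw [bi_map_right] at h
      refine h.trans (congrArg (_ ≫ ·) ?_)
      refine Eq.trans ?_ (bi_map_right N (⟨p⟩ ⊗ y) ((⟨p⟩ : Sym) ◁ g))
      rw [← whiskerLeft_id]
      rfl
    · have h := h₁ p (x := (y, a)) (y := (y', a)) (g, 𝟙 a)
      rw [bi_map_left] at h
      refine h.trans (congrArg (_ ≫ ·) ?_)
      refine Eq.trans ?_ (bi_map_left N ((⟨p⟩ : Sym) ◁ g) (⟨p⟩ ⊗ a))
      rw [← whiskerLeft_id]
      rfl
  have h₃ (p : ℕ) (y : Sym) : ∃ f : pw (sphereT C) p ⊗ M.functor.obj y ⟶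
      N.functor.obj (⟨p⟩ ⊗ y), ∀ a, gen C p ▷ (M.functor.obj y).functor.obj a ≫
        dη (pw (sphereT C) p) (M.functor.obj y) ⟨p⟩ a ≫ f.natTrans.app (⟨p⟩ ⊗ a) =
          (λ_ _).hom ≫ c p y a :=
    exists_pwDesc p (N := M.functor.obj y) (N' := N.functor.obj (⟨p⟩ ⊗ y)) (c p y) (k₁ p y)
  choose m hm using h₃
  have n₁ {p q : ℕ} (σ : Fin p ≃ Fin q) (y : Sym) :
      permMap (sphereT C) p q σ ▷ M.functor.obj y ≫ m q y =
        m p y ≫ N.functor.map (symHom σ ▷ y) := by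
    apply pw_hom_ext
    intro a
    have e₁ := hm p y a
    have e₂ := hm q y a
    have e₃ := gen_permMap (C := C) p q σ
    have e₄ := dη_whiskerRight (permMap (sphereT C) p q σ) (M.functor.obj y) ⟨p⟩ a
    have e₅ := dη_natural_left (pw (sphereT C) q) (M.functor.obj y) (symHom σ) a
    have e₆ := (m q y).natTrans.naturality (symHom σ ▷ a)
    have : IsIso (symHom σ ▷ a) :=
      inferInstanceAs (IsIso ((Sym.mkIso (X := ⟨p⟩) (Y := ⟨q⟩) σ).hom ▷ a))
    rw [← cancel_mono ((N.functor.obj (⟨q⟩ ⊗ y)).functor.map (symHom σ ▷ a)), day_comp_app,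
      day_comp_app, reassoc_of% e₁, reassoc_of% e₄]
    simp only [Category.assoc]
    rw [k₃, ← e₆, ← reassoc_of% e₅, ← comp_whiskerRight_assoc, ← comp_whiskerRight_assoc,
      Category.assoc, ← e₂, e₃]
  have n₂ (p : ℕ) {y z : Sym} (g : y ⟶ z) : pw (sphereT C) p ◁ M.functor.map g ≫ m p z =
      m p y ≫ N.functor.map ((⟨p⟩ : Sym) ◁ g) := by
    apply pw_hom_ext
    intro a
    have e₁ := hm p y a
    have e₂ := hm p z a
    have e₄ := dη_whiskerLeft (pw (sphereT C) p) (M.functor.map g) ⟨p⟩ a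
    rw [day_comp_app, day_comp_app, reassoc_of% e₁, reassoc_of% e₄, ← whisker_exchange_assoc, e₂,
      leftUnitor_naturality_assoc, k₂]
  refine ⟨dayDesc (F := sph C) (fun x y => m x.n y) (fun σ y => n₁ σ y) (fun x _ _ g => n₂ x.n g),
    fun p x => ?_⟩
  have e := congrArg (fun t => t.natTrans.app (⟨p⟩ ⊗ x.2))
    (dη_dayDesc (F := sph C) (fun x y => m x.n y) (fun σ y => n₁ σ y) (fun x _ _ g => n₂ x.n g)
      ⟨p⟩ x.1)
  simp only [day_comp_app] at e
  rw [← cancel_epi (λ_ _).hom, ← bgen_opr]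
  refine Eq.trans ?_ ((hm p x.1 x.2).trans (congrArg ((λ_ _).hom ≫ ·) (hc p x.1 x.2)))
  exact congrArg (gen C p ▷ _ ≫ ·) ((Category.assoc _ _ _).trans (congrArg (_ ≫ ·) e))

end Actions

/-! ### Modules over `Sym(T)` -/

section Shift

variable {K L : Type} [Category.{0} K] [MonoidalCategory K] [SymmetricCategory K]
  [Category.{0} L] [MonoidalCategory L] [SymmetricCategory L]
  {V : Type u} [Category.{v} V] [MonoidalCategory V] [SymmetricCategory V]
  [HasColimitsOfSize.{0, 0} V] [∀ v : V, PreservesColimitsOfSize.{0, 0} (tensorLeft v)]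

/-- The functor `y ↦ F(x ⊗ y)` of two variables. -/
def bshift (x : K × L) (F : DayFunctor K (DayFunctor L V)) : DayFunctor K (DayFunctor L V) := .mk
  { obj a := shift x.2 (F.functor.obj (x.1 ⊗ a))
    map g := .mk
      { app b := (F.functor.map (x.1 ◁ g)).natTrans.app (x.2 ⊗ b)
        naturality _ _ _ := (F.functor.map (x.1 ◁ g)).natTrans.naturality _ }
    map_id a := by
      apply DayFunctor.hom_ext
      ext b
      rw [whiskerLeft_id]
      have h := congrArg (fun t => t.natTrans.app (x.2 ⊗ b))
        (CategoryTheory.Functor.map_id F.functor (x.1 ⊗ a))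
      exact h
    map_comp g h := by
      apply DayFunctor.hom_ext
      ext b
      rw [whiskerLeft_comp]
      have h' := congrArg (fun t => t.natTrans.app (x.2 ⊗ b))
        (CategoryTheory.Functor.map_comp F.functor (x.1 ◁ g) (x.1 ◁ h))
      exact h' }

lemma bi_unit_tensor_hom_ext {F G : DayFunctor K (DayFunctor L V)} {f g : 𝟙_ _ ⊗ F ⟶ G}
    (h : ∀ y, bν K L V ▷ (bi F).obj y ≫ bη (𝟙_ _) F (𝟙_ (K × L)) y ≫
        (biMap f).app (𝟙_ (K × L) ⊗ y) =
      bν K L V ▷ (bi F).obj y ≫ bη (𝟙_ _) F (𝟙_ (K × L)) y ≫ (biMap g).app (𝟙_ (K × L) ⊗ y)) :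
    f = g := by
  rw [← cancel_epi (λ_ F).inv]
  apply biMap_injective
  intro y
  have k (t : 𝟙_ _ ⊗ F ⟶ G) : (bi F).map (X := y) (Y := 𝟙_ (K × L) ⊗ y) (λ_ y).inv ≫
      (biMap ((λ_ F).inv ≫ t)).app (𝟙_ (K × L) ⊗ y) = (λ_ ((bi F).obj y)).inv ≫
        bν K L V ▷ (bi F).obj y ≫ bη (𝟙_ _) F (𝟙_ (K × L)) y ≫
        (biMap t).app (𝟙_ (K × L) ⊗ y) := by
    have h₁ : bν K L V ▷ (bi F).obj y ≫ bη (𝟙_ _) F (𝟙_ _) y ≫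
        (biMap (λ_ F).hom).app (𝟙_ (K × L) ⊗ y) =
        (λ_ ((bi F).obj y)).hom ≫ (bi F).map (X := y) (Y := 𝟙_ (K × L) ⊗ y) (λ_ y).inv :=
      bν_leftUnitor F y
    have h₂ : (biMap (λ_ F).hom).app (𝟙_ (K × L) ⊗ y) ≫ (biMap (λ_ F).inv).app (𝟙_ (K × L) ⊗ y) =
        𝟙 _ := congrArg (fun t => (biMap t).app (𝟙_ (K × L) ⊗ y)) (λ_ F).hom_inv_id
    rw [Iso.eq_inv_comp, ← reassoc_of% h₁, biMap_comp_app, reassoc_of% h₂]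
  have : IsIso ((bi F).map (X := y) (Y := 𝟙_ (K × L) ⊗ y) (λ_ y).inv) := inferInstance
  have n (t : 𝟙_ _ ⊗ F ⟶ G) : (bi F).map (X := y) (Y := 𝟙_ (K × L) ⊗ y) (λ_ y).inv ≫
      (biMap ((λ_ F).inv ≫ t)).app (𝟙_ (K × L) ⊗ y) =
      (biMap ((λ_ F).inv ≫ t)).app y ≫ (bi G).map (X := y) (Y := 𝟙_ (K × L) ⊗ y) (λ_ y).inv :=
    (biMap ((λ_ F).inv ≫ t)).naturality _
  rw [← cancel_mono ((bi G).map (X := y) (Y := 𝟙_ (K × L) ⊗ y) (λ_ y).inv), ← n, ← n, k, k, h]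

lemma bη_associator_inv (F G H : DayFunctor K (DayFunctor L V)) (x y z : K × L) :
    (bi F).obj x ◁ bη G H y z ≫ bη F (G ⊗ H) x (y ⊗ z) ≫
      (biMap (α_ F G H).inv).app (x ⊗ y ⊗ z) =
    (α_ _ _ _).inv ≫ bη F G x y ▷ (bi H).obj z ≫ bη (F ⊗ G) H (x ⊗ y) z ≫
      (bi ((F ⊗ G) ⊗ H)).map (α_ x y z).hom := by
  have h := bη_associator F G H x y z
  have h₁ : (biMap (α_ F G H).hom).app (x ⊗ y ⊗ z) ≫ (biMap (α_ F G H).inv).app (x ⊗ y ⊗ z) =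
      𝟙 _ := congrArg (fun t => (biMap t).app (x ⊗ y ⊗ z)) (α_ F G H).hom_inv_id
  have h₂ := (biMap (α_ F G H).hom).naturality (α_ x y z).hom
  have h₃ : (bi (F ⊗ G ⊗ H)).map (α_ x y z).inv ≫ (bi (F ⊗ G ⊗ H)).map (α_ x y z).hom = 𝟙 _ := by
    rw [← CategoryTheory.Functor.map_comp, Iso.inv_hom_id, CategoryTheory.Functor.map_id]
  have h₄ : (α_ _ _ _).hom ≫ (bi F).obj x ◁ bη G H y z ≫ bη F (G ⊗ H) x (y ⊗ z) =
      bη F G x y ▷ (bi H).obj z ≫ bη (F ⊗ G) H (x ⊗ y) z ≫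
      (biMap (α_ F G H).hom).app ((x ⊗ y) ⊗ z) ≫ (bi (F ⊗ G ⊗ H)).map (α_ x y z).hom := by
    rw [reassoc_of% h, h₃, Category.comp_id]
  rw [← cancel_epi (α_ _ _ _).hom, Iso.hom_inv_id_assoc, reassoc_of% h₄, ← reassoc_of% h₂, h₁,
    Category.comp_id]

end Shift

section SphModules

variable {C : Type u} [Category.{v} C] [MonoidalCategory C] [SymmetricCategory C]
  [HasColimitsOfSize.{0, 0} C] [∀ X : C, PreservesColimitsOfSize.{0, 0} (tensorLeft X)]

section

variable {M N P : DayFunctor Sym (DayFunctor Sym C)}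

/-- The operations `opr f p` as a morphism `M ⟶ N(p + -)`. -/
def oprHom (f : sph C ⊗ M ⟶ N) (p : ℕ) : M ⟶ bshift (dg p) N :=
  ofBi (G := bshift (dg p) N)
    { app x := opr f p x
      naturality _ _ g := opr_natural f p g }

lemma biMap_oprHom (f : sph C ⊗ M ⟶ N) (p : ℕ) (x : Sym × Sym) :
    (biMap (oprHom f p)).app x = opr f p x := rfl

/-- Morphisms out of `Sym(T) ⊗ (M ⊗ N)` are determined by the operations of the fundamental
elements on products. -/
lemma opr_ext_tensor {f g : sph C ⊗ (M ⊗ N) ⟶ P}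
    (h : ∀ p x y, bη M N x y ≫ opr f p (x ⊗ y) = bη M N x y ≫ opr g p (x ⊗ y)) : f = g := by
  apply opr_ext
  intro p
  have : oprHom f p = oprHom g p := bi_hom_ext (h p)
  intro x
  rw [← biMap_oprHom, this, biMap_oprHom]

/-- Morphisms out of `Sym(T) ⊗ (Sym(T) ⊗ M)` are determined by iterated operations of the
fundamental elements. -/
lemma opr_ext₂ {f g : sph C ⊗ (sph C ⊗ M) ⟶ N}
    (h : ∀ p q x, (λ_ _).inv ≫ bgen C q ▷ (bi M).obj x ≫ bη (sph C) M (dg q) x ≫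
        opr f p (dg q ⊗ x) =
      (λ_ _).inv ≫ bgen C q ▷ (bi M).obj x ≫ bη (sph C) M (dg q) x ≫ opr g p (dg q ⊗ x)) :
    f = g := by
  apply opr_ext
  intro p
  have : oprHom f p = oprHom g p := opr_ext (h p)
  intro x
  rw [← biMap_oprHom, this, biMap_oprHom]

lemma bη_opr_associator (h : (sph C ⊗ M) ⊗ N ⟶ P) (p : ℕ) (x y : Sym × Sym) :
    bη M N x y ≫ opr ((α_ (sph C) M N).inv ≫ h) p (x ⊗ y) =
      ((λ_ _).inv ≫ bgen C p ▷ (bi M).obj x ≫ bη (sph C) M (dg p) x) ▷ (bi N).obj y ≫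
        bη (sph C ⊗ M) N (dg p ⊗ x) y ≫ (biMap h).app ((dg p ⊗ x) ⊗ y) ≫
          (bi P).map (α_ (dg p) x y).hom := by
  unfold opr
  have e := bη_associator_inv (sph C) M N (dg p) x y
  have n := (biMap h).naturality (α_ (dg p) x y).hom
  rw [biMap_comp_app, leftUnitor_inv_naturality_assoc, whisker_exchange_assoc, reassoc_of% e, n]
  simp

lemma bη_opr_whiskerRight (h : sph C ⊗ M ⟶ M) (f : M ⊗ N ⟶ P) (p : ℕ) (x y : Sym × Sym) :
    bη M N x y ≫ opr ((α_ (sph C) M N).inv ≫ h ▷ N ≫ f) p (x ⊗ y) =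
      opr h p x ▷ (bi N).obj y ≫ bη M N (dg p ⊗ x) y ≫ (biMap f).app ((dg p ⊗ x) ⊗ y) ≫
        (bi P).map (α_ (dg p) x y).hom := by
  have e := bη_whiskerRight h N (dg p ⊗ x) y
  rw [bη_opr_associator, biMap_comp_app, Category.assoc, reassoc_of% e,
    ← comp_whiskerRight_assoc]
  simp only [opr, Category.assoc]

end

/-- The operation of the fundamental element of degree `p` on a spectrum. -/
def opn (M : Spectra C) (p : ℕ) (x : Sym × Sym) : (bi M.X).obj x ⟶ (bi M.X).obj (dg p ⊗ x) :=
  opr (act M) p x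

lemma opn_natural (M : Spectra C) (p : ℕ) {x y : Sym × Sym} (g : x ⟶ y) :
    (bi M.X).map g ≫ opn M p y = opn M p x ≫ (bi M.X).map (dg p ◁ g) := opr_natural _ p g

lemma opn_invariant (M : Spectra C) {p q : ℕ} (σ : (⟨p⟩ : Sym) ⟶ ⟨q⟩) (x : Sym × Sym) :
    opn M p x ≫ (bi M.X).map (dgMap σ ▷ x) = opn M q x := opr_invariant _ σ x

lemma opn_hom {M N : Spectra C} (f : M ⟶ N) (p : ℕ) (x : Sym × Sym) :
    opn M p x ≫ (biMap f.hom).app (dg p ⊗ x) = (biMap f.hom).app x ≫ opn N p x := by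
  unfold opn
  rw [← opr_comp, ← opr_whiskerLeft, act_hom]

/-- In terms of operations, the unit axiom of a module says that the fundamental element of degree
`0` acts trivially. -/
lemma one_act_iff {M : DayFunctor Sym (DayFunctor Sym C)} (a : sph C ⊗ M ⟶ M) :
    symOne (sphereT C) ▷ M ≫ a = (λ_ M).hom ↔
      ∀ x, opr a 0 x = (bi M).map (X := x) (Y := dg 0 ⊗ x) (λ_ x).inv := by
  have e (x : Sym × Sym) : bν Sym Sym C ▷ (bi M).obj x ≫ bη (𝟙_ _) M (𝟙_ (Sym × Sym)) x ≫
      (biMap (symOne (sphereT C) ▷ M ≫ a)).app (𝟙_ (Sym × Sym) ⊗ x) = (λ_ _).hom ≫ opr a 0 x := by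
    rw [← bgen_opr, biMap_comp_app, reassoc_of% bη_whiskerRight, ← comp_whiskerRight_assoc,
      bgen_one]
    rfl
  have e' (x : Sym × Sym) : bν Sym Sym C ▷ (bi M).obj x ≫ bη (𝟙_ _) M (𝟙_ (Sym × Sym)) x ≫
      (biMap (λ_ M).hom).app (𝟙_ (Sym × Sym) ⊗ x) = (λ_ _).hom ≫
        (bi M).map (X := x) (Y := dg 0 ⊗ x) (λ_ x).inv := bν_leftUnitor M x
  constructor
  · intro h x
    rw [← cancel_epi (λ_ _).hom, ← e, h, e']
  · intro h
    apply bi_unit_tensor_hom_ext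
    intro x
    rw [e, e', h]

/-- In terms of operations, the associativity axiom of a module says that the fundamental element
of degree `p + q` acts as the composite of those of degrees `q` and `p`. -/
lemma mul_act_iff {M : DayFunctor Sym (DayFunctor Sym C)} (a : sph C ⊗ M ⟶ M) :
    symMul (sphereT C) ▷ M ≫ a = (α_ _ _ _).hom ≫ sph C ◁ a ≫ a ↔
      ∀ p q x, opr a (p + q) x ≫ (bi M).map (X := dg (p + q) ⊗ x) (Y := dg p ⊗ dg q ⊗ x)
        (α_ (dg p) (dg q) x).hom = opr a q x ≫ opr a p (dg q ⊗ x) := by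
  have e (p q : ℕ) (x : Sym × Sym) : (λ_ _).inv ≫ bgen C q ▷ (bi M).obj x ≫
      bη (sph C) M (dg q) x ≫
      opr ((α_ _ _ _).inv ≫ symMul (sphereT C) ▷ M ≫ a) p (dg q ⊗ x) =
      opr a (p + q) x ≫ (bi M).map (X := dg (p + q) ⊗ x) (Y := dg p ⊗ dg q ⊗ x)
        (α_ (dg p) (dg q) x).hom := by
    have h := bη_whiskerRight (symMul (sphereT C)) M (dg p ⊗ dg q) x
    have h' := bgen_mul (C := C) p q
    have h'' : (λ_ (𝟙_ C)).inv ≫ (bgen C p ⊗ₘ bgen C q) = bgen C q ≫ (λ_ _).inv ≫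
        bgen C p ▷ _ := by
      rw [MonoidalCategory.tensorHom_def', leftUnitor_inv_naturality_assoc]
    rw [reassoc_of% h''] at h'
    rw [bη_opr_associator, biMap_comp_app, Category.assoc, reassoc_of% h,
      ← comp_whiskerRight_assoc, ← comp_whiskerRight_assoc, Category.assoc, Category.assoc, Category.assoc, h']
    unfold opr
    simp only [Category.assoc]
    rfl
  have e' (p q : ℕ) (x : Sym × Sym) : (λ_ _).inv ≫ bgen C q ▷ (bi M).obj x ≫
      bη (sph C) M (dg q) x ≫ opr (sph C ◁ a ≫ a) p (dg q ⊗ x) =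
      opr a q x ≫ opr a p (dg q ⊗ x) := by
    rw [opr_whiskerLeft]
    simp only [opr, Category.assoc]
  rw [← Iso.inv_comp_eq]
  constructor
  · intro h p q x
    rw [← e, h, e']
  · intro h
    apply opr_ext₂
    intro p q x
    rw [e, e', h]

lemma opn_zero (M : Spectra C) (x : Sym × Sym) :
    opn M 0 x = (bi M.X).map (X := x) (Y := dg 0 ⊗ x) (λ_ x).inv :=
  (one_act_iff _).1 (one_act M) x

lemma opn_add (M : Spectra C) (p q : ℕ) (x : Sym × Sym) :
    opn M (p + q) x ≫ (bi M.X).map (X := dg (p + q) ⊗ x) (Y := dg p ⊗ dg q ⊗ x)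
      (α_ (dg p) (dg q) x).hom = opn M q x ≫ opn M p (dg q ⊗ x) :=
  (mul_act_iff _).1 (mul_act M) p q x

/-- A morphism that commutes with the operations is a morphism of spectra. -/
lemma exists_hom {M N : Spectra C} (f : M.X ⟶ N.X)
    (h : ∀ p x, opn M p x ≫ (biMap f).app (dg p ⊗ x) = (biMap f).app x ≫ opn N p x) :
    ∃ g : M ⟶ N, g.hom = f := by
  have e : act M ≫ f = sph C ◁ f ≫ act N := by
    apply opr_ext
    intro p x
    rw [opr_comp, opr_whiskerLeft]
    exact h p x
  exact ⟨{ hom := f, isModHom := ⟨e⟩ }, rfl⟩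

/-- In terms of operations, linearity in the first variable says that the pairing commutes with the
fundamental elements acting on the first variable. -/
lemma linL_iff {M N P : Spectra C} (f : M.X ⊗ N.X ⟶ P.X) : LinL M N P f ↔
    ∀ p x y, opn M p x ▷ (bi N.X).obj y ≫ bη M.X N.X (dg p ⊗ x) y ≫
      (biMap f).app ((dg p ⊗ x) ⊗ y) ≫ (bi P.X).map (α_ (dg p) x y).hom =
      bη M.X N.X x y ≫ (biMap f).app (x ⊗ y) ≫ opn P p (x ⊗ y) := by
  have e₁ (p x y) := bη_opr_whiskerRight (act M) f p x y
  have e₂ (p x y) : bη M.X N.X x y ≫ opr (sph C ◁ f ≫ act P) p (x ⊗ y) =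
      bη M.X N.X x y ≫ (biMap f).app (x ⊗ y) ≫ opn P p (x ⊗ y) := by
    rw [opr_whiskerLeft]
    rfl
  unfold LinL
  rw [← Iso.inv_comp_eq]
  constructor
  · intro h p x y
    rw [← e₂, ← h]
    exact (e₁ p x y).symm
  · intro h
    apply opr_ext_tensor
    intro p x y
    rw [e₂, ← h]
    exact e₁ p x y

/-- Construction of spectra from operations. -/
lemma exists_spectrum {M : DayFunctor Sym (DayFunctor Sym C)}
    (b : ∀ p x, (bi M).obj x ⟶ (bi M).obj (dg p ⊗ x))
    (h₁ : ∀ p {x y : Sym × Sym} (g : x ⟶ y),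
      (bi M).map g ≫ b p y = b p x ≫ (bi M).map (dg p ◁ g))
    (h₂ : ∀ {p q : ℕ} (σ : (⟨p⟩ : Sym) ⟶ ⟨q⟩) (x : Sym × Sym),
      b p x ≫ (bi M).map (dgMap σ ▷ x) = b q x)
    (h₃ : ∀ x, b 0 x = (bi M).map (X := x) (Y := dg 0 ⊗ x) (λ_ x).inv)
    (h₄ : ∀ p q x, b (p + q) x ≫ (bi M).map (X := dg (p + q) ⊗ x) (Y := dg p ⊗ dg q ⊗ x)
      (α_ (dg p) (dg q) x).hom = b q x ≫ b p (dg q ⊗ x)) :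
    ∃ m : ModObj (sph C) M, ∀ p x, opn (C := C) { X := M, mod := m } p x = b p x := by
  obtain ⟨a, ha⟩ := exists_opr b h₁ h₂
  refine ⟨{ smul := a, one_smul := ?_, mul_smul := ?_ }, ha⟩
  · exact (one_act_iff a).2 fun x => (ha 0 x).trans (h₃ x)
  · refine (mul_act_iff a).2 fun p q x => ?_
    rw [ha, ha, ha, h₄]

end SphModules

/-! ### Standard morphisms of `J` -/

section StdJ

/-- A morphism of `J` as a morphism of pairs of sets. -/
abbrev jHom {X Y : J} (f : X ⟶ Y) : JHom (Fin X.fst) (Fin X.snd) (Fin Y.fst) (Fin Y.snd) := f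

lemma incl_tensorHom {x y x' y' : Sym × Sym} (f : x ⟶ y) (g : x' ⟶ y') :
    incl.map (f ⊗ₘ g) = incl.map f ⊗ₘ incl.map g :=
  JHom.tensor_eq _ _ _ _ _ _ _ _

lemma incl_whiskerLeft (x : Sym × Sym) {y z : Sym × Sym} (f : y ⟶ z) :
    incl.map (x ◁ f) = incl.obj x ◁ incl.map f := by
  rw [← id_tensorHom, ← id_tensorHom, ← CategoryTheory.Functor.map_id, ← incl_tensorHom]

lemma incl_whiskerRight {y z : Sym × Sym} (f : y ⟶ z) (x : Sym × Sym) :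
    incl.map (f ▷ x) = incl.map f ▷ incl.obj x := by
  rw [← tensorHom_id, ← tensorHom_id, ← CategoryTheory.Functor.map_id, ← incl_tensorHom]

/-- The morphism `(0, 0) ⟶ (p, p)` given by the identity of `{1,…,p}`. -/
def diag (p : ℕ) : 𝟙_ J ⟶ incl.obj (dg p) :=
  show JHom (Fin 0) (Fin 0) (Fin p) (Fin p) from
  { fst := Function.Embedding.ofIsEmpty
    snd := Function.Embedding.ofIsEmpty
    bij := Equiv.refl _ }

lemma diag_bij (p : ℕ) (i : Fin p) (h) : ((jHom (diag p)).bij ⟨i, h⟩).1 = i := rfl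

/-- A morphism `(0, 0) ⟶ (k, l)` is determined by its bijection. -/
lemma jHom_ext_zero {Y : J} {f g : 𝟙_ J ⟶ Y}
    (h : ∀ x hf hg, ((jHom f).bij ⟨x, hf⟩).1 = ((jHom g).bij ⟨x, hg⟩).1) : f = g :=
  JHom.ext' (fun a => a.elim0) (fun b => b.elim0) h

lemma diag_map {p q : ℕ} (σ : (⟨p⟩ : Sym) ⟶ ⟨q⟩) : diag p ≫ incl.map (dgMap σ) = diag q := by
  apply jHom_ext_zero
  intro x hf hg
  refine (JHom.comp_ofEquiv_bij (jHom (diag p)) (σ : Fin p ≃ Fin q)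
    (σ : Fin p ≃ Fin q) x hf ?_).trans ?_
  · rintro ⟨a, _⟩
    exact a.elim0
  · exact Equiv.apply_symm_apply (σ : Fin p ≃ Fin q) x

lemma diag_zero : diag 0 = 𝟙 (𝟙_ J) := by
  apply jHom_ext_zero
  intro x
  exact x.elim0

lemma diag_mul (p q : ℕ) : (λ_ (𝟙_ J)).inv ≫ (diag p ⊗ₘ diag q) = diag (p + q) := by
  apply jHom_ext_zero
  intro x hf hg
  refine Eq.trans ?_ (diag_bij (p + q) x hg).symm
  have hn {A : Type} (f : Fin 0 ↪ A) (a : A) : a ∈ (Set.range f)ᶜ := by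
    rintro ⟨i, _⟩
    exact i.elim0
  have hm {A B : Type} (f : Fin 0 ↪ A) (g : Fin 0 ↪ B) (a : A ⊕ B) :
      a ∈ (Set.range (f.sumMap g))ᶜ := by
    rintro ⟨i | i, _⟩
    · exact i.elim0
    · exact i.elim0
  have hx : x ∈ (Set.range (jHom (diag p ⊗ₘ diag q)).fst)ᶜ := by
    rintro ⟨i, _⟩
    exact i.elim0
  refine (JHom.comp_bij_compl _ (jHom (diag p ⊗ₘ diag q)) x hx hf).trans ?_
  have hy : x ∈ (Set.range (((jHom (diag p)).sum (jHom (diag q))).comp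
      (JHom.ofEquiv finSumFinEquiv finSumFinEquiv)).fst)ᶜ := by
    rintro ⟨i | i, _⟩
    · exact i.elim0
    · exact i.elim0
  refine (JHom.ofEquiv_comp_bij _ _ (((jHom (diag p)).sum (jHom (diag q))).comp
    (JHom.ofEquiv finSumFinEquiv finSumFinEquiv)) x hx hy).trans ?_
  refine (JHom.comp_ofEquiv_bij ((jHom (diag p)).sum (jHom (diag q))) finSumFinEquiv
    finSumFinEquiv x hy (hm _ _ _)).trans ?_
  obtain ⟨y, rfl⟩ := finSumFinEquiv.surjective x
  rw [JHom.bij_congr _ (Equiv.symm_apply_apply finSumFinEquiv y) (hm _ _ _) (hm _ _ _)]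
  congr 1
  obtain y | y := y
  · exact JHom.sum_bij_inl _ _ _ (hn _ _) _
  · exact JHom.sum_bij_inr _ _ _ (hn _ _) _

/-- The standard morphism `(m, n) ⟶ (p + m, p + n)`, the two inclusions of the last points with the
identity of `{1,…,p}`. -/
def std (p : ℕ) (x : Sym × Sym) : incl.obj x ⟶ incl.obj (dg p ⊗ x) :=
  (λ_ (incl.obj x)).inv ≫ diag p ▷ incl.obj x

lemma std_natural (p : ℕ) {x y : Sym × Sym} (g : x ⟶ y) :
    incl.map g ≫ std p y = std p x ≫ incl.map (dg p ◁ g) := by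
  have h := whisker_exchange (diag p) (incl.map g)
  have h' := leftUnitor_inv_naturality (incl.map g)
  have e : incl.map (dg p ◁ g) = incl.obj (dg p) ◁ incl.map g := incl_whiskerLeft _ _
  change _ ≫ (λ_ (incl.obj y)).inv ≫ diag p ▷ incl.obj y =
    ((λ_ (incl.obj x)).inv ≫ diag p ▷ incl.obj x) ≫ incl.map (dg p ◁ g)
  rw [e]
  refine (comp_comp_eq h' _).trans ((Category.assoc _ _ _).trans ?_)
  exact (congrArg (_ ≫ ·) h).trans (Category.assoc _ _ _).symm

lemma std_invariant {p q : ℕ} (σ : (⟨p⟩ : Sym) ⟶ ⟨q⟩) (x : Sym × Sym) :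
    std p x ≫ incl.map (dgMap σ ▷ x) = std q x := by
  have e : incl.map (dgMap σ ▷ x) = incl.map (dgMap σ) ▷ incl.obj x := incl_whiskerRight _ _
  rw [e]
  refine (Category.assoc _ _ _).trans (congrArg (_ ≫ ·) ?_)
  refine (comp_whiskerRight (diag p) (incl.map (dgMap σ)) _).symm.trans ?_
  rw [diag_map]

lemma std_zero (x : Sym × Sym) : std 0 x = incl.map (X := x) (Y := dg 0 ⊗ x) (λ_ x).inv := by
  unfold std
  rw [diag_zero]
  exact (congrArg (_ ≫ ·) (id_whiskerRight _ _)).trans (Category.comp_id _)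

lemma unit_tensor_whiskerRight {K : Type} [Category.{0} K] [MonoidalCategory K] {a b : K}
    (f : 𝟙_ K ⟶ a) (g : 𝟙_ K ⟶ b) (x : K) :
    ((λ_ x).inv ≫ ((λ_ (𝟙_ K)).inv ≫ (f ⊗ₘ g)) ▷ x) ≫ (α_ a b x).hom =
      ((λ_ x).inv ≫ g ▷ x) ≫ (λ_ (b ⊗ x)).inv ≫ f ▷ (b ⊗ x) := by
  rw [MonoidalCategory.tensorHom_def', leftUnitor_inv_naturality_assoc]
  simp only [comp_whiskerRight, Category.assoc, associator_naturality_left]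
  simp

/-- The standard morphisms compose as the operations of the fundamental elements of a spectrum do. -/
lemma std_add (p q : ℕ) (x : Sym × Sym) :
    std (p + q) x ≫ incl.map (X := dg (p + q) ⊗ x) (Y := dg p ⊗ dg q ⊗ x)
      (α_ (dg p) (dg q) x).hom = std q x ≫ std p (dg q ⊗ x) := by
  have h := unit_tensor_whiskerRight (diag p) (diag q) (incl.obj x)
  rw [diag_mul] at h
  exact h

lemma std_fst (p : ℕ) (x : Sym × Sym) (i : Fin x.1.n) :
    (jHom (std p x)).fst i = Fin.natAdd p i := by
  have : (finCongr (Nat.zero_add x.1.n)).symm i = finSumFinEquiv (Sum.inr i : Fin 0 ⊕ _) := by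
    ext; simp
  change finSumFinEquiv (((jHom (diag p)).sum (JHom.ofEquiv (Equiv.refl _) (Equiv.refl _))).fst
    (finSumFinEquiv.symm ((finCongr (Nat.zero_add x.1.n)).symm i))) = _
  rw [this]
  exact congrArg (fun t => finSumFinEquiv (((jHom (diag p)).sum (JHom.ofEquiv (Equiv.refl _)
    (Equiv.refl _))).fst t)) (Equiv.symm_apply_apply _ _)

lemma std_snd (p : ℕ) (x : Sym × Sym) (i : Fin x.2.n) :
    (jHom (std p x)).snd i = Fin.natAdd p i := by
  have : (finCongr (Nat.zero_add x.2.n)).symm i = finSumFinEquiv (Sum.inr i : Fin 0 ⊕ _) := by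
    ext; simp
  change finSumFinEquiv (((jHom (diag p)).sum (JHom.ofEquiv (Equiv.refl _) (Equiv.refl _))).snd
    (finSumFinEquiv.symm ((finCongr (Nat.zero_add x.2.n)).symm i))) = _
  rw [this]
  exact congrArg (fun t => finSumFinEquiv (((jHom (diag p)).sum (JHom.ofEquiv (Equiv.refl _)
    (Equiv.refl _))).snd t)) (Equiv.symm_apply_apply _ _)

lemma natAdd_ne_castAdd {p m : ℕ} (i : Fin p) (j : Fin m) : Fin.natAdd p j ≠ Fin.castAdd m i := by
  intro h
  have := congrArg Fin.val h
  have := i.isLt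
  simp only [Fin.val_natAdd, Fin.val_castAdd] at *
  omega

lemma castAdd_mem_compl (p : ℕ) (x : Sym × Sym) (i : Fin p) :
    (Fin.castAdd x.1.n i : Fin (p + x.1.n)) ∈ (Set.range (jHom (std p x)).fst)ᶜ := by
  rintro ⟨a, ha⟩
  exact natAdd_ne_castAdd i a ((std_fst p x a).symm.trans ha)

/-- The bijection of complements of a standard morphism is the identity of `{1,…,p}`. -/
lemma std_bij (p : ℕ) (x : Sym × Sym) (i : Fin p) (h) :
    ((jHom (std p x)).bij ⟨Fin.castAdd x.1.n i, h⟩).1 = Fin.castAdd x.2.n i := by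
  let d : JHom (Fin 0 ⊕ Fin x.1.n) (Fin 0 ⊕ Fin x.2.n) (Fin p ⊕ Fin x.1.n) (Fin p ⊕ Fin x.2.n) :=
    (jHom (diag p)).sum (JHom.ofEquiv (Equiv.refl _) (Equiv.refl _))
  have h₀ : (Sum.inl i : Fin p ⊕ Fin x.1.n) ∈ (Set.range d.fst)ᶜ := by
    rintro ⟨a | a, ha⟩
    · exact a.elim0
    · exact absurd (ha : (Sum.inr a : Fin p ⊕ Fin x.1.n) = Sum.inl i) Sum.inr_ne_inl
  have h₁ : (Fin.castAdd x.1.n i : Fin (p + x.1.n)) ∈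
      (Set.range (d.comp (JHom.ofEquiv finSumFinEquiv finSumFinEquiv)).fst)ᶜ := by
    rintro ⟨a, ha⟩
    exact h₀ ⟨a, finSumFinEquiv.injective ha⟩
  have h₂ : (Fin.castAdd x.1.n i : Fin (p + x.1.n)) ∈
      (Set.range (jHom (diag p ▷ incl.obj x)).fst)ᶜ := by
    rintro ⟨a, ha⟩
    exact h₁ ⟨_, ha⟩
  refine (JHom.comp_bij_compl _ (jHom (diag p ▷ incl.obj x)) _ h₂ h).trans ?_
  refine (JHom.ofEquiv_comp_bij _ _ (d.comp (JHom.ofEquiv finSumFinEquiv finSumFinEquiv)) _ h₂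
    h₁).trans ?_
  have h₃ : finSumFinEquiv.symm (Fin.castAdd x.1.n i) ∈ (Set.range d.fst)ᶜ := by
    rw [finSumFinEquiv_symm_apply_castAdd]
    exact h₀
  refine (JHom.comp_ofEquiv_bij d finSumFinEquiv finSumFinEquiv _ h₁ h₃).trans ?_
  rw [JHom.bij_congr d (finSumFinEquiv_symm_apply_castAdd i) h₃ h₀]
  refine (congrArg finSumFinEquiv (JHom.sum_bij_inl (jHom (diag p)) _ i ?_ h₀)).trans ?_
  · rintro ⟨a, _⟩
    exact a.elim0
  · rw [diag_bij]
    exact finSumFinEquiv_apply_left _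

/-- Every morphism of `J` is a standard morphism followed by a pair of bijections. -/
lemma exists_std {x y : Sym × Sym} (f : incl.obj x ⟶ incl.obj y) :
    ∃ (p : ℕ) (s : dg p ⊗ x ⟶ y), f = std p x ≫ incl.map s := by
  classical
  obtain ⟨⟨m⟩, ⟨n⟩⟩ := x
  obtain ⟨⟨k⟩, ⟨l⟩⟩ := y
  obtain ⟨φ, hφ⟩ : ∃ φ : JHom (Fin m) (Fin n) (Fin k) (Fin l), φ = f := ⟨f, rfl⟩
  let e : ↥(Set.range φ.fst)ᶜ ≃ Fin (Fintype.card ↥(Set.range φ.fst)ᶜ) := Fintype.equivFin _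
  let s₁ : Fin (Fintype.card ↥(Set.range φ.fst)ᶜ + m) ≃ Fin k :=
    finSumFinEquiv.symm.trans ((e.symm.sumCongr (Equiv.ofInjective _ φ.fst.injective)).trans
      ((Equiv.sumComm _ _).trans (Equiv.Set.sumCompl (Set.range φ.fst))))
  let s₂ : Fin (Fintype.card ↥(Set.range φ.fst)ᶜ + n) ≃ Fin l :=
    finSumFinEquiv.symm.trans (((e.symm.trans φ.bij).sumCongr
      (Equiv.ofInjective _ φ.snd.injective)).trans
      ((Equiv.sumComm _ _).trans (Equiv.Set.sumCompl (Set.range φ.snd))))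
  have h₁ (i : Fin m) : s₁ (Fin.natAdd _ i) = φ.fst i := by simp [s₁]
  have h₁' (i) : s₁ (Fin.castAdd _ i) = (e.symm i).1 := by simp [s₁]
  have h₂ (i : Fin n) : s₂ (Fin.natAdd _ i) = φ.snd i := by simp [s₂]
  have h₂' (i) : s₂ (Fin.castAdd _ i) = (φ.bij (e.symm i)).1 := by simp [s₂]
  refine ⟨_, (s₁, s₂), ?_⟩
  rw [← hφ]
  refine JHom.ext' (fun i => ?_) (fun i => ?_) (fun i hi hi' => ?_)
  · exact (h₁ i).symm.trans (congrArg s₁ (std_fst _ (⟨m⟩, ⟨n⟩) i).symm)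
  · exact (h₂ i).symm.trans (congrArg s₂ (std_snd _ (⟨m⟩, ⟨n⟩) i).symm)
  · have hc : s₁.symm i = Fin.castAdd _ (e ⟨i, hi⟩) := by
      rw [Equiv.symm_apply_eq, h₁', Equiv.symm_apply_apply]
    have hm := castAdd_mem_compl _ (⟨m⟩, ⟨n⟩) (e ⟨i, hi⟩)
    have hm' : s₁.symm i ∈ (Set.range (jHom (std _ (⟨m⟩, ⟨n⟩))).fst)ᶜ := by rw [hc]; exact hm
    have h := JHom.comp_ofEquiv_bij (jHom (std _ (⟨m⟩, ⟨n⟩))) s₁ s₂ i hi' hm'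
    refine Eq.trans ?_ h.symm
    have h' := (JHom.bij_congr (jHom (std _ (⟨m⟩, ⟨n⟩))) hc hm' hm).trans
      (std_bij _ (⟨m⟩, ⟨n⟩) (e ⟨i, hi⟩) hm)
    refine Eq.trans ?_ (congrArg s₂ h').symm
    refine Eq.trans ?_ (h₂' _).symm
    rw [Equiv.symm_apply_apply]

/-- The factorization of a morphism of `J` is unique up to a permutation of the complement. -/
lemma std_unique {p q : ℕ} {x y : Sym × Sym} {s : dg p ⊗ x ⟶ y} {t : dg q ⊗ x ⟶ y}
    (h : std p x ≫ incl.map s = std q x ≫ incl.map t) :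
    ∃ σ : (⟨p⟩ : Sym) ⟶ ⟨q⟩, s = dgMap σ ▷ x ≫ t := by
  obtain ⟨⟨m⟩, ⟨n⟩⟩ := x
  obtain ⟨⟨k⟩, ⟨l⟩⟩ := y
  obtain ⟨s₁, s₂⟩ := s
  obtain ⟨t₁, t₂⟩ := t
  change Fin (p + m) ≃ Fin k at s₁
  change Fin (p + n) ≃ Fin l at s₂
  change Fin (q + m) ≃ Fin k at t₁
  change Fin (q + n) ≃ Fin l at t₂
  obtain rfl : p = q := by
    have := (Fin.equiv_iff_eq.1 ⟨s₁⟩).trans (Fin.equiv_iff_eq.1 ⟨t₁⟩).symm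
    omega
  have e₁ (i : Fin m) : s₁ (Fin.natAdd p i) = t₁ (Fin.natAdd p i) :=
    (congrArg s₁ (std_fst p (⟨m⟩, ⟨n⟩) i)).symm.trans
      ((DFunLike.congr_fun (congrArg (fun f => (jHom f).fst) h) i).trans
        (congrArg t₁ (std_fst p (⟨m⟩, ⟨n⟩) i)))
  have e₂ (i : Fin n) : s₂ (Fin.natAdd p i) = t₂ (Fin.natAdd p i) :=
    (congrArg s₂ (std_snd p (⟨m⟩, ⟨n⟩) i)).symm.trans
      ((DFunLike.congr_fun (congrArg (fun f => (jHom f).snd) h) i).trans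
        (congrArg t₂ (std_snd p (⟨m⟩, ⟨n⟩) i)))
  have e₃ (i : Fin p) : ∃ j : Fin p, t₁.symm (s₁ (Fin.castAdd m i)) = Fin.castAdd m j := by
    obtain ⟨j, hj⟩ : ∃ j, t₁.symm (s₁ (Fin.castAdd m i)) = j := ⟨_, rfl⟩
    cases j using Fin.addCases with
    | left j => exact ⟨j, hj⟩
    | right j =>
      rw [Equiv.symm_apply_eq, ← e₁] at hj
      exact absurd (s₁.injective hj).symm (natAdd_ne_castAdd i j)
  choose σ hσ using e₃
  have hb : Function.Bijective σ := by
    refine Finite.injective_iff_bijective.1 fun i j hij => ?_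
    have := (hσ i).trans ((congrArg _ hij).trans (hσ j).symm)
    have := s₁.injective (t₁.symm.injective this)
    exact Fin.castAdd_injective _ _ this
  have hσ₁ (i : Fin p) : s₁ (Fin.castAdd m i) = t₁ (Fin.castAdd m (σ i)) := by
    rw [← hσ, Equiv.apply_symm_apply]
  have hσ₂ (i : Fin p) : s₂ (Fin.castAdd n i) = t₂ (Fin.castAdd n (σ i)) := by
    have m₁ := castAdd_mem_compl p (⟨m⟩, ⟨n⟩) i
    have m₂ := castAdd_mem_compl p (⟨m⟩, ⟨n⟩) (σ i)
    have m₃ : s₁ (Fin.castAdd m i) ∈ (Set.range ((jHom (std p (⟨m⟩, ⟨n⟩))).comp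
        (JHom.ofEquiv s₁ s₂)).fst)ᶜ := by
      rintro ⟨a, ha⟩
      exact m₁ ⟨a, s₁.injective ha⟩
    have m₄ : t₁ (Fin.castAdd m (σ i)) ∈ (Set.range ((jHom (std p (⟨m⟩, ⟨n⟩))).comp
        (JHom.ofEquiv t₁ t₂)).fst)ᶜ := by
      rintro ⟨a, ha⟩
      exact m₂ ⟨a, t₁.injective ha⟩
    have b₁ := JHom.comp_bij_map (jHom (std p (⟨m⟩, ⟨n⟩))) (JHom.ofEquiv s₁ s₂) _ m₁ m₃
    have b₂ := JHom.comp_bij_map (jHom (std p (⟨m⟩, ⟨n⟩))) (JHom.ofEquiv t₁ t₂) _ m₂ m₄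
    have c₁ := std_bij p (⟨m⟩, ⟨n⟩) i m₁
    have c₂ := std_bij p (⟨m⟩, ⟨n⟩) (σ i) m₂
    have h' : (jHom (std p (⟨m⟩, ⟨n⟩))).comp (JHom.ofEquiv s₁ s₂) =
      (jHom (std p (⟨m⟩, ⟨n⟩))).comp (JHom.ofEquiv t₁ t₂) := h
    have b₃ : ((((jHom (std p (⟨m⟩, ⟨n⟩))).comp (JHom.ofEquiv s₁ s₂))).bij ⟨_, m₃⟩).1 =
        ((((jHom (std p (⟨m⟩, ⟨n⟩))).comp (JHom.ofEquiv t₁ t₂))).bij ⟨_, m₄⟩).1 := by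
      have aux {f g : JHom (Fin m) (Fin n) (Fin k) (Fin l)} (hfg : f = g) {a b : Fin k}
          (hab : a = b) (ha hb) : (f.bij ⟨a, ha⟩).1 = (g.bij ⟨b, hb⟩).1 := by
        subst hfg hab
        rfl
      exact aux h' (hσ₁ i) m₃ m₄
    exact (congrArg s₂ c₁).symm.trans (b₁.symm.trans (b₃.trans (b₂.trans (congrArg t₂ c₂))))
  let σ' : Fin p ≃ Fin p := Equiv.ofBijective σ hb
  have r₁ : s₁ = (Sym.blockSum σ' (Equiv.refl (Fin m))).trans t₁ := by
    refine Equiv.ext fun i => ?_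
    rw [Equiv.trans_apply]
    cases i using Fin.addCases with
    | left i => rw [blockSum_castAdd, hσ₁]; rfl
    | right i => rw [blockSum_natAdd, e₁]; rfl
  have r₂ : s₂ = (Sym.blockSum σ' (Equiv.refl (Fin n))).trans t₂ := by
    refine Equiv.ext fun i => ?_
    rw [Equiv.trans_apply]
    cases i using Fin.addCases with
    | left i => rw [blockSum_castAdd, hσ₂]; rfl
    | right i => rw [blockSum_natAdd, e₂]; rfl
  exact ⟨σ', Prod.ext r₁ r₂⟩

/-- The standard map of the statement adds the new points at the end, `std` adds them at the front;
the shuffles relate the two. -/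
lemma std_one_shuffle (i n : ℕ) : std 1 (⟨i⟩, ⟨n⟩) ≫
    incl.map (X := dg 1 ⊗ (⟨i⟩, ⟨n⟩)) (Y := (⟨i⟩, ⟨n⟩) ⊗ dg 1)
      ((β_ (⟨1⟩ : Sym) ⟨i⟩).hom, (β_ (⟨1⟩ : Sym) ⟨n⟩).hom) = stdMap i n := by
  have hs (i : ℕ) (j : Fin i) : shuffle 1 i (Fin.natAdd 1 j) = j.castSucc := by
    ext
    rw [val_shuffle]
    simp
  have hs' (i : ℕ) (j : Fin 1) : shuffle 1 i (Fin.castAdd i j) = Fin.last i := by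
    ext
    rw [val_shuffle]
    simp
  refine JHom.ext' (fun j => ?_) (fun j => ?_) (fun j hj hj' => ?_)
  · exact (congrArg (shuffle 1 i) (std_fst 1 (⟨i⟩, ⟨n⟩) j)).trans (hs i j)
  · exact (congrArg (shuffle 1 n) (std_snd 1 (⟨i⟩, ⟨n⟩) j)).trans (hs n j)
  · change Fin (i + 1) at j
    cases j using Fin.lastCases with
    | cast j => exact absurd ⟨j, rfl⟩ hj'
    | last =>
      have hm := castAdd_mem_compl 1 (⟨i⟩, ⟨n⟩) 0
      have e : (shuffle 1 i).symm (Fin.last i) = Fin.castAdd i 0 := by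
        rw [Equiv.symm_apply_eq, hs']
      have hm' : (shuffle 1 i).symm (Fin.last i) ∈
          (Set.range (jHom (std 1 (⟨i⟩, ⟨n⟩))).fst)ᶜ := by rw [e]; exact hm
      have h := JHom.comp_ofEquiv_bij (jHom (std 1 (⟨i⟩, ⟨n⟩))) (shuffle 1 i) (shuffle 1 n)
        (Fin.last i) hj hm'
      refine h.trans ((congrArg (shuffle 1 n) ((JHom.bij_congr (jHom (std 1 (⟨i⟩, ⟨n⟩))) e hm'
        hm).trans (std_bij 1 (⟨i⟩, ⟨n⟩) 0 hm))).trans ?_)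
      exact hs' n 0

end StdJ

/-! ### The equivalence of categories -/

section Equivalence

variable {C : Type u} [Category.{v} C] [MonoidalCategory C] [SymmetricCategory C]
  [HasColimitsOfSize.{0, 0} C] [∀ X : C, PreservesColimitsOfSize.{0, 0} (tensorLeft X)]

lemma bi_jStar_map (X : DayFunctor J C) {x y : Sym × Sym} (f : x ⟶ y) :
    (bi ((jStar C).obj X)).map f = X.functor.map (incl.map f) := by
  refine (CategoryTheory.Functor.map_comp X.functor _ _).symm.trans ?_
  rw [← CategoryTheory.Functor.map_comp]
  congr 2

lemma exists_specOf (X : DayFunctor J C) : ∃ m : ModObj (sph C) ((jStar C).obj X), ∀ p x,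
    opn (C := C) { X := (jStar C).obj X, mod := m } p x = X.functor.map (std p x) := by
  apply exists_spectrum
  · intro p x y g
    rw [bi_jStar_map, bi_jStar_map]
    refine (CategoryTheory.Functor.map_comp X.functor _ _).symm.trans ?_
    rw [std_natural]
    exact CategoryTheory.Functor.map_comp X.functor _ _
  · intro p q σ x
    rw [bi_jStar_map, ← std_invariant σ x]
    exact (CategoryTheory.Functor.map_comp X.functor _ _).symm
  · intro x
    rw [bi_jStar_map, std_zero]
  · intro p q x
    rw [bi_jStar_map]
    refine (CategoryTheory.Functor.map_comp X.functor _ _).symm.trans ?_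
    rw [std_add]
    exact CategoryTheory.Functor.map_comp X.functor _ _

/-- The symmetric spectrum of a functor `X : J ⥤ C`: the restriction of `X` to `Σ × Σ`, on which
the fundamental elements act through the standard morphisms of `J`. -/
def specOf (X : DayFunctor J C) : Spectra C where
  X := (jStar C).obj X
  mod := (exists_specOf X).choose

/-- The fundamental elements act on the spectrum of `X` through the standard morphisms. -/
lemma opn_specOf (X : DayFunctor J C) (p : ℕ) (x : Sym × Sym) :
    opn (specOf X) p x = X.functor.map (std p x) :=
  (exists_specOf X).choose_spec p x

lemma exists_specMap {X Y : DayFunctor J C} (φ : X ⟶ Y) :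
    ∃ g : specOf X ⟶ specOf Y, g.hom = (jStar C).map φ :=
  exists_hom _ fun p x => by
    rw [opn_specOf, opn_specOf]
    exact φ.natTrans.naturality _

/-- The morphism of spectra given by a natural transformation. -/
def specMap {X Y : DayFunctor J C} (φ : X ⟶ Y) : specOf X ⟶ specOf Y := (exists_specMap φ).choose

lemma specMap_hom {X Y : DayFunctor J C} (φ : X ⟶ Y) : (specMap φ).hom = (jStar C).map φ :=
  (exists_specMap φ).choose_spec

lemma biMap_specMap {X Y : DayFunctor J C} (φ : X ⟶ Y) (x : Sym × Sym) :
    (biMap (specMap φ).hom).app x = φ.natTrans.app (incl.obj x) := by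
  rw [specMap_hom]
  rfl

variable (C) in
/-- The functor from `C^J` to symmetric spectra. -/
def toSpectra : DayFunctor J C ⥤ Spectra C where
  obj := specOf
  map := specMap
  map_id X := by
    apply Mod.hom_ext
    rw [specMap_hom, CategoryTheory.Functor.map_id]
    rfl
  map_comp φ ψ := by
    apply Mod.hom_ext
    rw [Mod.comp_hom', specMap_hom, specMap_hom, specMap_hom, CategoryTheory.Functor.map_comp]
    rfl

/-- A transformation that is natural for pairs of bijections and for the standard morphisms is
natural. -/
lemma exists_natTrans {V : Type u} [Category.{v} V] {F G : J ⥤ V}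
    (φ : ∀ x : Sym × Sym, F.obj (incl.obj x) ⟶ G.obj (incl.obj x))
    (h₁ : ∀ {x y : Sym × Sym} (f : x ⟶ y),
      F.map (incl.map f) ≫ φ y = φ x ≫ G.map (incl.map f))
    (h₂ : ∀ p x, F.map (std p x) ≫ φ (dg p ⊗ x) = φ x ≫ G.map (std p x)) :
    ∃ τ : F ⟶ G, ∀ x, τ.app (incl.obj x) = φ x := by
  refine ⟨{ app j := φ (⟨j.fst⟩, ⟨j.snd⟩), naturality := ?_ }, fun x => rfl⟩
  intro j k f
  obtain ⟨p, s, hs⟩ := exists_std (x := (⟨j.fst⟩, ⟨j.snd⟩)) (y := (⟨k.fst⟩, ⟨k.snd⟩)) f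
  obtain rfl : f = std p (⟨j.fst⟩, ⟨j.snd⟩) ≫ incl.map s := hs
  have e₁ := h₁ s
  have e₂ := h₂ p (⟨j.fst⟩, ⟨j.snd⟩)
  have m₁ := CategoryTheory.Functor.map_comp F (std p (⟨j.fst⟩, ⟨j.snd⟩)) (incl.map s)
  have m₂ := CategoryTheory.Functor.map_comp G (std p (⟨j.fst⟩, ⟨j.snd⟩)) (incl.map s)
  refine (congrArg (· ≫ _) m₁).trans (Eq.trans ?_ (congrArg (_ ≫ ·) m₂).symm)
  refine (Category.assoc _ _ _).trans ((congrArg (_ ≫ ·) e₁).trans ?_)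
  exact (comp_comp_eq e₂ _).trans (Category.assoc _ _ _)

instance : (toSpectra C).Faithful where
  map_injective {X Y} φ ψ h := by
    apply DayFunctor.hom_ext
    ext ⟨m, n⟩
    have e := biMap_specMap φ (⟨m⟩, ⟨n⟩)
    have e' := biMap_specMap ψ (⟨m⟩, ⟨n⟩)
    have h' : specMap φ = specMap ψ := h
    rw [← h'] at e'
    exact e.symm.trans e'

instance : (toSpectra C).Full where
  map_surjective {X Y} f := by
    obtain ⟨τ, hτ⟩ := exists_natTrans (F := X.functor) (G := Y.functor)
      (fun x => (biMap f.hom).app x)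
      (fun {x y} g => by
        have h := (biMap f.hom).naturality g
        have e₁ : (bi (specOf X).X).map g = X.functor.map (incl.map g) := bi_jStar_map X g
        have e₂ : (bi (specOf Y).X).map g = Y.functor.map (incl.map g) := bi_jStar_map Y g
        rw [← e₁, ← e₂]
        exact h)
      (fun p x => by
        have h : opn (specOf X) p x ≫ (biMap f.hom).app (dg p ⊗ x) =
          (biMap f.hom).app x ≫ opn (specOf Y) p x := opn_hom f p x
        rw [opn_specOf, opn_specOf] at h
        exact h)
    refine ⟨.mk τ, ?_⟩
    apply Mod.hom_ext
    apply biMap_injective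
    intro x
    exact (biMap_specMap _ x).trans (hτ x)

section EssSurj

variable (M : Spectra C)

/-- The map `M(x) ⟶ M(y)` given by a morphism `x ⟶ y` of `J`: it does not depend on the factorization
of the morphism. -/
lemma exists_jMap {x y : Sym × Sym} (f : incl.obj x ⟶ incl.obj y) :
    ∃ g : (bi M.X).obj x ⟶ (bi M.X).obj y, ∀ p (s : dg p ⊗ x ⟶ y), f = std p x ≫ incl.map s →
      g = opn M p x ≫ (bi M.X).map s := by
  obtain ⟨p, s, hs⟩ := exists_std f
  -- Another factorization of `f` differs by a permutation, under which the operations are invariant.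
  refine ⟨opn M p x ≫ (bi M.X).map s, fun q t ht => ?_⟩
  obtain ⟨σ, rfl⟩ := std_unique (hs.symm.trans ht)
  rw [← opn_invariant M σ x, CategoryTheory.Functor.map_comp, Category.assoc]

/-- The functor `J ⥤ C` of a symmetric spectrum. -/
lemma exists_functor : ∃ (X : DayFunctor J C) (u : ∀ x, X.functor.obj (incl.obj x) ≅ (bi M.X).obj x),
    ∀ {x y : Sym × Sym} p (s : dg p ⊗ x ⟶ y), X.functor.map (std p x ≫ incl.map s) ≫ (u y).hom =
      (u x).hom ≫ opn M p x ≫ (bi M.X).map s := by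
  choose g hg using fun (x y : Sym × Sym) (f : incl.obj x ⟶ incl.obj y) => exists_jMap M f
  let o (j : J) : Sym × Sym := (⟨j.fst⟩, ⟨j.snd⟩)
  have hid (x : Sym × Sym) : g x x (𝟙 _) = 𝟙 _ := by
    refine (hg x x (𝟙 _) 0 (λ_ x).hom ?_).trans ?_
    · rw [std_zero]
      refine Eq.trans ?_ (CategoryTheory.Functor.map_comp incl (λ_ x).inv (λ_ x).hom)
      rw [Iso.inv_hom_id, CategoryTheory.Functor.map_id]
    · rw [opn_zero]
      refine (CategoryTheory.Functor.map_comp (bi M.X) (λ_ x).inv (λ_ x).hom).symm.trans ?_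
      rw [Iso.inv_hom_id, CategoryTheory.Functor.map_id]
  have hcomp (x y z : Sym × Sym) (f : incl.obj x ⟶ incl.obj y) (f' : incl.obj y ⟶ incl.obj z) :
      g x z (f ≫ f') = g x y f ≫ g y z f' := by
    obtain ⟨p, s, hs⟩ := exists_std f
    obtain ⟨q, t, ht⟩ := exists_std f'
    rw [hg _ _ f p s hs, hg _ _ f' q t ht]
    refine (hg _ _ (f ≫ f') (q + p) ((α_ (dg q) (dg p) x).hom ≫ dg q ◁ s ≫ t) ?_).trans ?_
    · have e := std_natural q s
      have e' := std_add q p x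
      refine (congrArg₂ (· ≫ ·) hs ht).trans ?_
      refine (Category.assoc _ _ _).trans ((congrArg (_ ≫ ·) (comp_comp_eq e _)).trans ?_)
      rw [CategoryTheory.Functor.map_comp, CategoryTheory.Functor.map_comp, Category.assoc]
      exact ((comp_comp_eq e' _).trans (Category.assoc _ _ _)).symm
    · have e := opn_natural M q s
      have e' := opn_add M q p x
      rw [CategoryTheory.Functor.map_comp, CategoryTheory.Functor.map_comp, reassoc_of% e',
        Category.assoc, reassoc_of% e]
  exact ⟨.mk
    { obj j := (bi M.X).obj (o j)
      map {j k} f := g (o j) (o k) f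
      map_id j := hid (o j)
      map_comp {i j k} f f' := hcomp (o i) (o j) (o k) f f' }, fun x => Iso.refl _,
    fun {x y} p s => (Category.comp_id _).trans ((hg x y _ p s rfl).trans (Category.id_comp _).symm)⟩

end EssSurj

lemma comm_inv {V : Type u} [Category.{v} V] {a b c d : V} {f : a ⟶ b} {g : c ⟶ d} (i : a ≅ c)
    (j : b ≅ d) (h : f ≫ j.hom = i.hom ≫ g) : g ≫ j.inv = i.inv ≫ f := by
  rw [Iso.comp_inv_eq, Category.assoc, h, Iso.inv_hom_id_assoc]

/-- An isomorphism of the underlying objects that commutes with the operations is an isomorphism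
of spectra. -/
lemma exists_iso {M N : Spectra C} (φ : M.X ≅ N.X)
    (h : ∀ p x, opn M p x ≫ (biMap φ.hom).app (dg p ⊗ x) = (biMap φ.hom).app x ≫ opn N p x) :
    Nonempty (M ≅ N) := by
  obtain ⟨f, hf⟩ := exists_hom φ.hom h
  obtain ⟨f', hf'⟩ := exists_hom φ.inv fun p x => by
    have e (y : Sym × Sym) : (biMap φ.hom).app y ≫ (biMap φ.inv).app y = 𝟙 _ := by
      rw [← biMap_comp_app, φ.hom_inv_id, biMap_id_app]
    have e' (y : Sym × Sym) : (biMap φ.inv).app y ≫ (biMap φ.hom).app y = 𝟙 _ := by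
      rw [← biMap_comp_app, φ.inv_hom_id, biMap_id_app]
    exact comm_inv ⟨_, _, e x, e' x⟩ ⟨_, _, e _, e' _⟩ (h p x)
  refine ⟨{ hom := f, inv := f', hom_inv_id := ?_, inv_hom_id := ?_ }⟩
  · apply Mod.hom_ext
    rw [Mod.comp_hom', hf, hf', φ.hom_inv_id]
    rfl
  · apply Mod.hom_ext
    rw [Mod.comp_hom', hf, hf', φ.inv_hom_id]
    rfl

instance : (toSpectra C).EssSurj where
  mem_essImage M := by
    obtain ⟨X, u, hu⟩ := exists_functor M
    have h₁ {x y : Sym × Sym} (f : x ⟶ y) : (bi (specOf X).X).map f ≫ (u y).hom =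
        (u x).hom ≫ (bi M.X).map f := by
      have h := hu 0 ((λ_ x).hom ≫ f)
      have e : std 0 x ≫ incl.map ((λ_ x).hom ≫ f) = incl.map f := by
        rw [std_zero]
        refine (CategoryTheory.Functor.map_comp incl (λ_ x).inv ((λ_ x).hom ≫ f)).symm.trans ?_
        rw [Iso.inv_hom_id_assoc]
      have e' : opn M 0 x ≫ (bi M.X).map ((λ_ x).hom ≫ f) = (bi M.X).map f := by
        rw [opn_zero]
        refine (CategoryTheory.Functor.map_comp (bi M.X) (λ_ x).inv ((λ_ x).hom ≫ f)).symm.trans ?_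
        rw [Iso.inv_hom_id_assoc]
      rw [e, e'] at h
      exact (congrArg (· ≫ _) (bi_jStar_map X f)).trans h
    have h₂ (p : ℕ) (x : Sym × Sym) : opn (specOf X) p x ≫ (u (dg p ⊗ x)).hom =
        (u x).hom ≫ opn M p x := by
      have h := hu p (𝟙 (dg p ⊗ x))
      rw [CategoryTheory.Functor.map_id, CategoryTheory.Functor.map_id, Category.comp_id,
        Category.comp_id] at h
      rw [opn_specOf]
      exact h
    let φ : (specOf X).X ≅ M.X :=
      { hom := ofBi (F := (specOf X).X) { app x := (u x).hom, naturality _ _ f := h₁ f }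
        inv := ofBi (G := (specOf X).X)
          { app x := (u x).inv
            naturality x y f := comm_inv (u x) (u y) (h₁ f) }
        hom_inv_id := biMap_injective fun x => (u x).hom_inv_id
        inv_hom_id := biMap_injective fun x => (u x).inv_hom_id }
    obtain ⟨f⟩ := exists_iso (M := specOf X) (N := M) φ h₂
    exact ⟨X, ⟨f⟩⟩

instance : (toSpectra C).IsEquivalence where

end Equivalence

/-! ### The comparison of the tensor products -/

section Comparison

variable {C : Type u} [Category.{v} C] [MonoidalCategory C] [SymmetricCategory C]
  [HasColimitsOfSize.{0, 0} C] [∀ X : C, PreservesColimitsOfSize.{0, 0} (tensorLeft X)]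

section Universal

variable (X Y Z : DayFunctor J C)

/-- The universal map `X(x) ⊗ Y(y) ⟶ (X ⊗ Y)(x ⊗ y)` of the Day convolution over `J`, in terms of
the associated spectra. -/
def jη (x y : Sym × Sym) :
    (bi (specOf X).X).obj x ⊗ (bi (specOf Y).X).obj y ⟶ (bi (specOf (X ⊗ Y)).X).obj (x ⊗ y) :=
  dη X Y (incl.obj x) (incl.obj y)

lemma jη_natural_left {x x' : Sym × Sym} (f : x ⟶ x') (y : Sym × Sym) :
    (bi (specOf X).X).map f ▷ (bi (specOf Y).X).obj y ≫ jη X Y x' y =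
      jη X Y x y ≫ (bi (specOf (X ⊗ Y)).X).map (f ▷ y) := by
  have e := bi_jStar_map (X ⊗ Y) (f ▷ y)
  rw [incl_whiskerRight] at e
  refine (congrArg (fun t => t ▷ Y.functor.obj (incl.obj y) ≫ dη X Y (incl.obj x') (incl.obj y))
    (bi_jStar_map X f)).trans ?_
  exact (dη_natural_left X Y (incl.map f) (incl.obj y)).trans (congrArg (_ ≫ ·) e.symm)

lemma jη_natural_right (x : Sym × Sym) {y y' : Sym × Sym} (f : y ⟶ y') :
    (bi (specOf X).X).obj x ◁ (bi (specOf Y).X).map f ≫ jη X Y x y' =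
      jη X Y x y ≫ (bi (specOf (X ⊗ Y)).X).map (x ◁ f) := by
  have e := bi_jStar_map (X ⊗ Y) (x ◁ f)
  rw [incl_whiskerLeft] at e
  refine (congrArg (fun t => X.functor.obj (incl.obj x) ◁ t ≫ dη X Y (incl.obj x) (incl.obj y'))
    (bi_jStar_map Y f)).trans ?_
  exact (dη_natural_right X Y (incl.obj x) (incl.map f)).trans (congrArg (_ ≫ ·) e.symm)

lemma std_whiskerRight (p : ℕ) (x y : Sym × Sym) :
    std p x ▷ incl.obj y ≫ (α_ (incl.obj (dg p)) (incl.obj x) (incl.obj y)).hom =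
      std p (x ⊗ y) := by
  have h : ((λ_ (incl.obj x)).inv ≫ diag p ▷ incl.obj x) ▷ incl.obj y ≫
      (α_ (incl.obj (dg p)) (incl.obj x) (incl.obj y)).hom =
      (λ_ (incl.obj x ⊗ incl.obj y)).inv ≫ diag p ▷ (incl.obj x ⊗ incl.obj y) := by
    simp
  exact h

/-- The universal maps are compatible with the operations on the first factor. -/
lemma opn_jη (p : ℕ) (x y : Sym × Sym) :
    opn (specOf X) p x ▷ (bi (specOf Y).X).obj y ≫ jη X Y (dg p ⊗ x) y ≫
      (bi (specOf (X ⊗ Y)).X).map (α_ (dg p) x y).hom =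
      jη X Y x y ≫ opn (specOf (X ⊗ Y)) p (x ⊗ y) := by
  have e : (bi (specOf (X ⊗ Y)).X).map (α_ (dg p) x y).hom =
      (X ⊗ Y).functor.map (α_ (incl.obj (dg p)) (incl.obj x) (incl.obj y)).hom :=
    bi_jStar_map (X ⊗ Y) (α_ (dg p) x y).hom
  have n := dη_natural_left X Y (std p x) (incl.obj y)
  have s := congrArg (X ⊗ Y).functor.map (std_whiskerRight p x y)
  have m := (CategoryTheory.Functor.map_comp (X ⊗ Y).functor (std p x ▷ incl.obj y)
    (α_ (incl.obj (dg p)) (incl.obj x) (incl.obj y)).hom).symm.trans s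
  rw [e, opn_specOf, opn_specOf]
  exact (comp_comp_eq n _).trans ((Category.assoc _ _ _).trans (congrArg (_ ≫ ·) m))

lemma jη_whiskerRight {X X' : DayFunctor J C} (f : X ⟶ X') (x y : Sym × Sym) :
    jη X Y x y ≫ (biMap (specMap (f ▷ Y)).hom).app (x ⊗ y) =
      (biMap (specMap f).hom).app x ▷ (bi (specOf Y).X).obj y ≫ jη X' Y x y := by
  rw [biMap_specMap, biMap_specMap]
  exact dη_whiskerRight f Y (incl.obj x) (incl.obj y)

lemma jη_whiskerLeft {Y Y' : DayFunctor J C} (f : Y ⟶ Y') (x y : Sym × Sym) :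
    jη X Y x y ≫ (biMap (specMap (X ◁ f)).hom).app (x ⊗ y) =
      (bi (specOf X).X).obj x ◁ (biMap (specMap f).hom).app y ≫ jη X Y' x y := by
  rw [biMap_specMap, biMap_specMap]
  exact dη_whiskerLeft X f (incl.obj x) (incl.obj y)

lemma jη_braiding (x y : Sym × Sym) :
    jη X Y x y ≫ (biMap (specMap (β_ X Y).hom).hom).app (x ⊗ y) =
      (β_ _ _).hom ≫ jη Y X y x ≫ (bi (specOf (Y ⊗ X)).X).map (X := y ⊗ x) (Y := x ⊗ y)
        ((β_ y.1 x.1).hom, (β_ y.2 x.2).hom) := by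
  have e : (bi (specOf (Y ⊗ X)).X).map (X := y ⊗ x) (Y := x ⊗ y)
      ((β_ y.1 x.1).hom, (β_ y.2 x.2).hom) =
      (Y ⊗ X).functor.map (β_ (incl.obj y) (incl.obj x)).hom :=
    bi_jStar_map (Y ⊗ X) (x := y ⊗ x) (y := x ⊗ y) ((β_ y.1 x.1).hom, (β_ y.2 x.2).hom)
  rw [biMap_specMap, e]
  exact dη_braiding X Y (incl.obj x) (incl.obj y)

lemma jη_associator (x y z : Sym × Sym) :
    jη X Y x y ▷ (bi (specOf Z).X).obj z ≫ jη (X ⊗ Y) Z (x ⊗ y) z ≫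
      (biMap (specMap (α_ X Y Z).hom).hom).app ((x ⊗ y) ⊗ z) =
    (α_ _ _ _).hom ≫ (bi (specOf X).X).obj x ◁ jη Y Z y z ≫ jη X (Y ⊗ Z) x (y ⊗ z) ≫
      (bi (specOf (X ⊗ Y ⊗ Z)).X).map (α_ x y z).inv := by
  have e : (bi (specOf (X ⊗ Y ⊗ Z)).X).map (α_ x y z).inv =
      (X ⊗ Y ⊗ Z).functor.map (α_ (incl.obj x) (incl.obj y) (incl.obj z)).inv :=
    bi_jStar_map (X ⊗ Y ⊗ Z) (α_ x y z).inv
  rw [biMap_specMap, e]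
  exact dη_associator X Y Z (incl.obj x) (incl.obj y) (incl.obj z)

variable (C) in
/-- The universal map `𝟙 ⟶ 𝟙(0, 0)` of the unit of the Day convolution over `J`. -/
def jν : 𝟙_ C ⟶ (bi (specOf (𝟙_ (DayFunctor J C))).X).obj (𝟙_ (Sym × Sym)) := dayν J C

lemma jν_leftUnitor (y : Sym × Sym) :
    jν C ▷ (bi (specOf X).X).obj y ≫ jη (𝟙_ _) X (𝟙_ _) y ≫
      (biMap (specMap (λ_ X).hom).hom).app (𝟙_ (Sym × Sym) ⊗ y) =
    (λ_ _).hom ≫ (bi (specOf X).X).map (X := y) (Y := 𝟙_ (Sym × Sym) ⊗ y) (λ_ y).inv := by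
  have e : (bi (specOf X).X).map (X := y) (Y := 𝟙_ (Sym × Sym) ⊗ y) (λ_ y).inv =
      X.functor.map (λ_ (incl.obj y)).inv :=
    bi_jStar_map X (x := y) (y := 𝟙_ (Sym × Sym) ⊗ y) (λ_ y).inv
  rw [biMap_specMap, e]
  exact dν_leftUnitor X (incl.obj y)

end Universal

/-- Morphisms of spectra out of `e(X ⊗ Y)` are determined on the products of elements. -/
lemma specOf_tensor_hom_ext {X Y : DayFunctor J C} {M : Spectra C} {f g : specOf (X ⊗ Y) ⟶ M}
    (h : ∀ x y, jη X Y x y ≫ (biMap f.hom).app (x ⊗ y) =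
      jη X Y x y ≫ (biMap g.hom).app (x ⊗ y)) : f = g := by
  let i : specOf ((toSpectra C).objPreimage M) ≅ M := (toSpectra C).objObjPreimageIso M
  rw [← cancel_mono i.inv]
  obtain ⟨f', hf⟩ : ∃ f', specMap f' = f ≫ i.inv := (toSpectra C).map_surjective (f ≫ i.inv)
  obtain ⟨g', hg⟩ : ∃ g', specMap g' = g ≫ i.inv := (toSpectra C).map_surjective (g ≫ i.inv)
  rw [← hf, ← hg]
  congr 1
  apply day_hom_ext
  intro j k
  have e (t : specOf (X ⊗ Y) ⟶ M) (t') (ht : specMap t' = t ≫ i.inv) (x y : Sym × Sym) :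
      dη X Y (incl.obj x) (incl.obj y) ≫ t'.natTrans.app (incl.obj x ⊗ incl.obj y) =
      (jη X Y x y ≫ (biMap t.hom).app (x ⊗ y)) ≫ (biMap i.inv.hom).app (x ⊗ y) := by
    have h₁ := biMap_specMap t' (x ⊗ y)
    rw [ht, Mod.comp_hom', biMap_comp_app] at h₁
    exact (congrArg (_ ≫ ·) h₁.symm).trans (Category.assoc _ _ _).symm
  have k₁ := e f f' hf (⟨j.fst⟩, ⟨j.snd⟩) (⟨k.fst⟩, ⟨k.snd⟩)
  have k₂ := e g g' hg (⟨j.fst⟩, ⟨j.snd⟩) (⟨k.fst⟩, ⟨k.snd⟩)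
  rw [h] at k₁
  exact k₁.trans k₂.symm

/-- Morphisms of spectra out of `e(𝟙)` are determined on the unit element. -/
lemma specOf_unit_hom_ext {M : Spectra C} {f g : specOf (𝟙_ (DayFunctor J C)) ⟶ M}
    (h : jν C ≫ (biMap f.hom).app (𝟙_ _) = jν C ≫ (biMap g.hom).app (𝟙_ _)) : f = g := by
  let i : specOf ((toSpectra C).objPreimage M) ≅ M := (toSpectra C).objObjPreimageIso M
  rw [← cancel_mono i.inv]
  obtain ⟨f', hf⟩ : ∃ f', specMap f' = f ≫ i.inv := (toSpectra C).map_surjective (f ≫ i.inv)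
  obtain ⟨g', hg⟩ : ∃ g', specMap g' = g ≫ i.inv := (toSpectra C).map_surjective (g ≫ i.inv)
  rw [← hf, ← hg]
  congr 1
  apply DayFunctor.unit_hom_ext
  have e (t : specOf (𝟙_ (DayFunctor J C)) ⟶ M) (t') (ht : specMap t' = t ≫ i.inv) :
      dayν J C ≫ t'.natTrans.app (𝟙_ J) =
      (jν C ≫ (biMap t.hom).app (𝟙_ _)) ≫ (biMap i.inv.hom).app (𝟙_ _) := by
    have h₁ := biMap_specMap t' (𝟙_ _)
    rw [ht, Mod.comp_hom', biMap_comp_app] at h₁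
    exact (congrArg (_ ≫ ·) h₁.symm).trans (Category.assoc _ _ _).symm
  have k₁ := e f f' hf
  have k₂ := e g g' hg
  rw [h] at k₁
  exact k₁.trans k₂.symm

end Comparison

section TensorComparison

variable {C : Type u} [Category.{v} C] [MonoidalCategory C] [SymmetricCategory C]
  [HasColimitsOfSize.{0, 0} C] [∀ X : C, PreservesColimitsOfSize.{0, 0} (tensorLeft X)]

section

variable (X Y Z : DayFunctor J C)

/-- The map `j^* X ⊗ j^* Y ⟶ j^*(X ⊗ Y)` given by the universal maps of the Day convolution over
`J`. -/
def jμ : (specOf X).X ⊗ (specOf Y).X ⟶ (specOf (X ⊗ Y)).X :=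
  biDesc (jη X Y) (fun f y => jη_natural_left X Y f y) (fun x _ _ f => jη_natural_right X Y x f)

lemma bη_jμ (x y : Sym × Sym) :
    bη (specOf X).X (specOf Y).X x y ≫ (biMap (jμ X Y)).app (x ⊗ y) = jη X Y x y :=
  bη_biDesc _ _ _ x y

lemma jμ_braiding : jμ X Y ≫ (specMap (β_ X Y).hom).hom = (β_ _ _).hom ≫ jμ Y X := by
  apply bi_hom_ext
  intro x y
  have n := (biMap (jμ Y X)).naturality (X := y ⊗ x) (Y := x ⊗ y)
    ((β_ y.1 x.1).hom, (β_ y.2 x.2).hom)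
  rw [biMap_comp_app, biMap_comp_app, reassoc_of% bη_jμ, reassoc_of% bη_braiding, jη_braiding, n,
    reassoc_of% bη_jμ]

/-- Linearity in the first variable is naturality of the universal maps for the standard
morphisms. -/
lemma linL_jμ : LinL (specOf X) (specOf Y) (specOf (X ⊗ Y)) (jμ X Y) :=
  (linL_iff _).2 fun p x y => by
    rw [reassoc_of% bη_jμ, reassoc_of% bη_jμ, opn_jη]

/-- Linearity in the second variable follows from that in the first by the symmetry. -/
lemma linR_jμ : LinR (specOf X) (specOf Y) (specOf (X ⊗ Y)) (jμ X Y) := by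
  have e : (β_ (specOf X).X (specOf Y).X).hom ≫ jμ Y X ≫ (specMap (β_ Y X).hom).hom = jμ X Y := by
    rw [jμ_braiding, SymmetricCategory.symmetry_assoc]
  rw [← e]
  exact ((linL_jμ Y X).comp _).braid

/-- The map `e(X) ⊗ e(Y) ⟶ e(X ⊗ Y)` of spectra. -/
def specμ : specOf X ⊗ specOf Y ⟶ specOf (X ⊗ Y) := lift (jμ X Y) (linL_jμ X Y) (linR_jμ X Y)

lemma π_specμ : tproj (specOf X) (specOf Y) ≫ (specμ X Y).hom = jμ X Y :=
  π_lift _ (linL_jμ X Y) (linR_jμ X Y)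

variable {X Y Z}

lemma jμ_natural_left {X' : DayFunctor J C} (f : X ⟶ X') :
    (specMap f).hom ▷ (specOf Y).X ≫ jμ X' Y = jμ X Y ≫ (specMap (f ▷ Y)).hom := by
  apply bi_hom_ext
  intro x y
  rw [biMap_comp_app, biMap_comp_app, reassoc_of% bη_whiskerRight, bη_jμ, reassoc_of% bη_jμ,
    jη_whiskerRight]

lemma jμ_natural_right {Y' : DayFunctor J C} (f : Y ⟶ Y') :
    (specOf X).X ◁ (specMap f).hom ≫ jμ X Y' = jμ X Y ≫ (specMap (X ◁ f)).hom := by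
  apply bi_hom_ext
  intro x y
  rw [biMap_comp_app, biMap_comp_app, reassoc_of% bη_whiskerLeft, bη_jμ, reassoc_of% bη_jμ,
    jη_whiskerLeft]

lemma specμ_natural_left {X' : DayFunctor J C} (f : X ⟶ X') :
    specMap f ▷ specOf Y ≫ specμ X' Y = specμ X Y ≫ specMap (f ▷ Y) := by
  apply tensor_hom_ext
  rw [Mod.comp_hom', Mod.comp_hom', reassoc_of% π_whiskerRight, π_specμ, reassoc_of% π_specμ,
    jμ_natural_left]

lemma specμ_natural_right {Y' : DayFunctor J C} (f : Y ⟶ Y') :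
    specOf X ◁ specMap f ≫ specμ X Y' = specμ X Y ≫ specMap (X ◁ f) := by
  apply tensor_hom_ext
  rw [Mod.comp_hom', Mod.comp_hom', reassoc_of% π_whiskerLeft, π_specμ, reassoc_of% π_specμ,
    jμ_natural_right]

variable (X Y Z)

lemma specμ_braiding : specμ X Y ≫ specMap (β_ X Y).hom = (β_ _ _).hom ≫ specμ Y X := by
  apply tensor_hom_ext
  have e : tproj (specOf X) (specOf Y) ≫ (β_ (specOf X) (specOf Y)).hom.hom =
    (β_ _ _).hom ≫ tproj (specOf Y) (specOf X) := π_braid _ _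
  rw [Mod.comp_hom', Mod.comp_hom', reassoc_of% e, π_specμ, reassoc_of% π_specμ, jμ_braiding]

lemma jμ_associator :
    jμ X Y ▷ (specOf Z).X ≫ jμ (X ⊗ Y) Z ≫ (specMap (α_ X Y Z).hom).hom =
      (α_ _ _ _).hom ≫ (specOf X).X ◁ jμ Y Z ≫ jμ X (Y ⊗ Z) := by
  apply bi_hom_ext₃
  intro x y z
  have n₁ := (biMap ((specOf X).X ◁ jμ Y Z)).naturality (α_ x y z).inv
  have n₂ := (biMap (jμ X (Y ⊗ Z))).naturality (α_ x y z).inv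
  rw [biMap_comp_app, biMap_comp_app, biMap_comp_app, biMap_comp_app, reassoc_of% bη_associator,
    reassoc_of% bη_whiskerRight, reassoc_of% bη_jμ, reassoc_of% n₁, n₂, reassoc_of% bη_whiskerLeft,
    reassoc_of% bη_jμ, ← comp_whiskerRight_assoc, bη_jμ, ← whiskerLeft_comp_assoc, bη_jμ,
    jη_associator]

lemma specμ_associator :
    specμ X Y ▷ specOf Z ≫ specμ (X ⊗ Y) Z ≫ specMap (α_ X Y Z).hom =
      (α_ _ _ _).hom ≫ specOf X ◁ specμ Y Z ≫ specμ X (Y ⊗ Z) := by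
  apply tensor_hom_ext₃
  rw [Mod.comp_hom', Mod.comp_hom', Mod.comp_hom', Mod.comp_hom', reassoc_of% π_associator,
    reassoc_of% π_whiskerRight, reassoc_of% π_specμ, reassoc_of% π_whiskerLeft, π_specμ,
    ← comp_whiskerRight_assoc, π_specμ, ← whiskerLeft_comp_assoc, π_specμ, jμ_associator]

end

section Bilinear

variable {X Y Z : DayFunctor J C}

/-- The map `X(x) ⊗ Y(y) ⟶ Z(x ⊗ y)` given by a map `j^* X ⊗ j^* Y ⟶ j^* Z`. -/
def pairing (f : (specOf X).X ⊗ (specOf Y).X ⟶ (specOf Z).X) (x y : Sym × Sym) :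
    X.functor.obj (incl.obj x) ⊗ Y.functor.obj (incl.obj y) ⟶
      Z.functor.obj (incl.obj x ⊗ incl.obj y) :=
  bη (specOf X).X (specOf Y).X x y ≫ (biMap f).app (x ⊗ y)

lemma pairing_braid (f : (specOf X).X ⊗ (specOf Y).X ⟶ (specOf Z).X) (x y : Sym × Sym) :
    pairing ((β_ (specOf Y).X (specOf X).X).hom ≫ f) y x =
      (β_ _ _).hom ≫ pairing f x y ≫ Z.functor.map (β_ (incl.obj x) (incl.obj y)).hom := by
  have n := (biMap f).naturality (X := x ⊗ y) (Y := y ⊗ x) ((β_ x.1 y.1).hom, (β_ x.2 y.2).hom)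
  have e : (bi (specOf Z).X).map (X := x ⊗ y) (Y := y ⊗ x) ((β_ x.1 y.1).hom, (β_ x.2 y.2).hom) =
      Z.functor.map (β_ (incl.obj x) (incl.obj y)).hom :=
    bi_jStar_map Z (x := x ⊗ y) (y := y ⊗ x) ((β_ x.1 y.1).hom, (β_ x.2 y.2).hom)
  have h : bη (specOf Y).X (specOf X).X y x ≫
      (biMap ((β_ (specOf Y).X (specOf X).X).hom ≫ f)).app (y ⊗ x) =
      (β_ _ _).hom ≫ (bη (specOf X).X (specOf Y).X x y ≫ (biMap f).app (x ⊗ y)) ≫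
        (bi (specOf Z).X).map (X := x ⊗ y) (Y := y ⊗ x)
          ((β_ x.1 y.1).hom, (β_ x.2 y.2).hom) := by
    rw [biMap_comp_app, reassoc_of% bη_braiding, n, Category.assoc]
  rw [e] at h
  exact h

/-- A map that is linear in the first variable is natural in the first variable for all morphisms
of `J`, because bijections and standard morphisms generate `J`. -/
lemma pairing_natural_left {f : (specOf X).X ⊗ (specOf Y).X ⟶ (specOf Z).X}
    (hf : LinL (specOf X) (specOf Y) (specOf Z) f) {x x' : Sym × Sym}
    (φ : incl.obj x ⟶ incl.obj x') (y : Sym × Sym) :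
    X.functor.map φ ▷ Y.functor.obj (incl.obj y) ≫ pairing f x' y =
      pairing f x y ≫ Z.functor.map (φ ▷ incl.obj y) := by
  have h₁ {x x' : Sym × Sym} (s : x ⟶ x') :
      X.functor.map (incl.map s) ▷ Y.functor.obj (incl.obj y) ≫ pairing f x' y =
      pairing f x y ≫ Z.functor.map (incl.map s ▷ incl.obj y) := by
    have n := (biMap f).naturality (s ▷ y)
    have h : (bi (specOf X).X).map s ▷ (bi (specOf Y).X).obj y ≫
        bη (specOf X).X (specOf Y).X x' y ≫ (biMap f).app (x' ⊗ y) =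
        (bη (specOf X).X (specOf Y).X x y ≫ (biMap f).app (x ⊗ y)) ≫
          (bi (specOf Z).X).map (s ▷ y) := by
      rw [reassoc_of% bη_natural_left, n, Category.assoc]
    have e := bi_jStar_map Z (s ▷ y)
    rw [incl_whiskerRight] at e
    refine (congrArg (fun t => t ▷ Y.functor.obj (incl.obj y) ≫ pairing f x' y)
      (bi_jStar_map X s)).symm.trans ?_
    exact h.trans (congrArg (pairing f x y ≫ ·) e)
  have h₂ (p : ℕ) (x : Sym × Sym) :
      X.functor.map (std p x) ▷ Y.functor.obj (incl.obj y) ≫ pairing f (dg p ⊗ x) y =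
      pairing f x y ≫ Z.functor.map (std p x ▷ incl.obj y) := by
    have h := (linL_iff f).1 hf p x y
    have e : (bi (specOf Z).X).map (α_ (dg p) x y).hom =
        Z.functor.map (α_ (incl.obj (dg p)) (incl.obj x) (incl.obj y)).hom :=
      bi_jStar_map Z (α_ (dg p) x y).hom
    have s := congrArg Z.functor.map (std_whiskerRight p x y)
    have m := (CategoryTheory.Functor.map_comp Z.functor (std p x ▷ incl.obj y)
      (α_ (incl.obj (dg p)) (incl.obj x) (incl.obj y)).hom).symm.trans s
    rw [e, opn_specOf, opn_specOf] at h
    refine (cancel_mono (Z.functor.map (α_ (incl.obj (dg p)) (incl.obj x) (incl.obj y)).hom)).1 ?_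
    refine Eq.trans ?_ ((h.trans (Category.assoc _ _ _).symm).trans ?_)
    · exact (Category.assoc _ _ _).trans (congrArg (_ ≫ ·) (Category.assoc _ _ _))
    · exact (congrArg (_ ≫ ·) m.symm).trans (Category.assoc _ _ _).symm
  obtain ⟨p, s, rfl⟩ := exists_std φ
  have m₁ := CategoryTheory.Functor.map_comp X.functor (std p x) (incl.map s)
  have m₂ := CategoryTheory.Functor.map_comp Z.functor (std p x ▷ incl.obj y)
    (incl.map s ▷ incl.obj y)
  rw [m₁, comp_whiskerRight, comp_whiskerRight, m₂, Category.assoc, h₁, reassoc_of% h₂]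

lemma pairing_natural_right {f : (specOf X).X ⊗ (specOf Y).X ⟶ (specOf Z).X}
    (hf : LinR (specOf X) (specOf Y) (specOf Z) f) (x : Sym × Sym) {y y' : Sym × Sym}
    (φ : incl.obj y ⟶ incl.obj y') :
    X.functor.obj (incl.obj x) ◁ Y.functor.map φ ≫ pairing f x y' =
      pairing f x y ≫ Z.functor.map (incl.obj x ◁ φ) := by
  have h := pairing_natural_left hf.braid φ x
  rw [pairing_braid, pairing_braid, BraidedCategory.braiding_naturality_left_assoc, Category.assoc,
    Category.assoc, ← CategoryTheory.Functor.map_comp,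
    ← BraidedCategory.braiding_naturality_right, CategoryTheory.Functor.map_comp, cancel_epi,
    ← Category.assoc, ← Category.assoc, cancel_mono] at h
  exact h

/-- A bilinear map `j^* X ⊗ j^* Y ⟶ j^* Z` comes from a morphism `X ⊗ Y ⟶ Z` over `J`. -/
lemma exists_of_bilinear (f : (specOf X).X ⊗ (specOf Y).X ⟶ (specOf Z).X)
    (hl : LinL (specOf X) (specOf Y) (specOf Z) f) (hr : LinR (specOf X) (specOf Y) (specOf Z) f) :
    ∃ h : X ⊗ Y ⟶ Z, jμ X Y ≫ (specMap h).hom = f := by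
  refine ⟨dayDesc (fun j k => pairing f (⟨j.fst⟩, ⟨j.snd⟩) (⟨k.fst⟩, ⟨k.snd⟩))
    (fun {j j'} φ k => pairing_natural_left (x := (⟨j.fst⟩, ⟨j.snd⟩))
      (x' := (⟨j'.fst⟩, ⟨j'.snd⟩)) hl φ (⟨k.fst⟩, ⟨k.snd⟩))
    (fun j {k k'} φ => pairing_natural_right (y := (⟨k.fst⟩, ⟨k.snd⟩))
      (y' := (⟨k'.fst⟩, ⟨k'.snd⟩)) hr (⟨j.fst⟩, ⟨j.snd⟩) φ), ?_⟩
  apply bi_hom_ext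
  intro x y
  rw [biMap_comp_app, reassoc_of% bη_jμ, biMap_specMap]
  exact dη_dayDesc _ _ _ (incl.obj x) (incl.obj y)

end Bilinear

/-- The map `e(X) ⊗ e(Y) ⟶ e(X ⊗ Y)` is invertible, because both sides represent the pairings
`X(x) ⊗ Y(y) ⟶ Z(x ⊗ y)` that are natural over `J`. -/
instance (X Y : DayFunctor J C) : IsIso (specμ X Y) := by
  -- The source is isomorphic to some `e(Z)`, so that the projection is a bilinear map into `e(Z)`.
  let i : specOf ((toSpectra C).objPreimage (specOf X ⊗ specOf Y)) ≅ specOf X ⊗ specOf Y :=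
    (toSpectra C).objObjPreimageIso _
  obtain ⟨h, hh⟩ := exists_of_bilinear (tproj (specOf X) (specOf Y) ≫ i.inv.hom)
    ((linL_π (specOf X) (specOf Y)).comp i.inv) ((linR_π (specOf X) (specOf Y)).comp i.inv)
  have e : specμ X Y ≫ specMap h ≫ i.hom = 𝟙 _ := by
    rw [← Category.assoc, ← Iso.eq_comp_inv, Category.id_comp]
    apply tensor_hom_ext
    rw [Mod.comp_hom', reassoc_of% π_specμ, hh]
  refine ⟨specMap h ≫ i.hom, e, ?_⟩
  apply specOf_tensor_hom_ext
  intro x y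
  have e' : tproj (specOf X) (specOf Y) ≫ (specμ X Y).hom ≫
      ((specMap h ≫ i.hom) ≫ specμ X Y).hom = tproj (specOf X) (specOf Y) ≫ (specμ X Y).hom ≫
        (𝟙 (specOf (X ⊗ Y)) : specOf (X ⊗ Y) ⟶ _).hom := by
    rw [← Mod.comp_hom', ← Mod.comp_hom', ← Category.assoc, e, Category.id_comp, Category.comp_id]
  rw [reassoc_of% π_specμ, reassoc_of% π_specμ] at e'
  have e'' := congrArg (fun t => bη (specOf X).X (specOf Y).X x y ≫ (biMap t).app (x ⊗ y)) e'
  simp only [biMap_comp_app] at e''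
  rwa [reassoc_of% bη_jμ, reassoc_of% bη_jμ] at e''

end TensorComparison

/-! ### The comparison of the units -/

section UnitObject

variable {D : Type u} [Category.{v} D] [MonoidalCategory D] [SymmetricCategory D]
  [HasColimitsOfSize.{0, 0} D] [∀ X : D, PreservesColimitsOfSize.{0, 0} (tensorLeft X)]
  {A : D} [MonObj A] [IsCommMonObj A]

variable (A) in
/-- The unit of `A` as an element of the unit object of the category of modules. -/
def unitElt : 𝟙_ D ⟶ (𝟙_ (Mod D A)).X := MonObj.one (X := A)

lemma unitElt_actU (M : Mod D A) : unitElt A ▷ M.X ≫ actU M = (λ_ M.X).hom := one_act M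

/-- Morphisms out of the unit object are determined by the image of the unit of `A`. -/
lemma relUnit_hom_ext {M : Mod D A} {f g : 𝟙_ (Mod D A) ⟶ M}
    (h : unitElt A ≫ f.hom = unitElt A ≫ g.hom) : f = g := by
  apply Mod.hom_ext
  have k (t : 𝟙_ (Mod D A) ⟶ M) : t.hom = (ρ_ A).inv ≫ A ◁ (unitElt A ≫ t.hom) ≫ act M := by
    have e : (ρ_ A).inv ≫ A ◁ MonObj.one (X := A) ≫ MonObj.mul (X := A) = 𝟙 A := by
      rw [MonObj.mul_one, Iso.inv_hom_id]
    have e' : MonObj.mul (X := A) ≫ t.hom = A ◁ t.hom ≫ act M := act_hom t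
    have e'' := congrArg (· ≫ t.hom) e
    refine ((Category.id_comp t.hom).symm.trans e''.symm).trans ?_
    refine (Category.assoc _ _ _).trans (congrArg (_ ≫ ·) ?_)
    refine (Category.assoc _ _ _).trans ((congrArg (_ ≫ ·) e').trans ?_)
    refine (Category.assoc _ _ _).symm.trans (congrArg (· ≫ _) ?_)
    exact (whiskerLeft_comp A (MonObj.one (X := A)) t.hom).symm
  rw [k f, k g, h]

/-- An element of `M` gives a morphism of modules from the unit object to `M`. -/
lemma exists_relUnit_hom (M : Mod D A) (a : 𝟙_ D ⟶ M.X) :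
    ∃ f : 𝟙_ (Mod D A) ⟶ M, unitElt A ≫ f.hom = a := by
  have e : MonObj.mul (X := A) ≫ (ρ_ A).inv ≫ A ◁ a ≫ act M =
      A ◁ ((ρ_ A).inv ≫ A ◁ a ≫ act M) ≫ act M := by
    rw [rightUnitor_inv_naturality_assoc, ← whisker_exchange_assoc, mul_act]
    simp
  refine ⟨(Mod.Hom.mk' ((ρ_ A).inv ≫ A ◁ a ≫ act M) e : relUnit A ⟶ M), ?_⟩
  have h : MonObj.one (X := A) ≫ (ρ_ A).inv ≫ A ◁ a ≫ act M = a := by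
    rw [rightUnitor_inv_naturality_assoc, ← whisker_exchange_assoc, one_act]
    simp [unitors_equal]
  exact h

/-- Morphisms out of `𝟙 ⊗ M` are determined by the products of the unit with elements of `M`. -/
lemma relUnit_tensor_hom_ext {M N : Mod D A} {f g : 𝟙_ (Mod D A) ⊗ M ⟶ N}
    (h : unitElt A ▷ M.X ≫ tproj (𝟙_ _) M ≫ f.hom =
      unitElt A ▷ M.X ≫ tproj (𝟙_ _) M ≫ g.hom) : f = g := by
  rw [← cancel_epi (λ_ M).inv]
  apply Mod.hom_ext
  have k (t : 𝟙_ (Mod D A) ⊗ M ⟶ N) : ((λ_ M).inv ≫ t).hom =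
      (λ_ M.X).inv ≫ unitElt A ▷ M.X ≫ tproj (𝟙_ _) M ≫ t.hom := by
    refine (Category.assoc _ _ _).trans (congrArg (_ ≫ ·) (Category.assoc _ _ _))
  rw [k, k, h]

end UnitObject

section UnitComparison

variable (C : Type u) [Category.{v} C] [MonoidalCategory C] [SymmetricCategory C]
  [HasColimitsOfSize.{0, 0} C] [∀ X : C, PreservesColimitsOfSize.{0, 0} (tensorLeft X)]

lemma exists_specε : ∃ f : 𝟙_ (Spectra C) ⟶ specOf (𝟙_ (DayFunctor J C)),
    bν Sym Sym C ≫ (biMap (unitElt (sph C))).app (𝟙_ _) ≫ (biMap f.hom).app (𝟙_ _) = jν C := by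
  obtain ⟨f, hf⟩ := exists_relUnit_hom (specOf (𝟙_ (DayFunctor J C))) (biUnitDesc (jν C))
  refine ⟨f, ?_⟩
  rw [← biMap_comp_app, hf, bν_biUnitDesc]

/-- The map of spectra from the unit to `e(𝟙)`. -/
def specε : 𝟙_ (Spectra C) ⟶ specOf (𝟙_ (DayFunctor J C)) := (exists_specε C).choose

/-- The map `specε` sends the unit of `Sym(T)` to the unit element of `e(𝟙)`. -/
lemma unitElt_specε :
    bν Sym Sym C ≫ (biMap (unitElt (sph C))).app (𝟙_ _) ≫ (biMap (specε C).hom).app (𝟙_ _) =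
      jν C := (exists_specε C).choose_spec

instance : IsIso (specε C) := by
  -- The unit object is isomorphic to some `e(Z)`, and its unit element gives a morphism `𝟙 ⟶ Z`.
  let i : specOf ((toSpectra C).objPreimage (𝟙_ (Spectra C))) ≅ 𝟙_ (Spectra C) :=
    (toSpectra C).objObjPreimageIso _
  let u : 𝟙_ C ⟶ (bi (specOf ((toSpectra C).objPreimage (𝟙_ (Spectra C)))).X).obj (𝟙_ _) :=
    bν Sym Sym C ≫ (biMap (unitElt (sph C))).app (𝟙_ _) ≫ (biMap i.inv.hom).app (𝟙_ _)
  obtain ⟨h, hh⟩ : ∃ h : 𝟙_ (DayFunctor J C) ⟶ (toSpectra C).objPreimage (𝟙_ (Spectra C)),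
      jν C ≫ (biMap (specMap h).hom).app (𝟙_ _) = u :=
    ⟨DayFunctor.unitDesc u, by
      rw [biMap_specMap]
      exact dν_unitDesc (K := J) u⟩
  have e : specε C ≫ specMap h ≫ i.hom = 𝟙 _ := by
    rw [← Category.assoc, ← Iso.eq_comp_inv, Category.id_comp]
    apply relUnit_hom_ext
    apply bi_unit_hom_ext
    rw [Mod.comp_hom', biMap_comp_app, biMap_comp_app, biMap_comp_app,
      reassoc_of% unitElt_specε, hh]
  refine ⟨specMap h ≫ i.hom, e, ?_⟩
  apply specOf_unit_hom_ext
  have e' : (specε C).hom ≫ ((specMap h ≫ i.hom) ≫ specε C).hom = (specε C).hom ≫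
      (𝟙 (specOf (𝟙_ (DayFunctor J C))) : specOf (𝟙_ (DayFunctor J C)) ⟶ _).hom := by
    rw [← Mod.comp_hom', ← Mod.comp_hom', ← Category.assoc, e, Category.id_comp, Category.comp_id]
  have e'' := congrArg (fun t => bν Sym Sym C ≫ (biMap (unitElt (sph C))).app (𝟙_ _) ≫
    (biMap t).app (𝟙_ _)) e'
  simp only [biMap_comp_app] at e''
  rwa [reassoc_of% unitElt_specε, reassoc_of% unitElt_specε] at e''

variable {C}

lemma specμ_leftUnitor (X : DayFunctor J C) :
    (λ_ (specOf X)).hom = specε C ▷ specOf X ≫ specμ (𝟙_ _) X ≫ specMap (λ_ X).hom := by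
  apply relUnit_tensor_hom_ext
  rw [Mod.comp_hom', Mod.comp_hom', π_leftUnitor, unitElt_actU, reassoc_of% π_whiskerRight,
    reassoc_of% π_specμ]
  apply bi_unit_tensor_hom_ext
  intro y
  have e : bν Sym Sym C ▷ (bi (specOf X).X).obj y ≫ bη (𝟙_ _) (specOf X).X (𝟙_ _) y ≫
      (biMap (λ_ (specOf X).X).hom).app (𝟙_ (Sym × Sym) ⊗ y) =
      (λ_ _).hom ≫ (bi (specOf X).X).map (X := y) (Y := 𝟙_ (Sym × Sym) ⊗ y) (λ_ y).inv :=
    bν_leftUnitor _ y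
  rw [e, biMap_comp_app, biMap_comp_app, biMap_comp_app, reassoc_of% bη_whiskerRight,
    reassoc_of% bη_whiskerRight, reassoc_of% bη_jμ, ← comp_whiskerRight_assoc,
    ← comp_whiskerRight_assoc, Category.assoc, unitElt_specε, jν_leftUnitor]

lemma specμ_rightUnitor (X : DayFunctor J C) :
    (ρ_ (specOf X)).hom = specOf X ◁ specε C ≫ specμ X (𝟙_ _) ≫ specMap (ρ_ X).hom := by
  have e : specMap (ρ_ X).hom = specMap (β_ X (𝟙_ _)).hom ≫ specMap (λ_ X).hom := by
    rw [← braiding_leftUnitor]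
    exact (toSpectra C).map_comp _ _
  rw [e, reassoc_of% specμ_braiding, BraidedCategory.braiding_naturality_right_assoc,
    ← specμ_leftUnitor, braiding_leftUnitor]

variable (C) in
/-- The isomorphism from the unit to `e(𝟙)`. The instance is supplied for `specOf`, which is the value
of `toSpectra` by unfolding. -/
def specεIso : 𝟙_ (Spectra C) ≅ (toSpectra C).obj (𝟙_ (DayFunctor J C)) :=
  have : IsIso (specε C) := inferInstance
  @asIso _ _ (𝟙_ (Spectra C)) (specOf (𝟙_ (DayFunctor J C))) (specε C) this

/-- The isomorphism `e(X) ⊗ e(Y) ≅ e(X ⊗ Y)`. -/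
def specμIso (X Y : DayFunctor J C) :
    (toSpectra C).obj X ⊗ (toSpectra C).obj Y ≅ (toSpectra C).obj (X ⊗ Y) :=
  have : IsIso (specμ X Y) := inferInstance
  @asIso _ _ (specOf X ⊗ specOf Y) (specOf (X ⊗ Y)) (specμ X Y) this

/-- The functor from `C^J` to symmetric spectra is strong monoidal. -/
instance : (toSpectra C).Monoidal :=
  Functor.CoreMonoidal.toMonoidal
    { εIso := specεIso C
      μIso X Y := specμIso X Y
      μIso_hom_natural_left f _ := specμ_natural_left f
      μIso_hom_natural_right _ f := specμ_natural_right f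
      associativity X Y Z := specμ_associator X Y Z
      left_unitality X := specμ_leftUnitor X
      right_unitality X := specμ_rightUnitor X }

instance : (toSpectra C).Braided where
  braided X Y := specμ_braiding X Y

end UnitComparison

/-! ### The bonding maps -/

section Bonding

variable {C : Type u} [Category.{v} C] [MonoidalCategory C] [SymmetricCategory C]
  [HasColimitsOfSize.{0, 0} C] [∀ X : C, PreservesColimitsOfSize.{0, 0} (tensorLeft X)]

/-- The fundamental element of degree `1` of `Sym(T)` is the identity of `𝟙` in degree `1` of `T`. -/
lemma bgen_one_eq : bgen C 1 =
    (genT C : 𝟙_ C ⟶ _) ≫ (λ_ (sphereT C)).inv.natTrans.app (⟨1⟩ : Sym) := by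
  have h := dmul_leftUnitor (genT C)
  have e : (λ_ (sphereT C)).hom.natTrans.app (⟨1⟩ : Sym) ≫
      (λ_ (sphereT C)).inv.natTrans.app (⟨1⟩ : Sym) = 𝟙 _ := by
    rw [← day_comp_app, Iso.hom_inv_id]
    rfl
  have h' : bgen C 1 ≫ (λ_ (sphereT C)).hom.natTrans.app (⟨1⟩ : Sym) = genT C :=
    h.trans (Category.comp_id (genT C))
  exact ((Category.comp_id _).symm.trans (congrArg (bgen C 1 ≫ ·) e).symm).trans
    ((Category.assoc _ _ _).symm.trans (congrArg (· ≫ _) h'))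

/-- The bonding maps are the operations of the fundamental element of degree `1`, up to the shuffle
that moves the new elements from the front to the back. -/
lemma bondMap_eq (M : Spectra C) (i n : ℕ) : bondMap M i n = opn M 1 (⟨i⟩, ⟨n⟩) ≫
    (bi M.X).map (X := dg 1 ⊗ (⟨i⟩, ⟨n⟩)) (Y := (⟨i⟩, ⟨n⟩) ⊗ dg 1)
      ((β_ (⟨1⟩ : Sym) ⟨i⟩).hom, (β_ (⟨1⟩ : Sym) ⟨n⟩).hom) := by
  let x : Sym × Sym := (⟨i⟩, ⟨n⟩)
  have w := dη_whiskerLeft (M.X.functor.obj ⟨i⟩) (λ_ (sphereT C)).inv ⟨n⟩ ⟨1⟩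
  have h₁ : bondMap M i n = (ρ_ ((bi M.X).obj x)).inv ≫ (bi M.X).obj x ◁ bgen C 1 ≫
      bη M.X (sph C) x (dg 1) ≫ (biMap ((β_ M.X (sph C)).hom ≫ act M)).app (x ⊗ dg 1) := by
    have g : (bi M.X).obj x ◁ bgen C 1 =
        (bi M.X).obj x ◁ (λ_ (sphereT C)).inv.natTrans.app (⟨1⟩ : Sym) := by
      rw [bgen_one_eq]
      exact congrArg _ (Category.id_comp _)
    refine congrArg (_ ≫ ·) ?_
    refine (comp_comp_eq w _).trans ((Category.assoc _ _ _).trans ?_)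
    refine (congrArg (· ≫ _) g.symm).trans (congrArg (_ ≫ ·) ?_)
    exact (Category.assoc _ _ _).symm
  have n₁ := (biMap (act M)).naturality (X := dg 1 ⊗ x) (Y := x ⊗ dg 1)
    ((β_ (⟨1⟩ : Sym) ⟨i⟩).hom, (β_ (⟨1⟩ : Sym) ⟨n⟩).hom)
  have b := bη_braiding M.X (sph C) x (dg 1)
  have h₂ : bη M.X (sph C) x (dg 1) ≫ (biMap ((β_ M.X (sph C)).hom ≫ act M)).app (x ⊗ dg 1) =
      (β_ _ _).hom ≫ bη (sph C) M.X (dg 1) x ≫ (biMap (act M)).app (dg 1 ⊗ x) ≫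
        (bi M.X).map (X := dg 1 ⊗ x) (Y := x ⊗ dg 1)
          ((β_ (⟨1⟩ : Sym) ⟨i⟩).hom, (β_ (⟨1⟩ : Sym) ⟨n⟩).hom) := by
    rw [biMap_comp_app, reassoc_of% b, ← n₁]
  have r : (ρ_ ((bi M.X).obj x)).inv ≫ (β_ ((bi M.X).obj x) (𝟙_ C)).hom =
      (λ_ ((bi M.X).obj x)).inv := by
    simp
  rw [h₁, h₂, BraidedCategory.braiding_naturality_right_assoc, reassoc_of% r]
  simp only [opn, opr, Category.assoc]
  rfl

lemma bondMap_specOf (X : DayFunctor J C) (i n : ℕ) :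
    bondMap (specOf X) i n = X.functor.map (stdMap i n) := by
  have e : (bi (specOf X).X).map (X := dg 1 ⊗ (⟨i⟩, ⟨n⟩)) (Y := (⟨i⟩, ⟨n⟩) ⊗ dg 1)
      ((β_ (⟨1⟩ : Sym) ⟨i⟩).hom, (β_ (⟨1⟩ : Sym) ⟨n⟩).hom) = X.functor.map (incl.map
      (X := dg 1 ⊗ (⟨i⟩, ⟨n⟩)) (Y := (⟨i⟩, ⟨n⟩) ⊗ dg 1)
      ((β_ (⟨1⟩ : Sym) ⟨i⟩).hom, (β_ (⟨1⟩ : Sym) ⟨n⟩).hom)) := bi_jStar_map X _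
  rw [bondMap_eq, e, opn_specOf, ← std_one_shuffle]
  exact (CategoryTheory.Functor.map_comp X.functor _ _).symm

variable (C) in
/-- The object underlying the spectrum of `X` is the restriction of `X`. -/
def toSpectraForget : toSpectra C ⋙ Mod.forget _ ≅ jStar C :=
  NatIso.ofComponents (fun X => Iso.refl ((jStar C).obj X)) fun {X Y} φ => by
    have e : (specMap φ).hom ≫ 𝟙 ((jStar C).obj Y) = 𝟙 ((jStar C).obj X) ≫ (jStar C).map φ := by
      rw [specMap_hom]
      exact (Category.comp_id _).trans (Category.id_comp _).symm
    exact e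

end Bonding

end JSpectra

end

theorem proposition2p1 {C : Type u} [Category.{v} C] [MonoidalCategory C] [SymmetricCategory C]
    [HasColimitsOfSize.{0, 0} C] [∀ X : C, PreservesColimitsOfSize.{0, 0} (tensorLeft X)] :
    ∃ (e : DayFunctor J C ≌ Spectra C) (_ : e.functor.Braided)
      (θ : e.functor ⋙ Mod.forget _ ≅ jStar C),
      (∀ (X : DayFunctor J C) (i n : ℕ),
        bondMap (e.functor.obj X) i n ≫ levMap (θ.hom.app X) (i + 1) (n + 1) =
          levMap (θ.hom.app X) i n ≫ X.functor.map (stdMap i n)) ∧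
      (∀ (X Y : DayFunctor J C) (i n k l : ℕ),
        levTensor (e.functor.obj X).X (e.functor.obj Y).X i n k l ≫
            levMap (tproj (e.functor.obj X) (e.functor.obj Y) ≫
              (Functor.LaxMonoidal.μ e.functor X Y).hom ≫ θ.hom.app (X ⊗ Y)) (i + k) (n + l) =
          (levMap (θ.hom.app X) i n ⊗ₘ levMap (θ.hom.app Y) k l) ≫ dη X Y ⟨i, n⟩ ⟨k, l⟩) := by
  refine ⟨(toSpectra C).asEquivalence, (inferInstance : (toSpectra C).Braided), toSpectraForget C,
    fun X i n => ?_, fun X Y i n k l => ?_⟩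
  · exact (Category.comp_id (bondMap (specOf X) i n)).trans
      ((bondMap_specOf X i n).trans (Category.id_comp (X.functor.map (stdMap i n))).symm)
  · have h := bη_jμ X Y (⟨i⟩, ⟨n⟩) (⟨k⟩, ⟨l⟩)
    have e : tproj (specOf X) (specOf Y) ≫ (specμ X Y).hom ≫ 𝟙 ((jStar C).obj (X ⊗ Y)) = jμ X Y :=
      (congrArg (_ ≫ ·) (Category.comp_id (specμ X Y).hom)).trans (π_specμ X Y)
    rw [← e] at h
    refine Eq.trans h ?_
    have e' : (𝟙 (X.functor.obj ⟨i, n⟩) ⊗ₘ 𝟙 (Y.functor.obj ⟨k, l⟩)) ≫ dη X Y ⟨i, n⟩ ⟨k, l⟩ =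
        dη X Y ⟨i, n⟩ ⟨k, l⟩ := by
      rw [id_tensorHom_id, Category.id_comp]
    exact e'.symm
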